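/- Let $\Sigma$ be a fixed finite alphabet. A cost-enriched finite automaton (CEFA) with $k$ registers is $\mathcal A=(Q,\Sigma,R,\delta,I,F)$ with $R=(r_1,\dots,r_k)$, $I,F\subseteq Q$, and $\delta$ a finite set of transitions $(q,a,q',\eta)$ with $a\in\Sigma$, $\eta\in\mathbb Z^k$. It accepts $(w,v)\in\Sigma^*\times\mathbb Z^k$ if some run on $w$ from $I$ to $F$ has updates $\eta$ summing to $v$; $\mathscr L(\mathcal A)$ is the set of accepted pairs, and such sets are the cost-enriched regular languages (CERLs). A cost-enriched recognisable relation (CERR) is a finite union of products of CERLs. The size $|\mathcal A|$ is $\sum_{(q,a,q',\eta)\in\delta}\bigl(3+\sum_i\lceil\log_2|\eta_i|\rceil\bigr)$ (an entry $0$ contributes $0$), and $\|\mathcal A\|=|\mathcal A|+|Q|+|I|+|F|+k+1$ (which is $O(|\mathcal A|)$ whenever $|Q|,k\le|\mathcal A|$ and $|\mathcal A|\ge 1$). For a finite transducer $\mathcal T$ with transitions $(q,a,q',u)$, $a\in\Sigma$, $u\in\Sigma^*$, put $|\mathcal T|=\sum(3+|u|)$ and let $\|\mathcal T\|$ be $|\mathcal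 T|$ plus the numbers of states, initial states and final states plus $1$; $\mathcal T$ is functional if every input has at most one output. $|e|$ is the number of symbols of a regular expression $e$. Let $f$ be a (possibly partial) function from $(\Sigma^*\times\mathbb Z^{k_1})\times\cdots\times(\Sigma^*\times\mathbb Z^{k_l})$ to $\Sigma^*$ and $D$ a set of arguments. The cost-enriched pre-image over $D$ of $L\subseteq\Sigma^*\times\mathbb Z^k$ under $f$ is said to be CERR-definable if there are a CERR $\mathcal R\subseteq\prod_j(\Sigma^*\times\mathbb Z^{k_j+k})$ and linear integer terms $t=(t_1,\dots,t_k)$, $t_i$ having variables $r_i^{(1)},\dots,r_i^{(l)}$, such that, writing $t(d)$ for the value of $t$ at $r_i^{(j)}=d_{j,i}$ and $(x,d)$ for $((w_j,(c_j,d_j)))_j$ where $x=((w_j,c_j))_j$: (1) $\{(f(x),t(d)) : (x,d)\in\mathcal R,\ f(x)\text{ defined}\}=\{(w,v)\in L : w\in\operatorname{range} f\}$; (2) for every $x\in D$ and $v\in\mathbb Z^k$: there is $d$ with $(x,d)\in\mathcal R$ and $t(d)=v$ if and only if $f(x)$ is defined and $(f(x),v)\in L$; (3) $(x,d)\in\mathcal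 R$ implies $x\in D$. A CEFA representation consists of $t$ and a finite list of $l$-tuples of CEFAs such that the union over the list of the products of their languages is $\mathcal R$. Let $L=\mathscr L(\mathcal A)$. The cost-enriched pre-image of $L$ is CERR-definable for: concatenation; reverse; every functional finite transducer $\mathcal T$; $\mathrm{replaceAll}_{e,u}$ (leftmost and longest matches) for every word $u$ and every regular expression $e$ with $\varepsilon\notin\mathscr L(e)$ (in these four cases $D$ consists of all arguments); and $\mathrm{substring}(y,t_1,t_2)$, with $D=\{(y,t_1,t_2): 0\le t_1,\ 0\le t_2,\ t_1+t_2\le|y|\}$. Here $\mathrm{substring}(y,t_1,t_2)$ is $\varepsilon$ if $t_1<0$, $t_1\ge|y|$ or $t_2\le 0$, and otherwise the factor of $y$ from position $t_1$ to position $\min(t_1+t_2-1,|y|-1)$. Moreover there are programs, depending only on $\Sigma$, which compute CEFA representations of these pre-images from $\mathcal A$ (and $\mathcal T$, or $e$ and $u$), such that both the number of steps and the size of the representation (the sum of $\|\mathcal B\|$ over all CEFAs $\mathcal B$ in it, plus the length of the terms with coefficients in binary) are at most $O(\|\mathcal A\|^2)$ for concatenation; $O(\|\mathcal A\|)$ for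 reverse and for substring; $(\|\mathcal A\|+1)^{O(\|\mathcal T\|)}$ for a functional finite transducer $\mathcal T$ (polynomial in $\mathcal A$ for fixed $\mathcal T$, exponential in $\mathcal T$); $2^{O(|e|)}(\|\mathcal A\|+1)^{O(|u|+1)}$ for $\mathrm{replaceAll}_{e,u}$ (polynomial in $\mathcal A$ for fixed $e,u$, exponential in $|e|$ and $|u|$). Steps are counted in a first-order recursive language over binary trees in which building a pair, taking a component, testing for the empty tree, binding a variable and calling a function take one step each; integers, and the names $0,1,\dots$ of the states, are given in binary, the number of registers in unary, and letters by fixed distinct trees. -/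

import Mathlib

namespace CostEnriched

/-! ### Trees and a first-order functional language with a step count

The machine model: first-order recursive functions over binary trees. The primitives are
building a pair, taking one of its components, testing for the empty tree, binding a local
variable and calling a defined function; each of them costs one step (all of them are
constant-time operations on pointers). Letters of the alphabet, numbers and automata are encoded as
trees; there is no primitive for comparing trees. -/

/-- Binary trees, the only data of the machine model. -/
inductive BinTree : Type where
  | nil : BinTree
  | cons : BinTree → BinTree → BinTree

/-- Expressions. `var i` is the `i`-th most recently bound variable, `call f e` calls the `f`-th
function of the program (all functions are unary, several arguments are passed as a tree). -/
inductive TreeExpr : Type where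
  | var : ℕ → TreeExpr
  | nil : TreeExpr
  | cons : TreeExpr → TreeExpr → TreeExpr
  | hd : TreeExpr → TreeExpr
  | tl : TreeExpr → TreeExpr
  | ite : TreeExpr → TreeExpr → TreeExpr → TreeExpr
  | letIn : TreeExpr → TreeExpr → TreeExpr
  | call : ℕ → TreeExpr → TreeExpr

/-- A program is the list of the bodies of its (mutually recursive) functions;
the function number `0` is the main one. -/
abbrev TreeProgram : Type := List TreeExpr

def BinTree.hd : BinTree → BinTree
  | .nil => .nil
  | .cons a _ => a

def BinTree.tl : BinTree → BinTree
  | .nil => .nil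
  | .cons _ b => b

/-- `Eval P env e v m`: with the functions of `P` and the variables bound to `env`,
the call-by-value evaluation of `e` ends with the value `v` after exactly `m` steps. -/
inductive Eval (P : TreeProgram) : List BinTree → TreeExpr → BinTree → ℕ → Prop where
  | var (env : List BinTree) (i : ℕ) : Eval P env (.var i) (env.getD i .nil) 1
  | nil (env : List BinTree) : Eval P env .nil .nil 1
  | cons {env : List BinTree} {e₁ e₂ : TreeExpr} {v₁ v₂ : BinTree} {m₁ m₂ : ℕ} :
      Eval P env e₁ v₁ m₁ → Eval P env e₂ v₂ m₂ →
      Eval P env (.cons e₁ e₂) (.cons v₁ v₂) (m₁ + m₂ + 1)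
  | hd {env : List BinTree} {e : TreeExpr} {v : BinTree} {m : ℕ} :
      Eval P env e v m → Eval P env (.hd e) v.hd (m + 1)
  | tl {env : List BinTree} {e : TreeExpr} {v : BinTree} {m : ℕ} :
      Eval P env e v m → Eval P env (.tl e) v.tl (m + 1)
  | iteTrue {env : List BinTree} {c e₁ e₂ : TreeExpr} {a b v : BinTree} {m₁ m₂ : ℕ} :
      Eval P env c (.cons a b) m₁ → Eval P env e₁ v m₂ →
      Eval P env (.ite c e₁ e₂) v (m₁ + m₂ + 1)
  | iteFalse {env : List BinTree} {c e₁ e₂ : TreeExpr} {v : BinTree} {m₁ m₂ : ℕ} :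
      Eval P env c .nil m₁ → Eval P env e₂ v m₂ →
      Eval P env (.ite c e₁ e₂) v (m₁ + m₂ + 1)
  | letIn {env : List BinTree} {e₁ e₂ : TreeExpr} {v₁ v₂ : BinTree} {m₁ m₂ : ℕ} :
      Eval P env e₁ v₁ m₁ → Eval P (v₁ :: env) e₂ v₂ m₂ →
      Eval P env (.letIn e₁ e₂) v₂ (m₁ + m₂ + 1)
  | call {env : List BinTree} {f : ℕ} {e body : TreeExpr} {v₁ v₂ : BinTree} {m₁ m₂ : ℕ} :
      Eval P env e v₁ m₁ → P[f]? = some body → Eval P [v₁] body v₂ m₂ →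
      Eval P env (.call f e) v₂ (m₁ + m₂ + 1)

/-- The program `P` maps the input `x` to the output `y` within at most `b` steps. -/
def TreeProgram.OutputsWithin (P : TreeProgram) (x y : BinTree) (b : ℕ) : Prop :=
  ∃ m ≤ b, ∃ body, P[0]? = some body ∧ Eval P [x] body y m

/-! ### Cost-enriched finite automata -/

/-- A cost-enriched finite automaton over the alphabet `α` with `k` cost registers. The states
are `0, …, n - 1`; the finite sets of transitions `(q, a, q', η)`, of initial states and of final
states are presented as lists. -/
structure CEFA (α : Type*) (k : ℕ) where
  n : ℕ
  trans : List (Fin n × α × Fin n × (Fin k → ℤ))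
  init : List (Fin n)
  final : List (Fin n)

/-- `A.Run q w v q'`: there is a run from `q` to `q'` on the string `w`
whose updates of the cost registers sum up to `v`. -/
inductive CEFA.Run {α : Type*} {k : ℕ} (A : CEFA α k) :
    Fin A.n → List α → (Fin k → ℤ) → Fin A.n → Prop where
  | nil (q : Fin A.n) : CEFA.Run A q [] 0 q
  | cons {q q' q'' : Fin A.n} {a : α} {w : List α} {η v : Fin k → ℤ} :
      (q, a, q', η) ∈ A.trans → CEFA.Run A q' w v q'' → CEFA.Run A q (a :: w) (η + v) q''

/-- The cost-enriched language accepted by `A`. -/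
def CEFA.lang {α : Type*} {k : ℕ} (A : CEFA α k) : Set (List α × (Fin k → ℤ)) :=
  {x | ∃ q ∈ A.init, ∃ q' ∈ A.final, A.Run q x.1 x.2 q'}

/-- `∑ ⌈log₂ |η(r)|⌉`, the number of bits of an integer vector (`0` for an entry `0`). -/
def bits {k : ℕ} (η : Fin k → ℤ) : ℕ := ∑ i, Nat.clog 2 (η i).natAbs

/-- The size `|A|`: the sum of the sizes of the transitions, that of `(q, a, q', η)` being
`∑ ⌈log₂ |η(r)|⌉ + 3`. -/
def CEFA.size {α : Type*} {k : ℕ} (A : CEFA α k) : ℕ :=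
  (A.trans.map fun τ => bits τ.2.2.2 + 3).sum

/-- The size `|A|` plus the numbers of states, of listed initial and final states and of registers,
plus one; it is `O(|A|)` as soon as those numbers are. -/
def CEFA.fullSize {α : Type*} {k : ℕ} (A : CEFA α k) : ℕ :=
  A.size + A.n + A.init.length + A.final.length + k + 1

/-- Cost-enriched regular languages. -/
def IsCERL {α : Type*} {k : ℕ} (L : Set (List α × (Fin k → ℤ))) : Prop :=
  ∃ A : CEFA α k, A.lang = L

/-- Cost-enriched recognisable relations: finite unions of products of cost-enriched regular
languages. -/
def IsCERR {α : Type*} {l : ℕ} {ks : Fin l → ℕ}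
    (R : Set ((j : Fin l) → List α × (Fin (ks j) → ℤ))) : Prop :=
  ∃ (n : ℕ) (L : Fin n → (j : Fin l) → Set (List α × (Fin (ks j) → ℤ))),
    (∀ i j, IsCERL (L i j)) ∧ R = ⋃ i, {x | ∀ j, x j ∈ L i j}

/-! ### Cost-enriched pre-images -/

/-- The arguments `((w₁, c₁), …, (w_l, c_l))` of a string function. -/
abbrev Args (α : Type*) {l : ℕ} (ks : Fin l → ℕ) : Type _ :=
  (j : Fin l) → List α × (Fin (ks j) → ℤ)

/-- A (possibly partial) string function, given by its graph: `f x w` says `f(x) = w`. -/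
abbrev StrFun (α : Type*) {l : ℕ} (ks : Fin l → ℕ) : Type _ :=
  Args α ks → List α → Prop

/-- Linear integer terms in the variables `r⁽¹⁾, …, r⁽ˡ⁾`. -/
structure LinTerm (l : ℕ) where
  const : ℤ
  coeff : Fin l → ℤ

def LinTerm.eval {l : ℕ} (t : LinTerm l) (d : Fin l → ℤ) : ℤ :=
  t.const + ∑ j, t.coeff j * d j

/-- The values `tᵢ[dᵢ⁽¹⁾/rᵢ⁽¹⁾, …, dᵢ⁽ˡ⁾/rᵢ⁽ˡ⁾]` of a vector of terms, `tᵢ` having only the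
variables `rᵢ⁽¹⁾, …, rᵢ⁽ˡ⁾`. -/
def evalTerms {l k : ℕ} (t : Fin k → LinTerm l) (d : Fin l → Fin k → ℤ) : Fin k → ℤ :=
  fun i => (t i).eval fun j => d j i

/-- `((w₁, (c₁, d₁)), …, (w_l, (c_l, d_l)))`. -/
def withCosts {α : Type*} {l k : ℕ} {ks : Fin l → ℕ} (x : Args α ks) (d : Fin l → Fin k → ℤ) :
    Args α fun j => ks j + k :=
  fun j => ((x j).1, Fin.append (x j).2 (d j))

/-- `(R, t)` is the cost-enriched pre-image of `L` under `f` over the set `D` of arguments: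
* the costed strings `(f(x), t(d))` with `(x, d)` in `R` are exactly the elements of `L` whose
  string is a value of `f`;
* for every single `x` in `D`, the vectors `t(d)` with `(x, d)` in `R` are exactly the cost vectors
  that `L` admits for the string `f(x)` (none, if `f(x)` is undefined);
* `R` has no elements outside `D`. -/
def IsPreimage {α : Type*} {l k : ℕ} {ks : Fin l → ℕ} (f : StrFun α ks) (D : Set (Args α ks))
    (L : Set (List α × (Fin k → ℤ))) (R : Set (Args α fun j => ks j + k))
    (t : Fin k → LinTerm l) : Prop :=
  (∀ (w : List α) (v : Fin k → ℤ),
    (∃ (x : Args α ks) (d : Fin l → Fin k → ℤ),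
        withCosts x d ∈ R ∧ f x w ∧ v = evalTerms t d) ↔
      (w, v) ∈ L ∧ ∃ x, f x w) ∧
  (∀ x ∈ D, ∀ v : Fin k → ℤ,
    (∃ d : Fin l → Fin k → ℤ, withCosts x d ∈ R ∧ v = evalTerms t d) ↔
      ∃ w, f x w ∧ (w, v) ∈ L) ∧
  (∀ (x : Args α ks) (d : Fin l → Fin k → ℤ), withCosts x d ∈ R → x ∈ D)

/-- The pre-image of `L` under `f` (over `D`) is definable by a cost-enriched recognisable
relation. -/
def CERRDefinable {α : Type*} {l k : ℕ} {ks : Fin l → ℕ} (f : StrFun α ks) (D : Set (Args α ks))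
    (L : Set (List α × (Fin k → ℤ))) : Prop :=
  ∃ (R : Set (Args α fun j => ks j + k)) (t : Fin k → LinTerm l),
    IsCERR R ∧ IsPreimage f D L R t

/-- Candidates for CEFA representations of cost-enriched pre-images: a finite list of tuples of
CEFAs (the first `ks j` registers of the `j`-th one hold the integer arguments of the function)
and a vector of terms. -/
structure PreimageRep (α : Type*) {l : ℕ} (ks : Fin l → ℕ) (k : ℕ) where
  disjuncts : List ((j : Fin l) → CEFA α (ks j + k))
  terms : Fin k → LinTerm l

/-- The relation represented by the tuples of CEFAs. -/
def PreimageRep.rel {α : Type*} {l k : ℕ} {ks : Fin l → ℕ} (B : PreimageRep α ks k) :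
    Set (Args α fun j => ks j + k) :=
  {x | ∃ T ∈ B.disjuncts, ∀ j, x j ∈ (T j).lang}

/-- `B` is a CEFA representation of the pre-image of `L` under `f` over `D`. -/
def PreimageRep.Represents {α : Type*} {l k : ℕ} {ks : Fin l → ℕ} (B : PreimageRep α ks k)
    (f : StrFun α ks) (D : Set (Args α ks)) (L : Set (List α × (Fin k → ℤ))) : Prop :=
  IsPreimage f D L B.rel B.terms

/-- The total size of a representation. -/
def PreimageRep.fullSize {α : Type*} {l k : ℕ} {ks : Fin l → ℕ} (B : PreimageRep α ks k) : ℕ :=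
  (B.disjuncts.map fun T => ∑ j, (T j).fullSize).sum +
    ∑ i, (Nat.clog 2 (B.terms i).const.natAbs + bits (B.terms i).coeff + l + 1)

/-! ### The string functions -/

/-- Concatenation. -/
def concatFun (α : Type*) : StrFun α (fun _ : Fin 2 => 0) :=
  fun x w => w = (x 0).1 ++ (x 1).1

/-- Reverse. -/
def reverseFun (α : Type*) : StrFun α (fun _ : Fin 1 => 0) :=
  fun x w => w = (x 0).1.reverse

/-- The substring of `y` of length `t₂` (or less, if `y` ends before) from position `t₁` on. -/
def substring {α : Type*} (y : List α) (t₁ t₂ : ℤ) : List α :=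
  if t₁ < 0 ∨ (y.length : ℤ) ≤ t₁ ∨ t₂ = 0 then [] else (y.drop t₁.toNat).take t₂.toNat

def substringFun (α : Type*) : StrFun α (fun _ : Fin 1 => 2) :=
  fun x w => w = substring (x 0).1 ((x 0).2 0) ((x 0).2 1)

/-- The arguments `(y, t₁, t₂)` of `substring` that denote a factor of `y`:
`0 ≤ t₁`, `0 ≤ t₂`, `t₁ + t₂ ≤ |y|`. -/
def substringDom (α : Type*) : Set (Args α (fun _ : Fin 1 => 2)) :=
  {x | 0 ≤ (x 0).2 0 ∧ 0 ≤ (x 0).2 1 ∧ (x 0).2 0 + (x 0).2 1 ≤ ((x 0).1.length : ℤ)}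

/-- Nondeterministic finite transducers, with states `0, …, n - 1` and
transitions `(q, a, q', u)`. -/
structure NFT (α : Type*) where
  n : ℕ
  trans : List (Fin n × α × Fin n × List α)
  init : List (Fin n)
  final : List (Fin n)

/-- `T.Run q w u q'`: there is a run from `q` to `q'` on the input `w` with the output `u`. -/
inductive NFT.Run {α : Type*} (T : NFT α) : Fin T.n → List α → List α → Fin T.n → Prop where
  | nil (q : Fin T.n) : NFT.Run T q [] [] q
  | cons {q q' q'' : Fin T.n} {a : α} {w u v : List α} :
      (q, a, q', u) ∈ T.trans → NFT.Run T q' w v q'' → NFT.Run T q (a :: w) (u ++ v) q''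

/-- The transduction defined by `T`. -/
def NFT.rel {α : Type*} (T : NFT α) (w u : List α) : Prop :=
  ∃ q ∈ T.init, ∃ q' ∈ T.final, T.Run q w u q'

/-- `T` is functional (an FFT): its transduction is a partial function. -/
def NFT.Functional {α : Type*} (T : NFT α) : Prop :=
  ∀ w u u', T.rel w u → T.rel w u' → u = u'

/-- The size `|T|`: the sum of the sizes of the transitions,
that of `(q, a, q', u)` being `|u| + 3`. -/
def NFT.size {α : Type*} (T : NFT α) : ℕ := (T.trans.map fun τ => τ.2.2.2.length + 3).sum

/-- The size `|T|` plus the numbers of states and of listed initial and final states,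
plus one. -/
def NFT.fullSize {α : Type*} (T : NFT α) : ℕ :=
  T.size + T.n + T.init.length + T.final.length + 1

def NFT.toFun {α : Type*} (T : NFT α) : StrFun α (fun _ : Fin 1 => 0) :=
  fun x w => T.rel (x 0).1 w

open Classical in
/-- Replace all matches of the language `L` (not containing the empty string) by `u`, with
leftmost and longest matching: if some nonempty prefix belongs to `L`, the longest such prefix is
replaced by `u` and the rest is treated in the same way; otherwise the first letter is kept. -/
noncomputable def replaceAll {α : Type*} (L : Language α) (u : List α) : List α → List α
  | [] => []
  | a :: w =>
    if ∃ m ≤ w.length, (a :: w).take (m + 1) ∈ L then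
      u ++ replaceAll L u
        (w.drop (Nat.findGreatest (fun m => (a :: w).take (m + 1) ∈ L) w.length))
    else a :: replaceAll L u w
  termination_by w => w.length
  decreasing_by
    all_goals simp only [List.length_drop, List.length_cons]; omega

noncomputable def replaceAllFun {α : Type*} (e : RegularExpression α) (u : List α) :
    StrFun α (fun _ : Fin 1 => 0) :=
  fun x w => w = replaceAll e.matches' u (x 0).1

/-- The size of a regular expression: the number of its symbols. -/
def regexSize {α : Type*} : RegularExpression α → ℕ
  | .zero => 1
  | .epsilon => 1
  | .char _ => 1
  | .plus e₁ e₂ => regexSize e₁ + regexSize e₂ + 1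
  | .comp e₁ e₂ => regexSize e₁ + regexSize e₂ + 1
  | .star e => regexSize e + 1

/-! ### Encodings by trees -/

def encList : List BinTree → BinTree
  | [] => .nil
  | x :: xs => .cons x (encList xs)

def encBool : Bool → BinTree
  | false => .nil
  | true => .cons .nil .nil

/-- Natural numbers in binary, least significant bit first. -/
def encNat (m : ℕ) : BinTree := encList (m.bits.map encBool)

/-- Integers: the sign and the absolute value in binary. -/
def encInt (z : ℤ) : BinTree := .cons (encBool (decide (z < 0))) (encNat z.natAbs)

def encVec {k : ℕ} (η : Fin k → ℤ) : BinTree := encList ((List.ofFn η).map encInt)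

/-- Lists of states. -/
def encStates {n : ℕ} (S : List (Fin n)) : BinTree := encList (S.map fun q => encNat q)

def encString {α : Type*} (code : α → BinTree) (w : List α) : BinTree := encList (w.map code)

def encLinTerm {l : ℕ} (t : LinTerm l) : BinTree := .cons (encInt t.const) (encVec t.coeff)

/-- A CEFA is given by its list of states, its number of registers in unary, its transitions and
its initial and final states. -/
def encCEFA {α : Type*} (code : α → BinTree) {k : ℕ} (A : CEFA α k) : BinTree :=
  encList [encStates (List.finRange A.n),
    encList (List.replicate k .nil),
    encList (A.trans.map fun τ =>
      encList [encNat τ.1, code τ.2.1, encNat τ.2.2.1, encVec τ.2.2.2]),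
    encStates A.init,
    encStates A.final]

def encRep {α : Type*} (code : α → BinTree) {l k : ℕ} {ks : Fin l → ℕ} (B : PreimageRep α ks k) :
    BinTree :=
  .cons
    (encList (B.disjuncts.map fun T => encList (List.ofFn fun j => encCEFA code (T j))))
    (encList (List.ofFn fun i => encLinTerm (B.terms i)))

def encNFT {α : Type*} (code : α → BinTree) (T : NFT α) : BinTree :=
  encList [encStates (List.finRange T.n),
    encList (T.trans.map fun τ =>
      encList [encNat τ.1, code τ.2.1, encNat τ.2.2.1, encString code τ.2.2.2]),
    encStates T.init,
    encStates T.final]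

def encRegex {α : Type*} (code : α → BinTree) : RegularExpression α → BinTree
  | .zero => encList [encNat 0]
  | .epsilon => encList [encNat 1]
  | .char a => encList [encNat 2, code a]
  | .plus e₁ e₂ => encList [encNat 3, encRegex code e₁, encRegex code e₂]
  | .comp e₁ e₂ => encList [encNat 4, encRegex code e₁, encRegex code e₂]
  | .star e => encList [encNat 5, encRegex code e]

/-- On the input `x`, the program `P` outputs the encoding of a CEFA representation of the
pre-image of `L` under `f` over `D`, and both the number of steps and the size of the
representation are at most `b`. -/
def ComputesRep {α : Type*} (code : α → BinTree) (P : TreeProgram) (x : BinTree) {l k : ℕ}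
    {ks : Fin l → ℕ} (f : StrFun α ks) (D : Set (Args α ks)) (L : Set (List α × (Fin k → ℤ)))
    (b : ℕ) : Prop :=
  ∃ B : PreimageRep α ks k,
    B.Represents f D L ∧ B.fullSize ≤ b ∧ P.OutputsWithin x (encRep code B) b

end CostEnriched

open CostEnriched

/-!
The pre-images are computed by automata constructions, and the constructions are programmed in the
tree language.

*Constructions.* For concatenation, a run of `A` on `w₁w₂` is cut at the state reached after `w₁`;
there is one pair of automata per state (`concatRep_represents`). For reverse, the transitions are
reversed. For `substring`, two new states read what comes before and after the factor, and two new
registers count the letters before and in the factor (`CEFA.mem_lang_onFactor`). For a transducer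
`T`, the product of `T` and `A` simulates, on a transition of `T` with output `u`, all runs of `A` on
`u` at once (`mem_lang_product`); there are at most `|A| ^ (|u| + 1)` of them, which is why the
exponent of the bound is linear in `T`. In all cases the cost vectors of the components just add up,
and functionality of `T` makes the two descriptions of a pre-image in `IsPreimage` agree
(`isPreimage_of`).

`replaceAll` reduces to transducers. A transducer guesses where matches begin and end. A set of
residuals of the pattern `e` is represented by a marking of the letters of `e`, as in the position
automaton of `e`: `mem_markLang_shift` is its step on one letter. A state holds the marking of the
current match, if any, and a marking of all words that would refute an earlier guess, either by
prolonging a match that has been ended or by starting a match at a letter that has been kept; a run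
dies as soon as such a word is completed. The letterwise description of leftmost longest matching is
in `outsideSpec_cons` and `insideSpec_cons`, the correctness in `replaceNFT_rel`. There are
`2 ^ O(|e|)` markings, and the outputs have length at most `|u| + 1`.

*Programs.* `Comp f t` says that `f` is computed on encodings in `O(t + 1)` steps. Programs are
linked by renumbering functions, so `Comp` is closed under composition, pairing, branching and a
general recursion scheme (`Comp.recursion`), from which list processing follows. The linear and
quadratic bounds are obtained from `Comp` directly. For the exponential bounds it suffices to know
that everything apart from two explicit functions, the list of the runs on a word (`Comp.wordRuns`)
and the list of the markings (`Comp.markings`), is computable in polynomial time (`Poly`), and that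
polynomials in `|T| (|A| + 2) ^ O(|u| + 1)` have the required form (`PolyIn`). Automata,
transducers and representations enter as tuples of lists (`CEFA.raw`, `NFT.raw`,
`PreimageRep.raw`) whose encodings are the prescribed ones.
-/

set_option autoImplicit false
set_option linter.unusedSectionVars false

namespace CostEnriched

/-! ### Linking programs of the tree machine -/

/-- Renumber the functions that an expression calls. -/
def TreeExpr.relocate (g : ℕ → ℕ) : TreeExpr → TreeExpr
  | .var i => .var i
  | .nil => .nil
  | .cons a b => .cons (a.relocate g) (b.relocate g)
  | .hd a => .hd (a.relocate g)
  | .tl a => .tl (a.relocate g)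
  | .ite a b c => .ite (a.relocate g) (b.relocate g) (c.relocate g)
  | .letIn a b => .letIn (a.relocate g) (b.relocate g)
  | .call f a => .call (g f) (a.relocate g)

/-- Renumbering changes neither the value nor the number of steps. -/
theorem Eval.relocate {P P' : TreeProgram} {g : ℕ → ℕ}
    (h : ∀ f body, P[f]? = some body → P'[g f]? = some (body.relocate g))
    {env : List BinTree} {e : TreeExpr} {v : BinTree} {m : ℕ} (he : Eval P env e v m) :
    Eval P' env (e.relocate g) v m := by
  induction he with
  | var env i => exact .var env i
  | nil env => exact .nil env
  | cons _ _ h₁ h₂ => exact .cons h₁ h₂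
  | hd _ h => exact .hd h
  | tl _ h => exact .tl h
  | iteTrue _ _ h₁ h₂ => exact .iteTrue h₁ h₂
  | iteFalse _ _ h₁ h₂ => exact .iteFalse h₁ h₂
  | letIn _ _ h₁ h₂ => exact .letIn h₁ h₂
  | call _ hf _ h₁ h₂ => exact .call h₁ (h _ _ hf) h₂

/-- The function number `i` of `R` maps `x` to `y` in exactly `m` steps. -/
def Runs (R : TreeProgram) (i : ℕ) (x y : BinTree) (m : ℕ) : Prop :=
  ∃ body, R[i]? = some body ∧ Eval R [x] body y m

theorem Runs.call {R : TreeProgram} {i : ℕ} {x y : BinTree} {m m' : ℕ} (h : Runs R i x y m)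
    {env : List BinTree} {e : TreeExpr} (he : Eval R env e x m') :
    Eval R env (.call i e) y (m' + m + 1) := by
  obtain ⟨body, hb, hm⟩ := h
  exact .call he hb hm

/-- The program `P`, renumbered so as to be placed after `n` other functions. -/
def shiftBy (n : ℕ) (P : TreeProgram) : TreeProgram := P.map (TreeExpr.relocate (n + ·))

theorem Runs.embed {P : TreeProgram} {i : ℕ} {x y : BinTree} {m : ℕ} (h : Runs P i x y m)
    (A B : TreeProgram) : Runs (A ++ (shiftBy A.length P ++ B)) (A.length + i) x y m := by
  have key : ∀ f body, P[f]? = some body →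
      (A ++ (shiftBy A.length P ++ B))[A.length + f]? =
        some (body.relocate (A.length + ·)) := by
    intro f body hf
    have hlt : f < P.length := (List.getElem?_eq_some_iff.1 hf).1
    rw [List.getElem?_append_right (by omega), Nat.add_sub_cancel_left,
      List.getElem?_append_left (by simpa [shiftBy] using hlt)]
    simp [shiftBy, hf]
  obtain ⟨body, hb, hm⟩ := h
  exact ⟨_, key _ _ hb, hm.relocate key⟩

/-- The functions `H`, followed by the programs `P` and `Q`, whose main functions get the numbers
`H.length` and `H.length + P.length`. -/
def link (H P Q : TreeProgram) : TreeProgram :=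
  H ++ (shiftBy H.length P ++ shiftBy (H.length + P.length) Q)

theorem link_head {H P Q : TreeProgram} {i : ℕ} {body : TreeExpr} (h : H[i]? = some body) :
    (link H P Q)[i]? = some body := by
  rw [link, List.getElem?_append_left (List.getElem?_eq_some_iff.1 h).1, h]

theorem link_fst {H P Q : TreeProgram} {x y : BinTree} {m : ℕ} (h : Runs P 0 x y m) :
    Runs (link H P Q) H.length x y m :=
  h.embed H _

theorem link_snd {H P Q : TreeProgram} {x y : BinTree} {m : ℕ} (h : Runs Q 0 x y m) :
    Runs (link H P Q) (H.length + P.length) x y m := by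
  have := h.embed (H ++ shiftBy H.length P) []
  simpa [link, shiftBy, List.append_assoc] using this

/-! ### Encodings of data and computability with a time bound -/

/-- Data types with an encoding by trees. -/
class TreeEnc (β : Type*) where
  toTree : β → BinTree

/-- The encoding of a datum. -/
abbrev enc {β : Type*} [TreeEnc β] (b : β) : BinTree := TreeEnc.toTree b

instance : TreeEnc BinTree := ⟨id⟩
instance : TreeEnc Unit := ⟨fun _ => .nil⟩
instance : TreeEnc Bool := ⟨encBool⟩
instance : TreeEnc ℕ := ⟨encNat⟩
instance : TreeEnc ℤ := ⟨encInt⟩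
instance {β γ : Type*} [TreeEnc β] [TreeEnc γ] : TreeEnc (β × γ) :=
  ⟨fun p => .cons (enc p.1) (enc p.2)⟩
instance {β : Type*} [TreeEnc β] : TreeEnc (List β) := ⟨fun l => encList (l.map enc)⟩

section
variable {β γ δ ε : Type*} [TreeEnc β] [TreeEnc γ] [TreeEnc δ] [TreeEnc ε]

@[simp] theorem enc_tree (x : BinTree) : enc x = x := rfl
@[simp] theorem enc_unit (x : Unit) : enc x = BinTree.nil := rfl
@[simp] theorem enc_false : enc false = BinTree.nil := rfl
@[simp] theorem enc_true : enc true = BinTree.cons .nil .nil := rfl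
@[simp] theorem enc_pair (x : β) (y : γ) : enc (x, y) = BinTree.cons (enc x) (enc y) := rfl
@[simp] theorem enc_nil : enc ([] : List β) = BinTree.nil := rfl
@[simp] theorem enc_cons (x : β) (l : List β) : enc (x :: l) = BinTree.cons (enc x) (enc l) := rfl
theorem enc_prod (p : β × γ) : enc p = BinTree.cons (enc p.1) (enc p.2) := rfl

/-- `f` is computed in the encodings by some program, in time `O(t + 1)`. -/
def Comp (f : β → γ) (t : β → ℕ) : Prop :=
  ∃ (P : TreeProgram) (c : ℕ), ∀ b, ∃ m ≤ c * (t b + 1), Runs P 0 (enc b) (enc (f b)) m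

/-- Constant factors and summands of the time are irrelevant. -/
theorem Comp.mono {f : β → γ} {t t' : β → ℕ} (h : Comp f t) (K : ℕ)
    (ht : ∀ b, t b ≤ K * (t' b + 1)) : Comp f t' := by
  obtain ⟨P, c, h⟩ := h
  refine ⟨P, c * (K + 1), fun b => ?_⟩
  obtain ⟨m, hm, hr⟩ := h b
  refine ⟨m, hm.trans ?_, hr⟩
  rw [mul_assoc]
  exact Nat.mul_le_mul_left _ (by nlinarith [ht b])

/-- Changing the type of a datum but not its encoding costs nothing. -/
theorem Comp.of_enc_eq {f : β → γ} (h : ∀ b, enc (f b) = enc b) : Comp f fun _ => 0 :=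
  ⟨[.var 0], 1, fun b => ⟨1, by simp, _, rfl, by simpa [h b] using Eval.var [enc b] 0⟩⟩

theorem Comp.id : Comp (fun b : β => b) fun _ => 0 := .of_enc_eq fun _ => rfl

theorem Comp.of_hd {f : β → γ} (h : ∀ b, enc (f b) = (enc b).hd) : Comp f fun _ => 0 :=
  ⟨[.hd (.var 0)], 2, fun b => ⟨2, by simp, _, rfl, by
    simpa [h b] using Eval.hd (Eval.var [enc b] 0)⟩⟩

theorem Comp.of_tl {f : β → γ} (h : ∀ b, enc (f b) = (enc b).tl) : Comp f fun _ => 0 :=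
  ⟨[.tl (.var 0)], 2, fun b => ⟨2, by simp, _, rfl, by
    simpa [h b] using Eval.tl (Eval.var [enc b] 0)⟩⟩

theorem Comp.comp {f : β → γ} {g : γ → δ} {t : β → ℕ} {s : γ → ℕ} (hg : Comp g s)
    (hf : Comp f t) : Comp (fun b => g (f b)) fun b => t b + s (f b) := by
  obtain ⟨P, c, hP⟩ := hf
  obtain ⟨Q, d, hQ⟩ := hg
  let H : TreeProgram := [.call (1 + P.length) (.call 1 (.var 0))]
  refine ⟨link H P Q, c + d + 3, fun b => ?_⟩
  obtain ⟨m, hm, h₁⟩ := hP b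
  obtain ⟨n, hn, h₂⟩ := hQ (f b)
  have h₁ := link_fst (H := H) (Q := Q) h₁
  have h₂ := link_snd (H := H) (P := P) h₂
  refine ⟨_, ?_, _, link_head (H := H) (i := 0) rfl, h₂.call (h₁.call (Eval.var _ 0))⟩
  nlinarith

theorem Comp.pair {f : β → γ} {g : β → δ} {t : β → ℕ} {s : β → ℕ} (hf : Comp f t)
    (hg : Comp g s) : Comp (fun b => (f b, g b)) fun b => t b + s b := by
  obtain ⟨P, c, hP⟩ := hf
  obtain ⟨Q, d, hQ⟩ := hg
  let H : TreeProgram := [.cons (.call 1 (.var 0)) (.call (1 + P.length) (.var 0))]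
  refine ⟨link H P Q, c + d + 5, fun b => ?_⟩
  obtain ⟨m, hm, h₁⟩ := hP b
  obtain ⟨n, hn, h₂⟩ := hQ b
  have h₁ := link_fst (H := H) (Q := Q) h₁
  have h₂ := link_snd (H := H) (P := P) h₂
  refine ⟨_, ?_, _, link_head (H := H) (i := 0) rfl,
    (h₁.call (Eval.var _ 0)).cons (h₂.call (Eval.var _ 0))⟩
  nlinarith

theorem Comp.fst : Comp (fun p : β × γ => p.1) fun _ => 0 := .of_hd fun _ => rfl
theorem Comp.snd : Comp (fun p : β × γ => p.2) fun _ => 0 := .of_tl fun _ => rfl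

theorem Comp.const (y : γ) : Comp (fun _ : β => y) fun _ => 0 := by
  have key : ∀ x : BinTree, ∃ (e : TreeExpr) (c : ℕ), ∀ P env, Eval P env e x c := by
    intro x
    induction x with
    | nil => exact ⟨.nil, 1, fun _ _ => .nil _⟩
    | cons a b ha hb =>
      obtain ⟨e, c, h⟩ := ha
      obtain ⟨e', c', h'⟩ := hb
      exact ⟨.cons e e', c + c' + 1, fun P env => .cons (h P env) (h' P env)⟩
  obtain ⟨e, c, h⟩ := key (enc y)
  exact ⟨[e], c, fun b => ⟨c, by simp, e, rfl, h _ _⟩⟩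

/-- Branching on the pair of a condition and an argument. -/
theorem Comp.cond_pair {f g : β → γ} {t s : β → ℕ} (hf : Comp f t) (hg : Comp g s) :
    Comp (fun p : Bool × β => bif p.1 then f p.2 else g p.2)
      fun p => bif p.1 then t p.2 else s p.2 := by
  obtain ⟨P, c, hP⟩ := hf
  obtain ⟨Q, d, hQ⟩ := hg
  let H : TreeProgram :=
    [.ite (.hd (.var 0)) (.call 1 (.tl (.var 0))) (.call (1 + P.length) (.tl (.var 0)))]
  refine ⟨link H P Q, c + d + 6, ?_⟩
  rintro ⟨b, x⟩
  cases b with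
  | true =>
    obtain ⟨m, hm, h₁⟩ := hP x
    have h₁ := link_fst (H := H) (Q := Q) h₁
    refine ⟨_, ?_, _, link_head (H := H) (i := 0) rfl, Eval.iteTrue (a := .nil) (b := .nil)
      (Eval.hd (Eval.var _ 0)) (h₁.call (Eval.tl (Eval.var [enc (true, x)] 0)))⟩
    simp only [cond_true]
    nlinarith
  | false =>
    obtain ⟨m, hm, h₁⟩ := hQ x
    have h₁ := link_snd (H := H) (P := P) h₁
    refine ⟨_, ?_, _, link_head (H := H) (i := 0) rfl, Eval.iteFalse
      (Eval.hd (Eval.var _ 0)) (h₁.call (Eval.tl (Eval.var [enc (false, x)] 0)))⟩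
    simp only [cond_false]
    nlinarith

theorem Comp.cond {c : β → Bool} {f g : β → γ} {r t s : β → ℕ} (hc : Comp c r) (hf : Comp f t)
    (hg : Comp g s) :
    Comp (fun b => bif c b then f b else g b) fun b => r b + bif c b then t b else s b :=
  ((Comp.cond_pair hf hg).comp (hc.pair .id)).mono 1 fun b => by simp

/-- General recursion: `F b` is computed from the values of `F` at the arguments `ds b`; `T` is
any solution of the recurrence for the time. -/
theorem Comp.recursion {F : β → γ} {ds : β → List β} {post : β × List γ → γ} {t : β → ℕ}
    {s : β × List γ → ℕ} (hds : Comp ds t) (hpost : Comp post s)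
    (hF : ∀ b, F b = post (b, (ds b).map F)) {T : β → ℕ}
    (hT : ∀ b, t b + s (b, (ds b).map F) + 1 + ((ds b).map T).sum ≤ T b) : Comp F T := by
  obtain ⟨P, c, hP⟩ := hds
  obtain ⟨Q, d, hQ⟩ := hpost
  -- Function `1` maps function `0` over a list.
  let H : TreeProgram :=
    [.call (2 + P.length) (.cons (.var 0) (.call 1 (.call 2 (.var 0)))),
      .ite (.var 0) (.cons (.call 0 (.hd (.var 0))) (.call 1 (.tl (.var 0)))) .nil]
  have h0 := link_head (H := H) (P := P) (Q := Q) (i := 0) rfl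
  have h1 := link_head (H := H) (P := P) (Q := Q) (i := 1) rfl
  set R := link H P Q with hR
  -- The `9` steps around each recursive call are charged to that call.
  have main : ∀ n b, T b = n → ∃ m, m + 9 ≤ (c + d + 18) * T b ∧ Runs R 0 (enc b) (enc (F b)) m := by
    intro n
    induction n using Nat.strong_induction_on with
    | _ n ih =>
      intro b hb
      have hmap : ∀ l : List β, (∀ x ∈ l, T x < n) →
          ∃ m, m ≤ 3 + (c + d + 18) * (l.map T).sum ∧ Runs R 1 (enc l) (enc (l.map F)) m := by
        intro l
        induction l with
        | nil =>
          exact fun _ => ⟨3, by simp, _, h1, Eval.iteFalse (Eval.var _ 0) (Eval.nil _)⟩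
        | cons x l ihl =>
          intro hl
          obtain ⟨m, hm, hr⟩ := ihl fun y hy => hl y (List.mem_cons_of_mem _ hy)
          obtain ⟨m', hm', hr'⟩ := ih _ (hl x List.mem_cons_self) x rfl
          refine ⟨_, ?_, _, h1, Eval.iteTrue (Eval.var _ 0)
            ((hr'.call (Eval.hd (Eval.var _ 0))).cons (hr.call (Eval.tl (Eval.var _ 0))))⟩
          simp only [List.map_cons, List.sum_cons]
          nlinarith
      obtain ⟨m₁, hm₁, hr₁⟩ := hP b
      obtain ⟨m₃, hm₃, hr₃⟩ := hQ (b, (ds b).map F)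
      have hr₁ := link_fst (H := H) (Q := Q) hr₁
      have hr₃ := link_snd (H := H) (P := P) hr₃
      have hlt : ∀ x ∈ ds b, T x < n := by
        intro x hx
        have := List.single_le_sum (l := (ds b).map T) (by simp) _ (List.mem_map_of_mem hx)
        have := hT b
        omega
      obtain ⟨m₂, hm₂, hr₂⟩ := hmap _ hlt
      have hr := hr₃.call ((Eval.var [enc b] 0).cons (hr₂.call (hr₁.call (Eval.var [enc b] 0))))
      rw [← hF b] at hr
      refine ⟨_, ?_, _, h0, hr⟩
      have := Nat.mul_le_mul_left (c + d + 18) (hT b)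
      nlinarith
  refine ⟨R, c + d + 18, fun b => ?_⟩
  obtain ⟨m, hm, hr⟩ := main _ b rfl
  exact ⟨m, by nlinarith, hr⟩

end

/-! ### List processing -/

section
variable {β γ δ ε ρ : Type*} [TreeEnc β] [TreeEnc γ] [TreeEnc δ] [TreeEnc ε] [TreeEnc ρ]

theorem Comp.cons {f : β → γ} {g : β → List γ} {t s : β → ℕ} (hf : Comp f t) (hg : Comp g s) :
    Comp (fun b => f b :: g b) fun b => t b + s b :=
  ((Comp.of_enc_eq (f := fun p : γ × List γ => p.1 :: p.2) fun _ => rfl).comp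
    (hf.pair hg)).mono 1 fun b => by simp

theorem Comp.tail : Comp (fun l : List β => l.tail) fun _ => 0 :=
  .of_tl fun l => by cases l <;> rfl

/-- Case distinction on a list. -/
def listCase (l : List δ) (z : γ) (s : δ → List δ → γ) : γ :=
  match l with
  | [] => z
  | x :: xs => s x xs

@[simp] theorem listCase_nil (z : γ) (s : δ → List δ → γ) : listCase [] z s = z := rfl
@[simp] theorem listCase_cons (x : δ) (xs : List δ) (z : γ) (s : δ → List δ → γ) :
    listCase (x :: xs) z s = s x xs := rfl

theorem Comp.list_case_pair {z : β → γ} {s : β × δ × List δ → γ} {t : β → ℕ}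
    {r : β × δ × List δ → ℕ} (hz : Comp z t) (hs : Comp s r) :
    Comp (fun p : β × List δ => listCase p.2 (z p.1) fun x xs => s (p.1, x, xs))
      fun p => listCase p.2 (t p.1) fun x xs => r (p.1, x, xs) := by
  obtain ⟨P, c, hP⟩ := hs
  obtain ⟨Q, d, hQ⟩ := hz
  let H : TreeProgram :=
    [.ite (.tl (.var 0)) (.call 1 (.var 0)) (.call (1 + P.length) (.hd (.var 0)))]
  refine ⟨link H P Q, c + d + 6, ?_⟩
  rintro ⟨b, _ | ⟨x, xs⟩⟩
  · obtain ⟨m, hm, h₁⟩ := hQ b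
    have h₁ := link_snd (H := H) (P := P) h₁
    refine ⟨_, ?_, _, link_head (H := H) (i := 0) rfl, Eval.iteFalse
      (Eval.tl (Eval.var _ 0)) (h₁.call (Eval.hd (Eval.var [enc (b, ([] : List δ))] 0)))⟩
    simp only [listCase_nil]
    nlinarith
  · obtain ⟨m, hm, h₁⟩ := hP (b, x, xs)
    have h₁ := link_fst (H := H) (Q := Q) h₁
    refine ⟨_, ?_, _, link_head (H := H) (i := 0) rfl, Eval.iteTrue (a := enc x) (b := enc xs)
      (Eval.tl (Eval.var _ 0)) (h₁.call (Eval.var [enc (b, x :: xs)] 0))⟩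
    simp only [listCase_cons]
    nlinarith

theorem Comp.list_case {l : β → List δ} {z : β → γ} {s : β → δ → List δ → γ} {r t : β → ℕ}
    {u : β × δ × List δ → ℕ} (hl : Comp l r) (hz : Comp z t)
    (hs : Comp (fun p : β × δ × List δ => s p.1 p.2.1 p.2.2) u) :
    Comp (fun b => listCase (l b) (z b) (s b))
      fun b => r b + listCase (l b) (t b) fun x xs => u (b, x, xs) :=
  ((Comp.list_case_pair hz hs).comp (Comp.id.pair hl)).mono 1 fun b => by simp

/-- Structural recursion on a list, with a parameter. -/
theorem Comp.listRec {F : ρ × List δ → γ} {z : ρ → γ} {s : ρ × δ × List δ × γ → γ} {t : ρ → ℕ}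
    {u : ρ × δ × List δ × γ → ℕ} (hz : Comp z t) (hs : Comp s u)
    (h0 : ∀ p, F (p, []) = z p) (h1 : ∀ p x xs, F (p, x :: xs) = s (p, x, xs, F (p, xs)))
    {T : ρ × List δ → ℕ} (hT0 : ∀ p, t p ≤ T (p, []))
    (hT1 : ∀ p x xs, u (p, x, xs, F (p, xs)) + 1 + T (p, xs) ≤ T (p, x :: xs)) : Comp F T := by
  have hds : Comp (fun b : ρ × List δ => listCase b.2 [] fun _ xs => [(b.1, xs)])
      fun _ => 0 :=
    (Comp.list_case .snd (.const [])
      (Comp.cons ((Comp.fst.comp .fst).pair (Comp.snd.comp .snd)) (.const []))).mono 1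
      fun b => by rcases b with ⟨p, _ | ⟨x, xs⟩⟩ <;> simp
  have hpost : Comp (fun b : (ρ × List δ) × List γ => listCase b.1.2 (z b.1.1)
      fun x xs => listCase b.2 (z b.1.1) fun y _ => s (b.1.1, x, xs, y))
      fun b => listCase b.1.2 (t b.1.1)
      fun x xs => listCase b.2 (t b.1.1) fun y _ => u (b.1.1, x, xs, y) := by
    have h₁ : Comp (fun b : (((ρ × List δ) × List γ) × δ × List δ) × γ × List γ =>
        s (b.1.1.1.1, b.1.2.1, b.1.2.2, b.2.1)) fun b => u (b.1.1.1.1, b.1.2.1, b.1.2.2, b.2.1) :=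
      (hs.comp ((Comp.fst.comp (Comp.fst.comp (Comp.fst.comp .fst))).pair
        ((Comp.fst.comp (Comp.snd.comp .fst)).pair
          ((Comp.snd.comp (Comp.snd.comp .fst)).pair (Comp.fst.comp .snd))))).mono 1
        fun b => by simp
    refine (Comp.list_case (Comp.snd.comp .fst) (hz.comp (Comp.fst.comp .fst))
      (Comp.list_case (Comp.snd.comp .fst) (hz.comp (Comp.fst.comp (Comp.fst.comp .fst)))
        h₁)).mono 1 ?_
    rintro ⟨⟨p, _ | ⟨x, xs⟩⟩, _ | ⟨y, ys⟩⟩ <;> simp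
  refine (Comp.recursion hds hpost (F := F) (T := fun b => T b + 1) ?_ ?_).mono 1 fun b => by simp
  · rintro ⟨p, _ | ⟨x, xs⟩⟩
    · simp [h0]
    · simp [h1]
  · rintro ⟨p, _ | ⟨x, xs⟩⟩
    · simpa using hT0 p
    · simpa [← add_assoc] using hT1 p x xs

theorem Comp.map_pair {f : ρ × δ → γ} {t : ρ × δ → ℕ} (hf : Comp f t) :
    Comp (fun b : ρ × List δ => b.2.map fun x => f (b.1, x))
      fun b => (b.2.map fun x => t (b.1, x) + 1).sum := by
  refine Comp.listRec (.const []) (s := fun b => f (b.1, b.2.1) :: b.2.2.2)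
    (Comp.cons (hf.comp (Comp.fst.pair (Comp.fst.comp .snd)))
      (Comp.snd.comp (Comp.snd.comp .snd)))
    (fun _ => rfl) (fun _ _ _ => rfl) (fun _ => by simp) fun p x xs => by simp

theorem Comp.map {l : β → List δ} {f : β → δ → γ} {s : β → ℕ} {t : β × δ → ℕ}
    (hf : Comp (fun p : β × δ => f p.1 p.2) t) (hl : Comp l s) :
    Comp (fun b => (l b).map (f b)) fun b => s b + ((l b).map fun x => t (b, x) + 1).sum :=
  ((Comp.map_pair hf).comp (Comp.id.pair hl)).mono 1 fun b => by simp

theorem Comp.append {f g : β → List γ} {t s : β → ℕ} (hf : Comp f t) (hg : Comp g s) :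
    Comp (fun b => f b ++ g b) fun b => t b + s b + (f b).length := by
  have h : Comp (fun p : List γ × List γ => p.2 ++ p.1) fun p => p.2.length := by
    refine Comp.listRec .id (s := fun b => b.2.1 :: b.2.2.2)
      (Comp.cons (Comp.fst.comp .snd) (Comp.snd.comp (Comp.snd.comp .snd)))
      (fun _ => rfl) (fun _ _ _ => rfl) (fun _ => by simp) fun p x xs => by simp; omega
  exact (h.comp (hg.pair hf)).mono 1 fun b => by simp; omega

/-! ### Sizes, and polynomial time -/

/-- The number of nodes of a tree. -/
def BinTree.size : BinTree → ℕ
  | .nil => 1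
  | .cons a b => a.size + b.size + 1

/-- The size of the encoding of a datum. -/
def sz (b : β) : ℕ := (enc b).size

@[simp] theorem sz_pair (p : β × γ) : sz p = sz p.1 + sz p.2 + 1 := rfl
@[simp] theorem sz_nil : sz ([] : List β) = 1 := rfl
@[simp] theorem sz_cons (x : β) (l : List β) : sz (x :: l) = sz x + sz l + 1 := rfl
@[simp] theorem sz_unit (x : Unit) : sz x = 1 := rfl

theorem one_le_sz (b : β) : 1 ≤ sz b := by
  unfold sz; cases enc b <;> simp [BinTree.size]

theorem length_lt_sz (l : List β) : l.length < sz l := by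
  induction l with
  | nil => simp
  | cons x l ih => simp; omega

theorem sz_lt_of_mem {x : β} {l : List β} (h : x ∈ l) : sz x < sz l := by
  induction l with
  | nil => simp at h
  | cons y l ih =>
    rcases List.mem_cons.1 h with rfl | h
    · rw [sz_cons]; omega
    · have := ih h; simp; omega

theorem sz_list_eq (l : List β) : sz l = (l.map fun x => sz x + 1).sum + 1 := by
  induction l with
  | nil => simp
  | cons x l ih => simp [ih]; omega

theorem sz_list_le {l : List β} {M : ℕ} (h : ∀ x ∈ l, sz x ≤ M) :
    sz l ≤ l.length * (M + 1) + 1 := by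
  rw [sz_list_eq]
  have := List.sum_le_card_nsmul (l.map fun x => sz x + 1) (M + 1) (by simpa using h)
  simpa using this

/-- `h` is bounded by a polynomial in the size of its argument. -/
def PolyBd (h : β → ℕ) : Prop := ∃ c, ∀ b, h b ≤ (sz b + 1) ^ c

theorem PolyBd.mono {h h' : β → ℕ} (hh : PolyBd h') (hle : ∀ b, h b ≤ h' b) : PolyBd h :=
  let ⟨c, hc⟩ := hh
  ⟨c, fun b => (hle b).trans (hc b)⟩

theorem PolyBd.const (n : ℕ) : PolyBd fun _ : β => n := by
  refine ⟨n, fun b => ?_⟩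
  have h1 := one_le_sz b
  calc n ≤ 2 ^ n := Nat.lt_two_pow_self.le
    _ ≤ (sz b + 1) ^ n := Nat.pow_le_pow_left (by omega) n

theorem PolyBd.size : PolyBd fun b : β => sz b := ⟨1, fun b => by simp⟩

theorem PolyBd.mul {h h' : β → ℕ} (hh : PolyBd h) (hh' : PolyBd h') :
    PolyBd fun b => h b * h' b := by
  obtain ⟨c, hc⟩ := hh
  obtain ⟨d, hd⟩ := hh'
  exact ⟨c + d, fun b => by rw [pow_add]; exact Nat.mul_le_mul (hc b) (hd b)⟩

theorem PolyBd.add {h h' : β → ℕ} (hh : PolyBd h) (hh' : PolyBd h') :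
    PolyBd fun b => h b + h' b := by
  obtain ⟨c, hc⟩ := hh
  obtain ⟨d, hd⟩ := hh'
  refine ⟨c + d + 1, fun b => ?_⟩
  have h1 := one_le_sz b
  have h3 : (sz b + 1) ^ c ≤ (sz b + 1) ^ (c + d) := Nat.pow_le_pow_right (by omega) (by omega)
  have h4 : (sz b + 1) ^ d ≤ (sz b + 1) ^ (c + d) := Nat.pow_le_pow_right (by omega) (by omega)
  rw [pow_succ]
  have h5 := hc b
  have h6 := hd b
  have h7 : 0 < (sz b + 1) ^ (c + d) := by positivity
  simp only
  nlinarith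

/-- A bound at an argument of polynomial size. -/
theorem PolyBd.subst {h : γ → ℕ} {w f : β → ℕ} (hh : PolyBd h) (hw : PolyBd w)
    (hf : ∀ b, f b = 0 ∨ ∃ y, f b ≤ h y ∧ sz y ≤ w b) : PolyBd f := by
  obtain ⟨c, hc⟩ := hh
  obtain ⟨d, hd⟩ := hw.add (.const 1)
  refine ⟨d * c, fun b => ?_⟩
  obtain h0 | ⟨y, h1, h2⟩ := hf b
  · simp [h0]
  rw [pow_mul]
  exact h1.trans ((hc y).trans (Nat.pow_le_pow_left ((Nat.add_le_add_right h2 1).trans (hd b)) c))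

/-- `f` is computable in polynomial time, with results of polynomial size. The second condition
does not follow from the first one, as trees may share subtrees. -/
@[fun_prop]
def Poly (f : β → γ) : Prop :=
  (∃ t, PolyBd t ∧ Comp f t) ∧ PolyBd fun b => sz (f b)

theorem Poly.congr {f f' : β → γ} (h : Poly f) (hf : ∀ b, f b = f' b) : Poly f' := by
  rwa [← funext hf]

@[fun_prop]
theorem Poly.id : Poly (fun b : β => b) := ⟨⟨_, .const 0, .id⟩, .size⟩

theorem Poly.of_enc_eq {f : β → γ} (h : ∀ b, enc (f b) = enc b) : Poly f :=
  ⟨⟨_, .const 0, .of_enc_eq h⟩, PolyBd.size.mono fun b => by simp [sz, h]⟩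

@[fun_prop]
theorem Poly.const (y : γ) : Poly (fun _ : β => y) := ⟨⟨_, .const 0, .const y⟩, .const _⟩

@[fun_prop]
theorem Poly.comp {f : β → γ} {g : γ → δ} (hg : Poly g) (hf : Poly f) :
    Poly (fun b => g (f b)) := by
  obtain ⟨⟨s, hs, hg⟩, hg'⟩ := hg
  obtain ⟨⟨t, ht, hf⟩, hf'⟩ := hf
  exact ⟨⟨_, ht.add (hs.subst hf' fun b => .inr ⟨f b, le_rfl, le_rfl⟩), hg.comp hf⟩,
    hg'.subst hf' fun b => .inr ⟨f b, le_rfl, le_rfl⟩⟩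

@[fun_prop]
theorem Poly.pair {f : β → γ} {g : β → δ} (hf : Poly f) (hg : Poly g) :
    Poly (fun b => (f b, g b)) := by
  obtain ⟨⟨s, hs, hg⟩, hg'⟩ := hg
  obtain ⟨⟨t, ht, hf⟩, hf'⟩ := hf
  exact ⟨⟨_, ht.add hs, hf.pair hg⟩, (hf'.add hg').add (.const 1)⟩

@[fun_prop]
theorem Poly.fst : Poly (fun p : β × γ => p.1) :=
  ⟨⟨_, .const 0, .fst⟩, PolyBd.size.mono fun b => by simp; omega⟩

@[fun_prop]
theorem Poly.snd : Poly (fun p : β × γ => p.2) :=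
  ⟨⟨_, .const 0, .snd⟩, PolyBd.size.mono fun b => by simp; omega⟩

@[fun_prop]
theorem Poly.cond {c : β → Bool} {f g : β → γ} (hc : Poly c) (hf : Poly f) (hg : Poly g) :
    Poly (fun b => bif c b then f b else g b) := by
  obtain ⟨⟨r, hr, hc⟩, _⟩ := hc
  obtain ⟨⟨t, ht, hf⟩, hf'⟩ := hf
  obtain ⟨⟨s, hs, hg⟩, hg'⟩ := hg
  refine ⟨⟨_, (hr.add (ht.add hs)).mono fun b => ?_, hc.cond hf hg⟩,
    (hf'.add hg').mono fun b => ?_⟩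
  · cases c b <;> simp
  · simp only
    cases c b <;> simp

@[fun_prop]
theorem Poly.cons {f : β → γ} {g : β → List γ} (hf : Poly f) (hg : Poly g) :
    Poly (fun b => f b :: g b) :=
  (Poly.of_enc_eq (f := fun p : γ × List γ => p.1 :: p.2) fun _ => rfl).comp (hf.pair hg)

@[fun_prop]
theorem Poly.tail {f : β → List γ} (hf : Poly f) : Poly (fun b => (f b).tail) :=
  Poly.comp (g := List.tail) ⟨⟨_, .const 0, .tail⟩, PolyBd.size.mono fun l => by
    cases l <;> simp; omega⟩ hf

theorem Poly.list_case {l : β → List δ} {z : β → γ} {s : β → δ → List δ → γ} (hl : Poly l)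
    (hz : Poly z) (hs : Poly (fun p : β × δ × List δ => s p.1 p.2.1 p.2.2)) :
    Poly (fun b => listCase (l b) (z b) (s b)) := by
  obtain ⟨⟨r, hr, hl⟩, hl'⟩ := hl
  obtain ⟨⟨t, ht, hz⟩, hz'⟩ := hz
  obtain ⟨⟨u, hu, hs⟩, hs'⟩ := hs
  have hw : PolyBd fun b : β => sz b + sz (l b) + 1 :=
    (PolyBd.size.add hl').add (.const 1)
  have key : ∀ {h : β × δ × List δ → ℕ} {h' : β → ℕ}, PolyBd h → PolyBd h' →
      PolyBd fun b => listCase (l b) (h' b) fun x xs => h (b, x, xs) := by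
    intro h h' hh hh'
    refine (hh'.add (hh.subst hw (f := fun b => listCase (l b) 0
      fun x xs => h (b, x, xs)) fun b => ?_)).mono fun b => ?_
    · cases hlb : l b with
      | nil => exact .inl rfl
      | cons x xs => exact .inr ⟨(b, x, xs), le_rfl, le_rfl⟩
    · cases l b <;> simp
  refine ⟨⟨_, hr.add (key hu ht), hl.list_case hz hs⟩, (key hs' hz').mono fun b => ?_⟩
  simp only
  cases l b <;> simp

/-- The bound for a sum over the elements of a list. -/
theorem PolyBd.list_sum {l : β → List δ} {h : β × δ → ℕ} (hl : PolyBd fun b => sz (l b))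
    (hh : PolyBd h) : PolyBd fun b => ((l b).map fun x => h (b, x)).sum := by
  have hh' := hh
  obtain ⟨c, hc⟩ := hh
  have hw : PolyBd fun b => (sz b + sz (l b) + 2) ^ c := by
    obtain ⟨d, hd⟩ := (PolyBd.size.add hl).add (.const 2)
    exact ⟨d * c, fun b => by rw [pow_mul]; exact Nat.pow_le_pow_left (hd b) c⟩
  refine (hl.mul hw).mono fun b => ?_
  refine (List.sum_le_card_nsmul _ ((sz b + sz (l b) + 2) ^ c) ?_).trans ?_
  · simp only [List.mem_map]
    rintro _ ⟨x, hx, rfl⟩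
    refine (hc (b, x)).trans (Nat.pow_le_pow_left ?_ c)
    have := sz_lt_of_mem hx
    simp; omega
  · simp only [List.length_map, smul_eq_mul]
    exact Nat.mul_le_mul_right _ (length_lt_sz _).le

@[fun_prop]
theorem Poly.append {f g : β → List γ} (hf : Poly f) (hg : Poly g) :
    Poly (fun b => f b ++ g b) := by
  obtain ⟨⟨t, ht, hf⟩, hf'⟩ := hf
  obtain ⟨⟨s, hs, hg⟩, hg'⟩ := hg
  refine ⟨⟨_, (ht.add hs).add (hf'.mono fun b => (length_lt_sz _).le), hf.append hg⟩,
    (hf'.add hg').mono fun b => ?_⟩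
  simp only [sz_list_eq, List.map_append, List.sum_append]
  omega

theorem Poly.map {l : β → List δ} {f : β → δ → γ} (hf : Poly (fun p : β × δ => f p.1 p.2))
    (hl : Poly l) : Poly (fun b => (l b).map (f b)) := by
  obtain ⟨⟨t, ht, hf⟩, hf'⟩ := hf
  obtain ⟨⟨s, hs, hl⟩, hl'⟩ := hl
  refine ⟨⟨_, hs.add (hl'.list_sum (ht.add (.const 1))), hf.map hl⟩,
    ((hl'.list_sum (hf'.add (.const 1))).add (.const 1)).mono fun b => ?_⟩
  simp [sz_list_eq, Function.comp_def]

/-- General recursion in polynomial time: `μ` bounds the number of recursive calls, the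
arguments do not grow, and the results have to be of polynomial size. -/
theorem Poly.recursion {F : β → γ} {ds : β → List β} {post : β × List γ → γ} (hds : Poly ds)
    (hpost : Poly post) (hF : ∀ b, F b = post (b, (ds b).map F)) (μ : β → ℕ) (hμ : PolyBd μ)
    (hμd : ∀ b, ((ds b).map μ).sum + 1 ≤ μ b) (hsz : ∀ b, ∀ d ∈ ds b, sz d ≤ sz b)
    (hout : PolyBd fun b => sz (F b)) : Poly F := by
  obtain ⟨⟨t, ht, hds⟩, hds'⟩ := hds
  obtain ⟨⟨s, hs, hpost⟩, -⟩ := hpost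
  refine ⟨?_, hout⟩
  have hlist : PolyBd fun b => sz ((ds b).map F) :=
    ((hds'.list_sum (h := fun p : β × β => sz (F p.2) + 1) ((hout.subst .size fun p : β × β => .inr
      ⟨p.2, le_rfl, by simp; omega⟩).add (.const 1))).add (.const 1)).mono fun b => by
        simp [sz_list_eq, Function.comp_def]
  obtain ⟨C, hC⟩ := (ht.add (hs.subst ((PolyBd.size.add hlist).add (.const 1)) fun b => .inr
    ⟨(b, (ds b).map F), le_rfl, le_rfl⟩)).add (.const 1)
  refine ⟨fun b => μ b * (sz b + 1) ^ C, hμ.mul ⟨C, fun b => le_rfl⟩,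
    Comp.recursion hds hpost hF fun b => ?_⟩
  have h1 : ((ds b).map fun d => μ d * (sz d + 1) ^ C).sum ≤
      ((ds b).map fun d => μ d * (sz b + 1) ^ C).sum :=
    List.sum_le_sum fun d hd => Nat.mul_le_mul_left _
      (Nat.pow_le_pow_left (Nat.add_le_add_right (hsz b d hd) 1) C)
  rw [List.sum_map_mul_right] at h1
  have h2 := Nat.mul_le_mul_right ((sz b + 1) ^ C) (hμd b)
  have h3 := hC b
  simp only at h3
  rw [add_mul, one_mul] at h2
  omega

/-- Structural recursion on a list in polynomial time; the results have to be of polynomial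
size. -/
theorem Poly.listRec {F : ρ × List δ → γ} {z : ρ → γ} {s : ρ × δ × List δ × γ → γ}
    (hz : Poly z) (hs : Poly s) (h0 : ∀ p, F (p, []) = z p)
    (h1 : ∀ p x xs, F (p, x :: xs) = s (p, x, xs, F (p, xs)))
    (hout : PolyBd fun b => sz (F b)) : Poly F := by
  refine Poly.recursion (ds := fun b => listCase b.2 [] fun _ xs => [(b.1, xs)])
    (post := fun b => listCase b.1.2 (z b.1.1)
      fun x xs => listCase b.2 (z b.1.1) fun y _ => s (b.1.1, x, xs, y))
    ?_ ?_ ?_ (fun b => sz b.2) ?_ ?_ ?_ hout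
  · exact Poly.list_case (by fun_prop) (by fun_prop) (by fun_prop)
  · refine Poly.list_case (by fun_prop) (by fun_prop) (Poly.list_case (by fun_prop) (by fun_prop) ?_)
    exact hs.comp (by fun_prop)
  · rintro ⟨p, _ | ⟨x, xs⟩⟩ <;> simp [h0, h1]
  · exact PolyBd.size.mono fun b => by simp; omega
  · rintro ⟨p, _ | ⟨x, xs⟩⟩ <;> simp
  · rintro ⟨p, _ | ⟨x, xs⟩⟩ <;> simp; omega

theorem Poly.flatMap {l : β → List δ} {f : β → δ → List γ}
    (hf : Poly (fun p : β × δ => f p.1 p.2)) (hl : Poly l) :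
    Poly (fun b => (l b).flatMap (f b)) := by
  have hflat : Poly (fun p : Unit × List (List γ) => p.2.flatten) := by
    refine Poly.listRec (z := fun _ => []) (s := fun b => b.2.1 ++ b.2.2.2) (.const _)
      (by fun_prop) (fun _ => rfl) (fun _ _ _ => rfl) (PolyBd.size.mono ?_)
    rintro ⟨_, l⟩
    have : sz l.flatten ≤ sz l := by
      induction l with
      | nil => simp
      | cons x l ih =>
        have : sz (x ++ l.flatten) + 1 = sz x + sz l.flatten := by
          simp only [sz_list_eq, List.map_append, List.sum_append]; omega
        simp; omega
    simp; omega
  exact (hflat.comp (.pair (.const ()) (Poly.map hf hl))).congr fun b => by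
    simp [List.flatMap_def]

end

/-! ### Arithmetic in binary and comparison of data -/

/-- Encodings that determine the datum. -/
class InjEnc (β : Type*) [TreeEnc β] : Prop where
  inj : Function.Injective (enc : β → BinTree)

section
variable {β γ δ ε ρ : Type*} [TreeEnc β] [TreeEnc γ] [TreeEnc δ] [TreeEnc ε] [TreeEnc ρ]

theorem Comp.of_enc_eq_comp {f : β → γ} {g : β → δ} {t : β → ℕ} (hg : Comp g t)
    (h : ∀ b, enc (f b) = enc (g b)) : Comp f t := by
  obtain ⟨P, c, hP⟩ := hg
  exact ⟨P, c, fun b => h b ▸ hP b⟩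

theorem Poly.of_enc_eq_comp {f : β → γ} {g : β → δ} (hg : Poly g)
    (h : ∀ b, enc (f b) = enc (g b)) : Poly f := by
  obtain ⟨⟨t, ht, hg⟩, hg'⟩ := hg
  exact ⟨⟨t, ht, hg.of_enc_eq_comp h⟩, by simpa only [sz, h] using hg'⟩

/-- Whether a tree is nonempty. -/
def BinTree.isCons : BinTree → Bool
  | .nil => false
  | .cons _ _ => true

theorem sz_bool_le (b : Bool) : sz b ≤ 3 := by cases b <;> decide

theorem PolyBd.bool (f : β → Bool) : PolyBd fun b => sz (f b) :=
  (PolyBd.const 3).mono fun _ => sz_bool_le _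

theorem Comp.isCons : Comp BinTree.isCons fun _ => 0 := by
  refine ⟨[.ite (.var 0) (.cons .nil .nil) .nil], 5, fun b => ?_⟩
  cases b with
  | nil => exact ⟨_, by norm_num, _, rfl, Eval.iteFalse (Eval.var _ 0) (Eval.nil _)⟩
  | cons a b => exact ⟨_, by norm_num, _, rfl,
      Eval.iteTrue (a := a) (b := b) (Eval.var _ 0) ((Eval.nil _).cons (Eval.nil _))⟩

theorem Poly.isCons : Poly BinTree.isCons := ⟨⟨_, .const 0, .isCons⟩, .bool _⟩

theorem Poly.hd : Poly BinTree.hd :=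
  ⟨⟨_, .const 0, .of_hd fun _ => rfl⟩, PolyBd.size.mono fun b => by
    cases b <;> simp [sz, BinTree.hd, BinTree.size]; omega⟩

theorem Poly.tl : Poly BinTree.tl :=
  ⟨⟨_, .const 0, .of_tl fun _ => rfl⟩, PolyBd.size.mono fun b => by
    cases b <;> simp [sz, BinTree.tl, BinTree.size]; omega⟩

@[fun_prop]
theorem Poly.enc {f : β → γ} (hf : Poly f) : Poly (fun b => CostEnriched.enc (f b)) :=
  hf.of_enc_eq_comp fun _ => rfl

@[fun_prop]
theorem Poly.isCons' {f : β → BinTree} (hf : Poly f) : Poly (fun b => (f b).isCons) :=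
  Poly.isCons.comp hf

@[fun_prop]
theorem Poly.hd' {f : β → BinTree} (hf : Poly f) : Poly (fun b => (f b).hd) := Poly.hd.comp hf

@[fun_prop]
theorem Poly.tl' {f : β → BinTree} (hf : Poly f) : Poly (fun b => (f b).tl) := Poly.tl.comp hf

@[fun_prop]
theorem Poly.and {f g : β → Bool} (hf : Poly f) (hg : Poly g) : Poly (fun b => f b && g b) :=
  (Poly.cond hf hg (.const false)).congr fun b => by cases f b <;> rfl

@[fun_prop]
theorem Poly.or {f g : β → Bool} (hf : Poly f) (hg : Poly g) : Poly (fun b => f b || g b) :=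
  (Poly.cond hf (.const true) hg).congr fun b => by cases f b <;> rfl

@[fun_prop]
theorem Poly.not {f : β → Bool} (hf : Poly f) : Poly (fun b => !f b) :=
  (Poly.cond hf (.const false) (.const true)).congr fun b => by cases f b <;> rfl

@[fun_prop]
theorem Poly.xor {f g : β → Bool} (hf : Poly f) (hg : Poly g) :
    Poly (fun b => Bool.xor (f b) (g b)) :=
  (Poly.cond hf hg.not hg).congr fun b => by cases f b <;> simp

open Classical in
theorem Poly.tree_eq : Poly (fun p : BinTree × BinTree => decide (p.1 = p.2)) := by
  refine Poly.recursion
    (ds := fun p => bif p.1.isCons && p.2.isCons then [(p.1.hd, p.2.hd), (p.1.tl, p.2.tl)] else [])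
    (post := fun b => bif b.1.1.isCons && b.1.2.isCons then
      listCase b.2 false fun r rs => r && listCase rs false fun r _ => r
      else !b.1.1.isCons && !b.1.2.isCons)
    (by fun_prop) ?_ ?_ (fun p => sz p.1 + sz p.2) ?_ ?_ ?_ (.bool _)
  · refine Poly.cond (by fun_prop) (Poly.list_case (by fun_prop) (by fun_prop) ?_) (by fun_prop)
    exact Poly.and (by fun_prop) (Poly.list_case (by fun_prop) (by fun_prop) (by fun_prop))
  · rintro ⟨_ | ⟨a, b⟩, _ | ⟨c, d⟩⟩ <;> simp [BinTree.isCons, BinTree.hd, BinTree.tl]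
  · exact PolyBd.size.mono fun b => by simp
  · rintro ⟨_ | ⟨a, b⟩, _ | ⟨c, d⟩⟩ <;>
      simp [BinTree.isCons, BinTree.hd, BinTree.tl, sz, BinTree.size]
    omega
  · rintro ⟨_ | ⟨a, b⟩, _ | ⟨c, d⟩⟩ <;>
      simp [BinTree.isCons, BinTree.hd, BinTree.tl, sz, BinTree.size]
    omega

@[fun_prop]
theorem Poly.decide_eq [InjEnc γ] [DecidableEq γ] {f g : β → γ} (hf : Poly f) (hg : Poly g) :
    Poly (fun b => decide (f b = g b)) := by
  classical
  exact (Poly.tree_eq.comp (hf.enc.pair hg.enc)).congr fun b => by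
    simp [InjEnc.inj.eq_iff]

theorem encList_injective : Function.Injective encList := by
  intro l
  induction l with
  | nil => rintro (_ | ⟨y, l'⟩) h <;> simp_all [encList]
  | cons x l ih =>
    rintro (_ | ⟨y, l'⟩) h
    · simp [encList] at h
    · simp only [encList, BinTree.cons.injEq] at h
      rw [h.1, ih h.2]

instance : InjEnc BinTree := ⟨fun _ _ h => h⟩
instance : InjEnc Bool := ⟨fun a b h => by cases a <;> cases b <;> simp_all⟩
instance [InjEnc β] : InjEnc (List β) :=
  ⟨encList_injective.comp (List.map_injective_iff.2 InjEnc.inj)⟩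
instance [InjEnc β] [InjEnc γ] : InjEnc (β × γ) := ⟨fun p q h => by
  simp only [enc_prod, BinTree.cons.injEq] at h
  exact Prod.ext (InjEnc.inj h.1) (InjEnc.inj h.2)⟩

theorem enc_nat (n : ℕ) : enc n = enc n.bits := rfl

instance : InjEnc ℕ := ⟨fun m n h => by
  have h : m.bits = n.bits := InjEnc.inj h
  apply Nat.eq_of_testBit_eq
  intro i
  rw [Nat.testBit_eq_inth, Nat.testBit_eq_inth, h]⟩

@[simp] theorem enc_zero : enc 0 = BinTree.nil := rfl

theorem enc_bit (b : Bool) (n : ℕ) :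
    enc (Nat.bit b n) = bif !b && decide (n = 0) then enc 0 else .cons (enc b) (enc n) := by
  by_cases h : b = false ∧ n = 0
  · simp [h.1, h.2]
  · have : (!b && decide (n = 0)) = false := by simpa using h
    rw [this, enc_nat, Nat.bits_append_bit n b (by simpa using fun h' h'' => h ⟨h'', h'⟩)]
    rfl

@[fun_prop]
theorem Poly.bit {f : β → Bool} {g : β → ℕ} (hf : Poly f) (hg : Poly g) :
    Poly (fun b => Nat.bit (f b) (g b)) := by
  have h : Poly fun b => bif !f b && decide (g b = 0) then BinTree.nil else
      CostEnriched.enc (f b, g b) := by fun_prop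
  exact h.of_enc_eq_comp fun b => enc_bit _ _

theorem sz_nat_le (n : ℕ) : sz n ≤ 4 * n.size + 1 := by
  have : sz n = sz n.bits := rfl
  rw [this, ← Nat.size_eq_bits_len]
  refine (sz_list_le fun _ _ => sz_bool_le _).trans (by omega)

theorem size_le_sz (n : ℕ) : n.size ≤ sz n := by
  have : sz n = sz n.bits := rfl
  rw [this, ← Nat.size_eq_bits_len]
  exact (length_lt_sz _).le

theorem sz_nat_le_linear (n : ℕ) : sz n ≤ 4 * n + 1 := by
  have h := sz_nat_le n
  have : n.size ≤ n := Nat.size_le.2 Nat.lt_two_pow_self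
  omega

@[fun_prop]
theorem Poly.bodd {f : β → ℕ} (hf : Poly f) : Poly (fun b => (f b).bodd) := by
  refine (Poly.hd.comp hf.enc).of_enc_eq_comp fun b => ?_
  conv_rhs => rw [← Nat.bit_bodd_div2 (f b), enc_bit]
  cases h1 : (f b).bodd <;> by_cases h2 : (f b).div2 = 0 <;> simp [h2, BinTree.hd]

theorem enc_div2 (n : ℕ) : enc n.div2 = (enc n).tl := by
  conv_rhs => rw [← Nat.bit_bodd_div2 n, enc_bit]
  cases h1 : n.bodd <;> by_cases h2 : n.div2 = 0 <;> simp [h2, BinTree.tl]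

@[fun_prop]
theorem Poly.div2 {f : β → ℕ} (hf : Poly f) : Poly (fun b => (f b).div2) :=
  (Poly.tl.comp hf.enc).of_enc_eq_comp fun _ => enc_div2 _

theorem sz_div2_add_two {n : ℕ} (hn : n ≠ 0) : sz n.div2 + 2 ≤ sz n := by
  conv_rhs => rw [← Nat.bit_bodd_div2 n, sz, enc_bit]
  have h : ¬ (n.bodd = false ∧ n.div2 = 0) := by
    rintro ⟨h1, h2⟩
    exact hn (by rw [← Nat.bit_bodd_div2 n, h1, h2]; rfl)
  have h' : (!n.bodd && decide (n.div2 = 0)) = false := by simpa using h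
  have := one_le_sz n.bodd
  rw [h']
  simp only [cond_false, BinTree.size]
  change _ ≤ sz n.bodd + sz n.div2 + 1
  omega

theorem sz_div2_le (n : ℕ) : sz n.div2 ≤ sz n := by
  by_cases h : n = 0
  · simp [h]
  · have := sz_div2_add_two h; omega

/-- Addition with carry. -/
theorem Poly.addCarry : Poly fun p : Bool × ℕ × ℕ => p.2.1 + p.2.2 + p.1.toNat := by
  refine Poly.recursion
    (ds := fun p => bif decide (p.2.1 = 0) && decide (p.2.2 = 0) then [] else
      [((p.2.1.bodd && p.2.2.bodd) || (p.1 && (p.2.1.bodd || p.2.2.bodd)), p.2.1.div2, p.2.2.div2)])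
    (post := fun b => listCase b.2 (Nat.bit b.1.1 0) fun r _ =>
      Nat.bit (Bool.xor b.1.1 (Bool.xor b.1.2.1.bodd b.1.2.2.bodd)) r)
    (by fun_prop) (Poly.list_case (by fun_prop) (by fun_prop) (by fun_prop)) ?_
    (fun p => sz p.2.1 + sz p.2.2) ?_ ?_ ?_ ?_
  · rintro ⟨c, x, y⟩
    by_cases h : x = 0 ∧ y = 0
    · cases c <;> simp [h.1, h.2, Nat.bit]
    · have h' : (decide (x = 0) && decide (y = 0)) = false := by simpa using h
      simp only [h', cond_false, List.map_cons, listCase_cons]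
      conv_lhs => rw [← Nat.bit_bodd_div2 x, ← Nat.bit_bodd_div2 y]
      cases c <;> cases x.bodd <;> cases y.bodd <;> simp [Nat.bit_val] <;> omega
  · exact PolyBd.size.mono fun b => by simp; omega
  · rintro ⟨c, x, y⟩
    have hx := one_le_sz x
    by_cases h : x = 0 ∧ y = 0
    · simp [h.1, h.2]; exact Nat.le_add_right_of_le (one_le_sz 0)
    · have h' : (decide (x = 0) && decide (y = 0)) = false := by simpa using h
      have h1 := sz_div2_le x
      have h2 := sz_div2_le y
      simp only [h', cond_false, List.map_cons, List.map_nil, List.sum_cons, List.sum_nil]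
      rw [not_and_or] at h
      rcases h with h | h <;> have := sz_div2_add_two h <;> omega
  · rintro ⟨c, x, y⟩
    by_cases h : x = 0 ∧ y = 0
    · simp [h.1, h.2]
    · have h' : (decide (x = 0) && decide (y = 0)) = false := by simpa using h
      have h1 := sz_div2_le x
      have h2 := sz_div2_le y
      have h3 := one_le_sz c
      have h4 := sz_bool_le ((x.bodd && y.bodd) || (c && (x.bodd || y.bodd)))
      simp only [h', cond_false, List.mem_singleton, forall_eq, sz_pair]
      rw [not_and_or] at h
      rcases h with h | h <;> have := sz_div2_add_two h <;> omega
  · refine (((PolyBd.const 4).mul PolyBd.size).add (.const 5)).mono ?_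
    rintro ⟨c, x, y⟩
    have hc : c.toNat ≤ 1 := Bool.toNat_le c
    have key : (x + y + c.toNat).size ≤ x.size + y.size + 1 := by
      rw [Nat.size_le]
      have hx := Nat.lt_size_self x
      have hy := Nat.lt_size_self y
      have h1 : 2 ^ x.size ≤ 2 ^ (x.size + y.size) := Nat.pow_le_pow_right (by norm_num) (by omega)
      have h2 : 2 ^ y.size ≤ 2 ^ (x.size + y.size) := Nat.pow_le_pow_right (by norm_num) (by omega)
      rw [pow_succ]; omega
    have h1 := sz_nat_le (x + y + c.toNat)
    have h2 := size_le_sz x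
    have h3 := size_le_sz y
    simp only [sz_pair]
    omega

@[fun_prop]
theorem Poly.add {f g : β → ℕ} (hf : Poly f) (hg : Poly g) : Poly (fun b => f b + g b) :=
  (Poly.addCarry.comp (Poly.pair (.const false) (hf.pair hg))).congr fun b => by simp

/-- Subtraction with borrow; the result is a list, empty if the difference is negative. -/
theorem Poly.subBorrow : Poly fun p : Bool × ℕ × ℕ =>
    bif decide (p.2.2 + p.1.toNat ≤ p.2.1) then [p.2.1 - (p.2.2 + p.1.toNat)] else [] := by
  refine Poly.recursion
    (ds := fun p => bif decide (p.2.1 = 0) && decide (p.2.2 = 0) then [] else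
      [((!p.2.1.bodd && (p.1 || p.2.2.bodd)) || (p.1 && p.2.2.bodd), p.2.1.div2, p.2.2.div2)])
    (post := fun b => listCase b.2 (bif b.1.1 then [] else [0]) fun r _ => r.map fun s =>
      Nat.bit (Bool.xor b.1.1 (Bool.xor b.1.2.1.bodd b.1.2.2.bodd)) s)
    (by fun_prop) (Poly.list_case (by fun_prop) (by fun_prop)
      (Poly.map (by fun_prop) (by fun_prop))) ?_
    (fun p => sz p.2.1 + sz p.2.2) ?_ ?_ ?_ ?_
  · rintro ⟨c, x, y⟩
    by_cases h : x = 0 ∧ y = 0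
    · cases c <;> simp [h.1, h.2]
    · have h' : (decide (x = 0) && decide (y = 0)) = false := by simpa using h
      simp only [h', cond_false, List.map_cons, listCase_cons]
      conv_lhs => rw [← Nat.bit_bodd_div2 x, ← Nat.bit_bodd_div2 y]
      generalize x.div2 = x'
      generalize y.div2 = y'
      cases c <;> cases x.bodd <;> cases y.bodd <;>
        simp only [Nat.bit_val, Bool.toNat_false, Bool.toNat_true, Bool.and_false, Bool.and_true,
          Bool.or_false, Bool.or_true, Bool.not_true, Bool.not_false, Bool.xor_false,
          Bool.xor_true, cond_eq_ite, decide_eq_true_eq] <;>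
        split_ifs <;> simp <;> omega
  · exact PolyBd.size.mono fun b => by simp; omega
  · rintro ⟨c, x, y⟩
    have hx := one_le_sz x
    by_cases h : x = 0 ∧ y = 0
    · simp [h.1, h.2]; exact Nat.le_add_right_of_le (one_le_sz 0)
    · have h' : (decide (x = 0) && decide (y = 0)) = false := by simpa using h
      have h1 := sz_div2_le x
      have h2 := sz_div2_le y
      simp only [h', cond_false, List.map_cons, List.map_nil, List.sum_cons, List.sum_nil]
      rw [not_and_or] at h
      rcases h with h | h <;> have := sz_div2_add_two h <;> omega
  · rintro ⟨c, x, y⟩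
    by_cases h : x = 0 ∧ y = 0
    · simp [h.1, h.2]
    · have h' : (decide (x = 0) && decide (y = 0)) = false := by simpa using h
      have h1 := sz_div2_le x
      have h2 := sz_div2_le y
      have h3 := one_le_sz c
      have h4 := sz_bool_le ((!x.bodd && (c || y.bodd)) || (c && y.bodd))
      simp only [h', cond_false, List.mem_singleton, forall_eq, sz_pair]
      rw [not_and_or] at h
      rcases h with h | h <;> have := sz_div2_add_two h <;> omega
  · refine (((PolyBd.const 4).mul PolyBd.size).add (.const 5)).mono ?_
    rintro ⟨c, x, y⟩
    have key : (x - (y + c.toNat)).size ≤ x.size := Nat.size_le_size (by omega)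
    have h1 := sz_nat_le (x - (y + c.toNat))
    have h2 := size_le_sz x
    simp only [sz_pair]
    cases decide (y + c.toNat ≤ x) <;> simp
    omega

/-- The difference of two natural numbers, as an integer. -/
theorem Poly.intSub : Poly fun p : ℕ × ℕ => (p.1 : ℤ) - p.2 := by
  have h : Poly fun p : ℕ × ℕ => listCase
      (bif decide (p.2 + false.toNat ≤ p.1) then [p.1 - (p.2 + false.toNat)] else [])
      (true, listCase (bif decide (p.1 + false.toNat ≤ p.2) then [p.2 - (p.1 + false.toNat)] else [])
        0 fun r _ => r) fun r _ => (false, r) := by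
    refine Poly.list_case (Poly.subBorrow.comp (f := fun p : ℕ × ℕ => (false, p)) (by fun_prop))
      (.pair (.const true) (Poly.list_case (Poly.subBorrow.comp
        (f := fun p : ℕ × ℕ => (false, p.2, p.1)) (by fun_prop)) (by fun_prop) (by fun_prop)))
      (by fun_prop)
  refine h.of_enc_eq_comp ?_
  rintro ⟨x, y⟩
  by_cases hxy : y ≤ x
  · have h1 : ¬ ((x : ℤ) - y < 0) := by omega
    have h2 : ((x : ℤ) - y).natAbs = x - y := by omega
    simp only [Bool.toNat_false, add_zero, hxy, decide_true, cond_true, listCase_cons]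
    change encInt ((x : ℤ) - y) = _
    rw [encInt, h2, decide_eq_false h1]
    rfl
  · have h1 : (x : ℤ) - y < 0 := by omega
    have h2 : ((x : ℤ) - y).natAbs = y - x := by omega
    have h3 : x ≤ y := by omega
    simp only [Bool.toNat_false, add_zero, hxy, h3, decide_true, decide_false, cond_true,
      cond_false, listCase_cons, listCase_nil]
    change encInt ((x : ℤ) - y) = _
    rw [encInt, h2, decide_eq_true h1]
    rfl

@[fun_prop]
theorem Poly.intAdd {f g : β → ℤ} (hf : Poly f) (hg : Poly g) : Poly (fun b => f b + g b) := by
  have hp : Poly fun z : ℤ => (decide (z < 0), z.natAbs) := .of_enc_eq fun _ => rfl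
  have h1 : Poly fun z : ℤ => z.toNat :=
    ((Poly.cond (c := fun p : Bool × ℕ => p.1) .fst (.const 0) .snd).comp hp).congr fun z => by
      by_cases hz : z < 0 <;> simp [hz] <;> omega
  have h2 : Poly fun z : ℤ => (-z).toNat :=
    ((Poly.cond (c := fun p : Bool × ℕ => p.1) .fst .snd (.const 0)).comp hp).congr fun z => by
      by_cases hz : z < 0 <;> simp [hz] <;> omega
  exact (Poly.intSub.comp (((h1.comp hf).add (h1.comp hg)).pair
    ((h2.comp hf).add (h2.comp hg)))).congr fun b => by push_cast; omega

theorem Poly.zip : Poly fun p : List β × List γ => p.1.zip p.2 := by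
  refine Poly.recursion
    (ds := fun p => listCase p.1 [] fun _ xs => listCase p.2 [] fun _ ys => [(xs, ys)])
    (post := fun b => listCase b.1.1 [] fun x _ => listCase b.1.2 [] fun y _ =>
      listCase b.2 [] fun r _ => (x, y) :: r) ?_ ?_ ?_ (fun p => sz p.1) ?_ ?_ ?_ ?_
  · exact Poly.list_case (by fun_prop) (by fun_prop)
      (Poly.list_case (by fun_prop) (by fun_prop) (by fun_prop))
  · exact Poly.list_case (by fun_prop) (by fun_prop)
      (Poly.list_case (by fun_prop) (by fun_prop)
        (Poly.list_case (by fun_prop) (by fun_prop) (by fun_prop)))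
  · rintro ⟨_ | ⟨x, xs⟩, _ | ⟨y, ys⟩⟩ <;> simp
  · exact PolyBd.size.mono fun b => by simp; omega
  · rintro ⟨_ | ⟨x, xs⟩, _ | ⟨y, ys⟩⟩ <;> simp
  · rintro ⟨_ | ⟨x, xs⟩, _ | ⟨y, ys⟩⟩ <;> simp
    omega
  · refine PolyBd.size.mono ?_
    rintro ⟨xs, ys⟩
    have : sz (xs.zip ys) ≤ sz xs + sz ys := by
      induction xs generalizing ys with
      | nil => simp
      | cons x xs ih =>
        cases ys with
        | nil => simp
        | cons y ys => have := ih ys; simp; omega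
    simp only [sz_pair]; omega

@[fun_prop]
theorem Poly.vecAdd {f g : β → List ℤ} (hf : Poly f) (hg : Poly g) :
    Poly (fun b => List.zipWith (· + ·) (f b) (g b)) :=
  (Poly.map (f := fun _ p => p.1 + p.2) (by fun_prop) (Poly.zip.comp (hf.pair hg))).congr
    fun b => by simp [List.zip, List.map_zipWith]

theorem Poly.idxOf [InjEnc γ] [BEq γ] [LawfulBEq γ] :
    Poly (fun p : γ × List γ => p.2.idxOf p.1) := by
  classical
  refine Poly.listRec (z := fun _ => 0)
    (s := fun b => bif decide (b.2.1 = b.1) then 0 else b.2.2.2 + 1) (.const 0)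
    (by fun_prop) (fun _ => rfl) (fun p x xs => ?_)
    ((((PolyBd.const 4).mul .size).add (.const 1)).mono ?_)
  · by_cases h : x = p <;> simp [h]
  · rintro ⟨x, l⟩
    have h1 := sz_nat_le_linear (l.idxOf x)
    have h2 : l.idxOf x ≤ l.length := List.idxOf_le_length
    have h3 := length_lt_sz l
    simp only [sz_pair]; omega

/-- The successor, in time linear in its argument. -/
theorem Comp.succ : Comp (fun n : ℕ => n + 1) fun n => n := by
  have hnat : Comp (fun n : ℕ => enc n) fun _ => 0 := .of_enc_eq fun _ => rfl
  have hodd : Comp (fun n : ℕ => (enc n).hd.isCons) fun _ => 0 :=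
    (Comp.isCons.comp ((Comp.of_hd (f := BinTree.hd) fun _ => rfl).comp hnat)).mono 1
      fun b => by simp
  have hdiv : Comp Nat.div2 fun _ => 0 := .of_tl enc_div2
  have hodd' : ∀ n : ℕ, (enc n).hd.isCons = n.bodd := by
    intro n
    rw [← Nat.bit_bodd_div2 n, enc_bit]
    cases h1 : n.bodd <;> by_cases h2 : n.div2 = 0 <;>
      simp [h2, BinTree.hd, BinTree.isCons]
  have hout : Comp (fun n : ℕ => enc (n + 1)) fun n => n + 1 := by
    refine Comp.recursion (ds := fun n => bif (enc n).hd.isCons then [n.div2] else [])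
      (post := fun b => listCase b.2 (enc (true, b.1.div2)) fun r _ => enc (false, r))
      (t := fun _ => 0) (s := fun _ => 0)
      ((hodd.cond (hdiv.cons (.const [])) (.const [])).mono 1 fun b => by simp)
      ((Comp.list_case .snd
        ((Comp.of_enc_eq (f := fun p : Bool × ℕ => enc p) fun _ => rfl).comp
          ((Comp.const true).pair (hdiv.comp .fst)))
        ((Comp.of_enc_eq (f := fun p : Bool × BinTree => enc p) fun _ => rfl).comp
          ((Comp.const false).pair (Comp.fst.comp .snd)))).mono 1 ?_) ?_ ?_
    · rintro ⟨n, _ | ⟨r, rs⟩⟩ <;> simp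
    · intro n
      rw [hodd']
      have h := Nat.bit_bodd_div2 n
      cases hn : n.bodd with
      | true =>
        have : n + 1 = Nat.bit false (n.div2 + 1) := by
          rw [hn] at h; simp only [Nat.bit_val] at h ⊢; simp at h ⊢; omega
        simp only [cond_true, List.map_cons, listCase_cons]
        rw [this, enc_bit]
        simp
      | false =>
        have : n + 1 = Nat.bit true n.div2 := by
          rw [hn] at h; simp only [Nat.bit_val] at h ⊢; simp at h ⊢; omega
        simp only [cond_false, List.map_nil, listCase_nil]
        rw [this, enc_bit]
        simp
    · intro n
      rw [hodd']
      cases hn : n.bodd with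
      | true =>
        have h := Nat.bit_bodd_div2 n
        rw [hn] at h
        simp only [Nat.bit_val] at h
        simp at h ⊢
        omega
      | false => simp
  exact (hout.of_enc_eq_comp fun _ => rfl).mono 1 fun n => by simp

end

/-! ### Automata and representations as data -/

section
variable {β γ δ ε ρ : Type*} [TreeEnc β] [TreeEnc γ] [TreeEnc δ] [TreeEnc ε] [TreeEnc ρ]

/-- `f` is computed in constant time. -/
@[fun_prop]
def ConstTime (f : β → γ) : Prop := Comp f fun _ => 0

@[fun_prop]
theorem ConstTime.id : ConstTime (fun b : β => b) := Comp.id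

@[fun_prop]
theorem ConstTime.const (y : γ) : ConstTime (fun _ : β => y) := Comp.const y

@[fun_prop]
theorem ConstTime.comp {f : β → γ} {g : γ → δ} (hg : ConstTime g) (hf : ConstTime f) :
    ConstTime (fun b => g (f b)) := Comp.comp hg hf

@[fun_prop]
theorem ConstTime.pair {f : β → γ} {g : β → δ} (hf : ConstTime f) (hg : ConstTime g) :
    ConstTime (fun b => (f b, g b)) := Comp.pair hf hg

@[fun_prop]
theorem ConstTime.fst : ConstTime (fun p : β × γ => p.1) := Comp.fst

@[fun_prop]
theorem ConstTime.snd : ConstTime (fun p : β × γ => p.2) := Comp.snd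

@[fun_prop]
theorem ConstTime.cons {f : β → γ} {g : β → List γ} (hf : ConstTime f) (hg : ConstTime g) :
    ConstTime (fun b => f b :: g b) := Comp.cons hf hg

theorem Comp.comp_const {f : β → γ} {g : γ → δ} {s : γ → ℕ} (hg : Comp g s)
    (hf : ConstTime f) : Comp (fun b => g (f b)) fun b => s (f b) :=
  (hg.comp hf).mono 1 fun b => by simp

theorem Comp.pair_const {f : β → γ} {g : β → δ} {s : β → ℕ} (hf : ConstTime f)
    (hg : Comp g s) : Comp (fun b => (f b, g b)) s :=
  (Comp.pair hf hg).mono 1 fun b => by simp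

theorem Comp.map_const {l : β → List δ} {f : β → δ → γ} {s : β → ℕ}
    (hf : ConstTime (fun p : β × δ => f p.1 p.2)) (hl : Comp l s) :
    Comp (fun b => (l b).map (f b)) fun b => s b + (l b).length :=
  (Comp.map hf hl).mono 1 fun b => by simp

end

section
variable {α : Type*} [TreeEnc α] {k : ℕ}

/-- Automata as data: states, registers in unary, transitions, initial and final states. The
components of type `Unit` make the encoding of a tuple that of a list, as prescribed. -/
abbrev RawCEFA (α : Type*) : Type _ :=
  List ℕ × List Unit × List (ℕ × α × ℕ × List ℤ × Unit) × List ℕ × List ℕ × Unit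

/-- An automaton as data. -/
def CEFA.raw (A : CEFA α k) : RawCEFA α :=
  (List.range A.n, List.replicate k (),
    A.trans.map fun τ => (τ.1.val, τ.2.1, τ.2.2.1.val, List.ofFn τ.2.2.2, ()),
    A.init.map Fin.val, A.final.map Fin.val, ())

theorem enc_list {β : Type*} [TreeEnc β] (l : List β) : enc l = encList (l.map enc) := rfl

theorem encStates_eq {n : ℕ} (S : List (Fin n)) : encStates S = enc (S.map Fin.val) := by
  rw [enc_list, encStates]
  congr 2
  rw [List.map_eq_flatMap]
  rfl

theorem CEFA.enc_raw (A : CEFA α k) : enc A.raw = encCEFA enc A := by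
  simp only [encCEFA, encStates_eq, List.map_coe_finRange_eq_range, CEFA.raw, enc_pair, encList]
  congr 2
  · simp only [enc_list, List.map_replicate]
    rfl
  · congr 1
    simp only [enc_list, List.map_map]
    rfl

/-- Representations of pre-images as data. -/
abbrev RawRep (α : Type*) : Type _ := List (List (RawCEFA α)) × List (ℤ × List ℤ)

/-- A representation as data. -/
def PreimageRep.raw {l : ℕ} {ks : Fin l → ℕ} (B : PreimageRep α ks k) : RawRep α :=
  (B.disjuncts.map fun T => List.ofFn fun j => (T j).raw,
    List.ofFn fun i => ((B.terms i).const, List.ofFn (B.terms i).coeff))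

theorem PreimageRep.enc_raw {l : ℕ} {ks : Fin l → ℕ} (B : PreimageRep α ks k) :
    enc B.raw = encRep enc B := by
  simp only [encRep, PreimageRep.raw, enc_pair]
  congr 1
  · simp only [← CEFA.enc_raw]
    simp only [enc_list, List.map_map, List.map_ofFn, Function.comp_def]
  · simp only [enc_list, List.map_ofFn, Function.comp_def]
    simp only [encLinTerm, encVec, enc_pair, enc_list]
    rfl

/-- Change of the type of the number of registers. -/
def CEFA.cast {k' : ℕ} (h : k = k') (A : CEFA α k) : CEFA α k' := h ▸ A

@[simp] theorem CEFA.raw_cast {k' : ℕ} (h : k = k') (A : CEFA α k) : (A.cast h).raw = A.raw := by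
  subst h; rfl

@[simp] theorem CEFA.fullSize_cast {k' : ℕ} (h : k = k') (A : CEFA α k) :
    (A.cast h).fullSize = A.fullSize := by
  subst h; rfl

theorem CEFA.mem_lang_cast {k' : ℕ} (h : k = k') (A : CEFA α k) (w : List α) (v : Fin k' → ℤ) :
    (w, v) ∈ (A.cast h).lang ↔ (w, fun i => v (Fin.cast h i)) ∈ A.lang := by
  subst h; rfl

theorem CEFA.mem_lang_cast_zero (A : CEFA α k) (w : List α) (c : Fin 0 → ℤ) (d : Fin k → ℤ) :
    (w, Fin.append c d) ∈ (A.cast (Nat.zero_add k).symm).lang ↔ (w, d) ∈ A.lang := by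
  rw [CEFA.mem_lang_cast]
  have : (fun i => Fin.append c d (Fin.cast (Nat.zero_add k).symm i)) = d := by
    funext i
    have : Fin.cast (Nat.zero_add k).symm i = Fin.natAdd 0 i := by ext; simp
    rw [this, Fin.append_right]
  rw [this]

/-! ### Runs -/

theorem CEFA.Run.append {A : CEFA α k} {q q' q'' : Fin A.n} {w w' : List α} {v v' : Fin k → ℤ}
    (h : A.Run q w v q') (h' : A.Run q' w' v' q'') : A.Run q (w ++ w') (v + v') q'' := by
  induction h with
  | nil q => simpa using h'
  | cons ht _ ih => rw [add_assoc]; exact .cons ht (ih h')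

theorem CEFA.Run.split {A : CEFA α k} {q q'' : Fin A.n} {w w' : List α} {v : Fin k → ℤ}
    (h : A.Run q (w ++ w') v q'') :
    ∃ q' v₁ v₂, A.Run q w v₁ q' ∧ A.Run q' w' v₂ q'' ∧ v = v₁ + v₂ := by
  induction w generalizing q v with
  | nil => exact ⟨q, 0, v, .nil q, h, by simp⟩
  | cons a w ih =>
    cases h with
    | cons ht h =>
      obtain ⟨q', v₁, v₂, h₁, h₂, rfl⟩ := ih h
      exact ⟨q', _, v₂, .cons ht h₁, h₂, by rw [add_assoc]⟩

/-! ### Pre-images under functions of one string -/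

/-- For a function all of whose values are attained on `D`, the first condition on a pre-image
follows from the other two. -/
theorem isPreimage_of {l : ℕ} {ks : Fin l → ℕ} {f : StrFun α ks} {D : Set (Args α ks)}
    {L : Set (List α × (Fin k → ℤ))} {R : Set (Args α fun j => ks j + k)}
    {t : Fin k → LinTerm l} (hf : ∀ x w w', f x w → f x w' → w = w')
    (hrange : ∀ x w, f x w → ∃ y ∈ D, f y w)
    (h : ∀ x ∈ D, ∀ v, (∃ d, withCosts x d ∈ R ∧ v = evalTerms t d) ↔ ∃ w, f x w ∧ (w, v) ∈ L)
    (hD : ∀ x d, withCosts x d ∈ R → x ∈ D) : IsPreimage f D L R t := by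
  refine ⟨fun w v => ⟨?_, ?_⟩, h, hD⟩
  · rintro ⟨x, d, hR, hfx, rfl⟩
    obtain ⟨w', hw', hL⟩ := (h x (hD x d hR) _).1 ⟨d, hR, rfl⟩
    exact ⟨hf x w' w hw' hfx ▸ hL, x, hfx⟩
  · rintro ⟨hL, x, hx⟩
    obtain ⟨y, hy, hfy⟩ := hrange x w hx
    obtain ⟨d, hR, rfl⟩ := (h y hy v).2 ⟨w, hfy, hL⟩
    exact ⟨y, d, hR, hfy, rfl⟩

/-- The terms `r⁽¹⁾ + ⋯ + r⁽ˡ⁾`. -/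
def sumTerms (l k : ℕ) : Fin k → LinTerm l := fun _ => ⟨0, fun _ => 1⟩

theorem evalTerms_sumTerms {l : ℕ} (d : Fin l → Fin k → ℤ) :
    evalTerms (sumTerms l k) d = ∑ j, d j := by
  funext i
  simp [evalTerms, sumTerms, LinTerm.eval]

theorem fullSize_sumTerms {l : ℕ} {ks : Fin l → ℕ} (D : List ((j : Fin l) → CEFA α (ks j + k))) :
    PreimageRep.fullSize ⟨D, sumTerms l k⟩ =
      (D.map fun T => ∑ j, (T j).fullSize).sum + k * (l + 1) := by
  simp [PreimageRep.fullSize, sumTerms, bits]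

/-- The representation consisting of one automaton without integer arguments. -/
def singleRep (B : CEFA α k) : PreimageRep α (fun _ : Fin 1 => 0) k :=
  ⟨[fun _ => B.cast (Nat.zero_add k).symm], sumTerms 1 k⟩

theorem singleRep_raw (B : CEFA α k) :
    (singleRep B).raw = ([[B.raw]], List.replicate k (0, [1])) := by
  simp [PreimageRep.raw, singleRep, sumTerms]

theorem singleRep_fullSize (B : CEFA α k) : (singleRep B).fullSize ≤ 3 * B.fullSize := by
  rw [singleRep, fullSize_sumTerms]
  have : k + 1 ≤ B.fullSize := by simp only [CEFA.fullSize]; omega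
  simp
  omega

theorem singleRep_represents {A B : CEFA α k} {f : List α → List α → Prop}
    (hf : ∀ w u u', f w u → f w u' → u = u')
    (hB : ∀ w d, (w, d) ∈ B.lang ↔ ∃ u, f w u ∧ (u, d) ∈ A.lang) :
    (singleRep B).Represents (fun x u => f (x 0).1 u) Set.univ A.lang := by
  refine isPreimage_of (fun x => hf _) (fun x w hx => ⟨x, trivial, hx⟩) (fun x _ v => ?_)
    fun _ _ _ => trivial
  have key : ∀ d : Fin 1 → Fin k → ℤ, withCosts x d ∈ (singleRep B).rel ↔
      ∃ u, f (x 0).1 u ∧ (u, d 0) ∈ A.lang := by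
    intro d
    rw [← hB, ← CEFA.mem_lang_cast_zero B _ (x 0).2]
    simp [PreimageRep.rel, singleRep, withCosts]
  constructor
  · rintro ⟨d, hd, rfl⟩
    change ∃ u, _ ∧ (u, evalTerms (sumTerms 1 k) d) ∈ A.lang
    rw [evalTerms_sumTerms]
    simpa using (key d).1 hd
  · intro h
    refine ⟨fun _ => v, (key _).2 h, ?_⟩
    change v = evalTerms (sumTerms 1 k) _
    simp [evalTerms_sumTerms]

/-! ### Reverse -/

/-- The automaton with all transitions reversed. -/
def CEFA.reverse (A : CEFA α k) : CEFA α k where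
  n := A.n
  trans := A.trans.map fun τ => (τ.2.2.1, τ.2.1, τ.1, τ.2.2.2)
  init := A.final
  final := A.init

theorem CEFA.Run.reverse {A : CEFA α k} {q q' : Fin A.n} {w : List α} {v : Fin k → ℤ}
    (h : A.Run q w v q') : A.reverse.Run q' w.reverse v q := by
  induction h with
  | nil q => exact .nil (A := A.reverse) q
  | @cons q q' q'' a w η v ht _ ih =>
    have h1 : A.reverse.Run q' [a] (η + 0) q :=
      .cons (A := A.reverse) (List.mem_map_of_mem (f := fun τ => (τ.2.2.1, τ.2.1, τ.1, τ.2.2.2)) ht)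
        (.nil (A := A.reverse) q)
    have := ih.append h1
    simpa [add_comm] using this

theorem CEFA.reverse_reverse (A : CEFA α k) : A.reverse.reverse = A := by
  simp [CEFA.reverse, Function.comp_def]

theorem CEFA.mem_lang_reverse (A : CEFA α k) (w : List α) (d : Fin k → ℤ) :
    (w, d) ∈ A.reverse.lang ↔ (w.reverse, d) ∈ A.lang := by
  have key : ∀ (A : CEFA α k) w, (w, d) ∈ A.lang → (w.reverse, d) ∈ A.reverse.lang := by
    rintro A w ⟨q, hq, q', hq', h⟩
    exact ⟨q', hq', q, hq, h.reverse⟩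
  refine ⟨fun h => ?_, fun h => ?_⟩
  · simpa [CEFA.reverse_reverse] using key _ _ h
  · simpa using key _ _ h

theorem CEFA.fullSize_reverse (A : CEFA α k) : A.reverse.fullSize = A.fullSize := by
  simp [CEFA.fullSize, CEFA.size, CEFA.reverse, Function.comp_def]
  omega

theorem Comp.singleRep {f : RawCEFA α → RawCEFA α} {t : RawCEFA α → ℕ} (hf : Comp f t) :
    Comp (fun A => (([[f A]], A.2.1.map fun _ => (0, [1])) : RawRep α))
      fun A => t A + A.2.1.length :=
  ((Comp.cons (Comp.cons hf (.const [])) (.const [])).pair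
    (Comp.map_const (f := fun _ _ => ((0 : ℤ), [(1 : ℤ)])) (by fun_prop)
      (s := fun _ => 0) (show ConstTime _ by fun_prop))).mono 1 fun b => by simp

/-- A computation of representations as data gives a program in the sense of `ComputesRep`. -/
theorem Comp.computesRep {X : Type*} [TreeEnc X] {F : X → RawRep α} {t : X → ℕ} (hF : Comp F t) :
    ∃ (P : TreeProgram) (c : ℕ), ∀ (x : X) {l k : ℕ} {ks : Fin l → ℕ} (B : PreimageRep α ks k)
      {f : StrFun α ks} {D : Set (Args α ks)} {L : Set (List α × (Fin k → ℤ))} {b : ℕ},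
      F x = B.raw → B.Represents f D L → B.fullSize ≤ b → c * (t x + 1) ≤ b →
      ComputesRep enc P (enc x) f D L b := by
  obtain ⟨P, c, hP⟩ := hF
  refine ⟨P, c, fun x l k ks B f D L b hx hB hb ht => ⟨B, hB, hb, ?_⟩⟩
  obtain ⟨m, hm, body, h1, h2⟩ := hP x
  rw [hx, PreimageRep.enc_raw] at h2
  exact ⟨m, hm.trans ht, body, h1, h2⟩

theorem CEFA.lengths_le (A : CEFA α k) :
    3 * A.trans.length + A.n + A.init.length + A.final.length + k + 1 ≤ A.fullSize := by
  have h := List.card_nsmul_le_sum (A.trans.map fun τ => bits τ.2.2.2 + 3) 3 (by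
    simp only [List.mem_map]
    rintro _ ⟨τ, _, rfl⟩
    omega)
  simp only [List.length_map, smul_eq_mul] at h
  simp only [CEFA.fullSize, CEFA.size]
  omega

theorem reverse_computes : ∃ (P : TreeProgram) (c : ℕ), ∀ (k : ℕ) (A : CEFA α k),
    ComputesRep enc P (encCEFA enc A) (reverseFun α) Set.univ A.lang (c * A.fullSize) := by
  have hrev : Comp (fun A : RawCEFA α => ((A.1, A.2.1,
      A.2.2.1.map fun τ => (τ.2.2.1, τ.2.1, τ.1, τ.2.2.2), A.2.2.2.2.1, A.2.2.2.1, ()) :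
      RawCEFA α)) fun A => A.2.2.1.length := by
    refine (Comp.pair_const (by fun_prop) (Comp.pair_const (by fun_prop)
      (Comp.pair (Comp.map_const (s := fun _ => 0) (by fun_prop)
        (show ConstTime _ by fun_prop))
        (show ConstTime _ by fun_prop)))).mono 1 fun b => by simp
  obtain ⟨P, c, h⟩ := hrev.singleRep.computesRep
  refine ⟨P, c + 3, fun k A => ?_⟩
  rw [← CEFA.enc_raw]
  refine h A.raw (singleRep A.reverse) ?_ ?_ ?_ ?_
  · rw [singleRep_raw]
    simp [CEFA.raw, CEFA.reverse, Function.comp_def]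
  · refine singleRep_represents (f := fun w u => u = w.reverse) (fun w u u' h h' => h.trans h'.symm)
      fun w d => ?_
    simp [CEFA.mem_lang_reverse]
  · have := singleRep_fullSize A.reverse
    rw [CEFA.fullSize_reverse] at this
    nlinarith
  · have h1 := A.lengths_le
    have h2 : A.raw.2.2.1.length + A.raw.2.1.length + 1 ≤ A.fullSize := by
      simp [CEFA.raw]; omega
    nlinarith [Nat.mul_le_mul_left c h2]

end

section
variable {α : Type*} [TreeEnc α] {k : ℕ}

/-! ### Concatenation -/

/-- The automaton with other initial and final states. -/
def CEFA.withEnds (A : CEFA α k) (I F : List (Fin A.n)) : CEFA α k := ⟨A.n, A.trans, I, F⟩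

theorem CEFA.Run.withEnds {A : CEFA α k} {q q' : Fin A.n} {w : List α} {v : Fin k → ℤ}
    (h : A.Run q w v q') (I F : List (Fin A.n)) : (A.withEnds I F).Run q w v q' := by
  induction h with
  | nil q => exact .nil (A := A.withEnds I F) q
  | cons ht _ ih => exact .cons (A := A.withEnds I F) ht ih

theorem CEFA.mem_lang_withEnds (A : CEFA α k) (I F : List (Fin A.n)) (w : List α)
    (v : Fin k → ℤ) : (w, v) ∈ (A.withEnds I F).lang ↔ ∃ q ∈ I, ∃ q' ∈ F, A.Run q w v q' :=
  ⟨fun ⟨q, hq, q', hq', h⟩ => ⟨q, hq, q', hq', h.withEnds A.init A.final⟩,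
    fun ⟨q, hq, q', hq', h⟩ => ⟨q, hq, q', hq', h.withEnds I F⟩⟩

/-- The pre-image under concatenation: one pair of automata for each state in the middle. -/
def concatRep (A : CEFA α k) : PreimageRep α (fun _ : Fin 2 => 0) k :=
  ⟨(List.finRange A.n).map fun q j => if j = 0
    then (A.withEnds A.init [q]).cast (Nat.zero_add k).symm
    else (A.withEnds [q] A.final).cast (Nat.zero_add k).symm, sumTerms 2 k⟩

theorem concatRep_represents (A : CEFA α k) :
    (concatRep A).Represents (concatFun α) Set.univ A.lang := by
  refine isPreimage_of (fun x w w' h h' => h.trans h'.symm) (fun x w hx => ⟨x, trivial, hx⟩)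
    (fun x _ v => ?_) fun _ _ _ => trivial
  have key : ∀ d : Fin 2 → Fin k → ℤ, withCosts x d ∈ (concatRep A).rel ↔
      ∃ q, (∃ p ∈ A.init, A.Run p (x 0).1 (d 0) q) ∧ ∃ p ∈ A.final, A.Run q (x 1).1 (d 1) p := by
    intro d
    simp only [PreimageRep.rel, concatRep, withCosts, List.mem_map, List.mem_finRange, true_and,
      exists_exists_eq_and, Set.mem_ofPred_eq, Fin.forall_fin_two, if_true, one_ne_zero, if_false]
    refine exists_congr fun q => ?_
    rw [CEFA.mem_lang_cast_zero, CEFA.mem_lang_cast_zero, CEFA.mem_lang_withEnds,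
      CEFA.mem_lang_withEnds]
    simp
  constructor
  · rintro ⟨d, hd, rfl⟩
    obtain ⟨q, ⟨p, hp, h⟩, p', hp', h'⟩ := (key d).1 hd
    refine ⟨_, rfl, p, hp, p', hp', ?_⟩
    change A.Run p _ (evalTerms (sumTerms 2 k) d) p'
    rw [evalTerms_sumTerms, Fin.sum_univ_two]
    exact h.append h'
  · rintro ⟨w, rfl, p, hp, p', hp', h⟩
    obtain ⟨q, v₁, v₂, h₁, h₂, hv⟩ := CEFA.Run.split h
    refine ⟨![v₁, v₂], (key _).2 ⟨q, ⟨p, hp, h₁⟩, p', hp', h₂⟩, ?_⟩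
    change v = evalTerms (sumTerms 2 k) _
    rw [evalTerms_sumTerms, Fin.sum_univ_two]
    exact hv

theorem concatRep_raw (A : CEFA α k) : (concatRep A).raw =
    ((List.range A.n).map fun q => [(A.raw.1, A.raw.2.1, A.raw.2.2.1, A.raw.2.2.2.1, [q], ()),
      (A.raw.1, A.raw.2.1, A.raw.2.2.1, [q], A.raw.2.2.2.2.1, ())],
      List.replicate k (0, [1, 1])) := by
  simp only [PreimageRep.raw, concatRep, sumTerms]
  congr 1
  · simp only [← List.map_coe_finRange_eq_range, List.map_map]
    refine List.map_congr_left fun q _ => ?_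
    simp only [List.ofFn_succ, List.ofFn_zero, Function.comp_apply, Fin.succ_zero_eq_one, if_true,
      one_ne_zero, if_false, CEFA.raw_cast]
    rfl
  · simp [List.ofFn_succ]

theorem CEFA.fullSize_withEnds_le (A : CEFA α k) (I F : List (Fin A.n)) :
    (A.withEnds I F).fullSize ≤ A.fullSize + I.length + F.length := by
  simp only [CEFA.fullSize, CEFA.size, CEFA.withEnds]
  omega

theorem concatRep_fullSize (A : CEFA α k) : (concatRep A).fullSize ≤ 7 * A.fullSize ^ 2 := by
  rw [concatRep, fullSize_sumTerms]
  have h0 : A.n + A.init.length + A.final.length + k + 1 ≤ A.fullSize := by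
    have := A.lengths_le; omega
  have h1 : ∀ q : Fin A.n, (A.withEnds A.init [q]).fullSize ≤ 2 * A.fullSize := fun q => by
    have := A.fullSize_withEnds_le A.init [q]; simp only [List.length_singleton] at this; omega
  have h2 : ∀ q : Fin A.n, (A.withEnds [q] A.final).fullSize ≤ 2 * A.fullSize := fun q => by
    have := A.fullSize_withEnds_le [q] A.final; simp only [List.length_singleton] at this; omega
  have h3 := List.sum_le_card_nsmul ((List.finRange A.n).map fun q =>
    (A.withEnds A.init [q]).fullSize + (A.withEnds [q] A.final).fullSize) (4 * A.fullSize) (by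
      simp only [List.mem_map]
      rintro _ ⟨q, _, rfl⟩
      have := h1 q
      have := h2 q
      omega)
  simp only [List.length_map, List.length_finRange, smul_eq_mul] at h3
  simp only [List.map_map, Function.comp_def, Fin.sum_univ_two, if_true, one_ne_zero, if_false,
    CEFA.fullSize_cast]
  nlinarith

theorem concat_computes : ∃ (P : TreeProgram) (c : ℕ), ∀ (k : ℕ) (A : CEFA α k),
    ComputesRep enc P (encCEFA enc A) (concatFun α) Set.univ A.lang (c * A.fullSize ^ 2) := by
  have hF : Comp (fun A : RawCEFA α => ((A.1.map fun q =>
      [(A.1, A.2.1, A.2.2.1, A.2.2.2.1, [q], ()), (A.1, A.2.1, A.2.2.1, [q], A.2.2.2.2.1, ())],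
      A.2.1.map fun _ => (0, [1, 1])) : RawRep α)) fun A => A.1.length + A.2.1.length := by
    refine (Comp.pair (Comp.map_const (s := fun _ => 0) (by fun_prop) (show ConstTime _ by fun_prop))
      (Comp.map_const (f := fun _ _ => ((0 : ℤ), [(1 : ℤ), 1])) (s := fun _ => 0) (by fun_prop)
        (show ConstTime _ by fun_prop))).mono 1 fun b => by simp
  obtain ⟨P, c, h⟩ := hF.computesRep
  refine ⟨P, c + 7, fun k A => ?_⟩
  rw [← CEFA.enc_raw]
  have h1 : 0 < A.fullSize := by simp [CEFA.fullSize]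
  refine h A.raw (concatRep A) ?_ (concatRep_represents A) ?_ ?_
  · rw [concatRep_raw]
    simp [CEFA.raw]
  · exact (concatRep_fullSize A).trans (Nat.mul_le_mul_right _ (by omega))
  · have h2 : A.raw.1.length + A.raw.2.1.length + 1 ≤ A.fullSize := by
      have := A.lengths_le
      simp [CEFA.raw]; omega
    have h3 : A.fullSize ≤ A.fullSize ^ 2 := Nat.le_self_pow (by norm_num) _
    exact Nat.mul_le_mul (by omega) (h2.trans h3)

/-! ### Substring -/

section substring
variable [Fintype α]

/-- Register updates with values for the two integer arguments of `substring`. -/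
def withArgs (s t : ℤ) (η : Fin k → ℤ) : Fin (2 + k) → ℤ := Fin.append ![s, t] η

theorem withArgs_add (s t s' t' : ℤ) (η η' : Fin k → ℤ) :
    withArgs s t η + withArgs s' t' η' = withArgs (s + s') (t + t') (η + η') := by
  funext i
  refine Fin.addCases (fun i => ?_) (fun i => ?_) i
  · fin_cases i <;> simp [withArgs, Fin.append_left]
  · simp [withArgs, Fin.append_right]

theorem withArgs_zero : withArgs 0 0 (0 : Fin k → ℤ) = 0 := by
  funext i
  refine Fin.addCases (fun i => ?_) (fun i => ?_) i
  · fin_cases i <;> simp [withArgs, Fin.append_left]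
  · simp [withArgs, Fin.append_right]

theorem withArgs_inj {s t s' t' : ℤ} {η η' : Fin k → ℤ}
    (h : withArgs s t η = withArgs s' t' η') : s = s' ∧ t = t' ∧ η = η' := by
  refine ⟨?_, ?_, ?_⟩
  · have := congrFun h (Fin.castAdd k 0)
    simpa [withArgs, Fin.append_left] using this
  · have := congrFun h (Fin.castAdd k 1)
    simpa [withArgs, Fin.append_left] using this
  · funext i
    have := congrFun h (Fin.natAdd 2 i)
    simpa [withArgs, Fin.append_right] using this

/-- The transitions of `CEFA.onFactor`. -/
noncomputable def CEFA.factorTrans (A : CEFA α k) :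
    List (Fin (A.n + 2) × α × Fin (A.n + 2) × (Fin (2 + k) → ℤ)) :=
  (A.trans.map fun τ => (τ.1.castAdd 2, τ.2.1, τ.2.2.1.castAdd 2, withArgs 0 1 τ.2.2.2)) ++
  (Finset.univ : Finset α).toList.flatMap fun a =>
    (Fin.natAdd A.n 0, a, Fin.natAdd A.n 0, withArgs 1 0 0) ::
    (Fin.natAdd A.n 1, a, Fin.natAdd A.n 1, withArgs 0 0 0) ::
    ((A.init.map fun q => (Fin.natAdd A.n 0, a, q.castAdd 2, withArgs 1 0 0)) ++
      A.final.map fun q => (q.castAdd 2, a, Fin.natAdd A.n 1, withArgs 0 0 0))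

/-- An automaton that simulates `A` on a factor of its input. It has two further states, one for
the letters before the factor and one for those after it; two further registers count the letters
before the factor and the letters of the factor. -/
noncomputable def CEFA.onFactor (A : CEFA α k) : CEFA α (2 + k) where
  n := A.n + 2
  trans := A.factorTrans
  init := Fin.natAdd A.n 0 :: A.init.map (Fin.castAdd 2)
  final := Fin.natAdd A.n 1 :: A.final.map (Fin.castAdd 2)

theorem CEFA.mem_factorTrans {A : CEFA α k} {x y : Fin (A.n + 2)} {a : α}
    {v : Fin (2 + k) → ℤ} : (x, a, y, v) ∈ A.factorTrans ↔
      (∃ q q' η, (q, a, q', η) ∈ A.trans ∧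
        x = Fin.castAdd 2 q ∧ y = Fin.castAdd 2 q' ∧ v = withArgs 0 1 η) ∨
      (x = Fin.natAdd A.n 0 ∧ y = Fin.natAdd A.n 0 ∧ v = withArgs 1 0 0) ∨
      (x = Fin.natAdd A.n 1 ∧ y = Fin.natAdd A.n 1 ∧ v = withArgs 0 0 0) ∨
      (∃ q ∈ A.init, x = Fin.natAdd A.n 0 ∧ y = Fin.castAdd 2 q ∧ v = withArgs 1 0 0) ∨
      ∃ q ∈ A.final, x = Fin.castAdd 2 q ∧ y = Fin.natAdd A.n 1 ∧ v = withArgs 0 0 0 := by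
  simp only [CEFA.factorTrans, List.mem_append, List.mem_map, List.mem_flatMap, Finset.mem_toList,
    Finset.mem_univ, true_and, List.mem_cons, Prod.exists, Prod.mk.injEq]
  constructor
  · rintro (⟨q, a, q', η, h, rfl, rfl, rfl, rfl⟩ | ⟨a, ⟨rfl, rfl, rfl, rfl⟩ | ⟨rfl, rfl, rfl, rfl⟩ |
      ⟨q, h, rfl, rfl, rfl, rfl⟩ | ⟨q, h, rfl, rfl, rfl, rfl⟩⟩)
    · exact .inl ⟨q, q', η, h, rfl, rfl, rfl⟩
    · exact .inr (.inl ⟨rfl, rfl, rfl⟩)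
    · exact .inr (.inr (.inl ⟨rfl, rfl, rfl⟩))
    · exact .inr (.inr (.inr (.inl ⟨q, h, rfl, rfl, rfl⟩)))
    · exact .inr (.inr (.inr (.inr ⟨q, h, rfl, rfl, rfl⟩)))
  · rintro (⟨q, q', η, h, rfl, rfl, rfl⟩ | ⟨rfl, rfl, rfl⟩ | ⟨rfl, rfl, rfl⟩ |
      ⟨q, h, rfl, rfl, rfl⟩ | ⟨q, h, rfl, rfl, rfl⟩)
    · exact .inl ⟨q, a, q', η, h, rfl, rfl, rfl, rfl⟩
    · exact .inr ⟨a, .inl ⟨rfl, rfl, rfl, rfl⟩⟩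
    · exact .inr ⟨a, .inr (.inl ⟨rfl, rfl, rfl, rfl⟩)⟩
    · exact .inr ⟨a, .inr (.inr (.inl ⟨q, h, rfl, rfl, rfl, rfl⟩))⟩
    · exact .inr ⟨a, .inr (.inr (.inr ⟨q, h, rfl, rfl, rfl, rfl⟩))⟩

theorem castAdd_ne_natAdd {n : ℕ} (q : Fin n) (i : Fin 2) : Fin.castAdd 2 q ≠ Fin.natAdd n i := by
  intro h
  have := congrArg Fin.val h
  simp at this
  omega

theorem natAdd_zero_ne_one (n : ℕ) : Fin.natAdd n (0 : Fin 2) ≠ Fin.natAdd n 1 := by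
  intro h
  have := congrArg Fin.val h
  simp at this

/-- The runs from the three kinds of states: after, inside and before the factor. -/
theorem CEFA.Run.of_onFactor {A : CEFA α k} {x y : Fin A.onFactor.n} {w : List α}
    {v : Fin (2 + k) → ℤ} (h : A.onFactor.Run x w v y) (hy : y ∈ A.onFactor.final) :
    (x = Fin.natAdd A.n 1 → v = withArgs 0 0 0) ∧
    (∀ q, x = Fin.castAdd 2 q → ∃ mid post η, w = mid ++ post ∧ v = withArgs 0 mid.length η ∧
      ∃ q' ∈ A.final, A.Run q mid η q') ∧
    (x = Fin.natAdd A.n 0 → ∃ pre mid post η, w = pre ++ (mid ++ post) ∧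
      v = withArgs pre.length mid.length η ∧ ∃ q ∈ A.init, ∃ q' ∈ A.final, A.Run q mid η q') := by
  induction h with
  | nil x =>
    have hy : x = Fin.natAdd A.n 1 ∨ ∃ q ∈ A.final, Fin.castAdd 2 q = x :=
      (List.mem_cons.1 hy).imp_right List.mem_map.1
    refine ⟨fun _ => withArgs_zero.symm, ?_, ?_⟩
    · rintro q rfl
      obtain hy | ⟨q', hq', hy⟩ := hy
      · exact (castAdd_ne_natAdd _ _ hy).elim
      · rw [Fin.castAdd_inj] at hy
        exact ⟨[], [], 0, rfl, withArgs_zero.symm, q, hy ▸ hq', .nil q⟩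
    · rintro rfl
      obtain hy | ⟨q', hq', hy⟩ := hy
      · exact (natAdd_zero_ne_one _ hy).elim
      · exact (castAdd_ne_natAdd _ _ hy).elim
  | @cons x z y a w η v ht _ ih =>
    obtain ⟨ih1, ih2, ih3⟩ := ih hy
    replace ht := CEFA.mem_factorTrans.1 ht
    obtain ⟨q, q', η, h, rfl, rfl, rfl⟩ | ⟨rfl, rfl, rfl⟩ | ⟨rfl, rfl, rfl⟩ |
      ⟨q, h, rfl, rfl, rfl⟩ | ⟨q, h, rfl, rfl, rfl⟩ := ht
    · refine ⟨fun h' => (castAdd_ne_natAdd _ _ h').elim, fun p hp => ?_,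
        fun h' => (castAdd_ne_natAdd _ _ h').elim⟩
      obtain rfl : q = p := Fin.castAdd_injective _ _ hp
      obtain ⟨mid, post, η', rfl, rfl, r, hr, h'⟩ := ih2 q' rfl
      refine ⟨a :: mid, post, η + η', rfl, ?_, r, hr, .cons h h'⟩
      rw [withArgs_add]
      simp [add_comm]
    · refine ⟨fun h' => (natAdd_zero_ne_one _ h').elim,
        fun p hp => (castAdd_ne_natAdd _ _ hp.symm).elim, fun _ => ?_⟩
      obtain ⟨pre, mid, post, η', rfl, rfl, h'⟩ := ih3 rfl
      refine ⟨a :: pre, mid, post, η', rfl, ?_, h'⟩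
      rw [withArgs_add]
      simp [add_comm]
    · refine ⟨fun _ => ?_, fun p hp => (castAdd_ne_natAdd _ _ hp.symm).elim,
        fun h' => (natAdd_zero_ne_one _ h'.symm).elim⟩
      rw [ih1 rfl, withArgs_add]
      simp
    · refine ⟨fun h' => (natAdd_zero_ne_one _ h').elim,
        fun p hp => (castAdd_ne_natAdd _ _ hp.symm).elim, fun _ => ?_⟩
      obtain ⟨mid, post, η', rfl, rfl, h'⟩ := ih2 q rfl
      refine ⟨[a], mid, post, η', rfl, ?_, q, h, h'⟩
      rw [withArgs_add]
      simp
    · refine ⟨fun h' => (castAdd_ne_natAdd _ _ h').elim, fun p hp => ?_,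
        fun h' => (castAdd_ne_natAdd _ _ h').elim⟩
      obtain rfl : q = p := Fin.castAdd_injective _ _ hp
      refine ⟨[], a :: w, 0, rfl, ?_, q, h, .nil q⟩
      rw [ih1 rfl, withArgs_add]
      simp

theorem CEFA.onFactor_run_after (A : CEFA α k) (w : List α) :
    A.onFactor.Run (Fin.natAdd A.n 1) w (withArgs 0 0 0) (Fin.natAdd A.n 1) := by
  induction w with
  | nil => rw [withArgs_zero]; exact .nil (A := A.onFactor) _
  | cons a w ih =>
    have := CEFA.Run.cons (A := A.onFactor)
      (CEFA.mem_factorTrans.2 (.inr (.inr (.inl ⟨rfl, rfl, rfl⟩))) : (_, a, _, _) ∈ _) ih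
    simpa [withArgs_add] using this

theorem CEFA.Run.onFactor {A : CEFA α k} {q q' : Fin A.n} {w : List α} {v : Fin k → ℤ}
    (h : A.Run q w v q') :
    A.onFactor.Run (Fin.castAdd 2 q) w (withArgs 0 w.length v) (Fin.castAdd 2 q') := by
  induction h with
  | nil q => exact withArgs_zero ▸ .nil (A := A.onFactor) _
  | @cons q q' q'' a w η v ht _ ih =>
    have := CEFA.Run.cons (A := A.onFactor)
      (CEFA.mem_factorTrans.2 (.inl ⟨q, q', η, ht, rfl, rfl, rfl⟩) : (_, a, _, _) ∈ _) ih
    simpa [withArgs_add, add_comm] using this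

theorem CEFA.onFactor_run_before {A : CEFA α k} {q : Fin A.n} (hq : q ∈ A.init) (w : List α)
    (a : α) : A.onFactor.Run (Fin.natAdd A.n 0) (a :: w) (withArgs (w.length + 1) 0 0)
      (Fin.castAdd 2 q) := by
  induction w generalizing a with
  | nil =>
    have := CEFA.Run.cons (A := A.onFactor)
      (CEFA.mem_factorTrans.2 (.inr (.inr (.inr (.inl ⟨q, hq, rfl, rfl, rfl⟩)))) :
        (_, a, _, _) ∈ _) (.nil (A := A.onFactor) _)
    simpa using this
  | cons b w ih =>
    have := CEFA.Run.cons (A := A.onFactor)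
      (CEFA.mem_factorTrans.2 (.inr (.inl ⟨rfl, rfl, rfl⟩)) : (_, a, _, _) ∈ _) (ih b)
    simpa [withArgs_add, add_comm] using this

theorem CEFA.mem_lang_onFactor (A : CEFA α k) (w : List α) (v : Fin (2 + k) → ℤ) :
    (w, v) ∈ A.onFactor.lang ↔ ∃ pre mid post η, w = pre ++ (mid ++ post) ∧
      v = withArgs pre.length mid.length η ∧ (mid, η) ∈ A.lang := by
  constructor
  · rintro ⟨x, hx, y, hy, h⟩
    have hx : x = Fin.natAdd A.n 0 ∨ ∃ q ∈ A.init, Fin.castAdd 2 q = x :=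
      (List.mem_cons.1 hx).imp_right List.mem_map.1
    obtain ⟨-, h2, h3⟩ := CEFA.Run.of_onFactor h hy
    obtain rfl | ⟨q, hq, rfl⟩ := hx
    · exact h3 rfl
    · obtain ⟨mid, post, η, hw, hv, q', hq', h'⟩ := h2 q rfl
      exact ⟨[], mid, post, η, hw, hv, q, hq, q', hq', h'⟩
  · rintro ⟨pre, mid, post, η, rfl, rfl, q, hq, q', hq', h⟩
    have h1 : ∃ y ∈ A.onFactor.final, A.onFactor.Run (Fin.castAdd 2 q) (mid ++ post)
        (withArgs 0 mid.length η) y := by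
      cases post with
      | nil =>
        refine ⟨Fin.castAdd 2 q', List.mem_cons_of_mem _ (List.mem_map_of_mem hq'), ?_⟩
        simpa using h.onFactor
      | cons a post =>
        refine ⟨Fin.natAdd A.n 1, List.mem_cons_self, ?_⟩
        have := h.onFactor.append (CEFA.Run.cons (A := A.onFactor) (CEFA.mem_factorTrans.2
          (.inr (.inr (.inr (.inr ⟨q', hq', rfl, rfl, rfl⟩)))) : (_, a, _, _) ∈ _)
          (A.onFactor_run_after post))
        simpa [withArgs_add] using this
    obtain ⟨y, hy, h1⟩ := h1
    cases pre with
    | nil => exact ⟨Fin.castAdd 2 q, List.mem_cons_of_mem _ (List.mem_map_of_mem hq), y, hy, h1⟩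
    | cons a pre =>
      refine ⟨Fin.natAdd A.n 0, List.mem_cons_self, y, hy, ?_⟩
      have := (CEFA.onFactor_run_before hq pre a).append h1
      simpa [withArgs_add] using this

/-- The pre-image under `substring`. -/
noncomputable def substringRep (A : CEFA α k) : PreimageRep α (fun _ : Fin 1 => 2) k :=
  ⟨[fun _ => A.onFactor], sumTerms 1 k⟩

theorem substring_eq {y : List α} {s t : ℤ} (hs : 0 ≤ s)
    (h : s + t ≤ y.length) : substring y s t = (y.drop s.toNat).take t.toNat := by
  rw [substring]
  split_ifs with hc
  · obtain hc | hc | hc := hc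
    · omega
    · have : t.toNat = 0 := by omega
      simp [this]
    · simp [hc]
  · rfl

theorem substringRep_represents (A : CEFA α k) :
    (substringRep A).Represents (substringFun α) (substringDom α) A.lang := by
  have key : ∀ (x : Args α fun _ : Fin 1 => 2) (d : Fin 1 → Fin k → ℤ),
      withCosts x d ∈ (substringRep A).rel ↔ ∃ pre mid post, (x 0).1 = pre ++ (mid ++ post) ∧
        (x 0).2 0 = pre.length ∧ (x 0).2 1 = mid.length ∧ (mid, d 0) ∈ A.lang := by
    intro x d
    have hx : Fin.append (x 0).2 (d 0) = withArgs ((x 0).2 0) ((x 0).2 1) (d 0) := by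
      rw [withArgs]
      congr 1
      funext i
      fin_cases i <;> rfl
    have : withCosts x d ∈ (substringRep A).rel ↔
        ((x 0).1, withArgs ((x 0).2 0) ((x 0).2 1) (d 0)) ∈ A.onFactor.lang := by
      rw [← hx]
      simp [PreimageRep.rel, substringRep, withCosts]
    rw [this, CEFA.mem_lang_onFactor]
    constructor
    · rintro ⟨pre, mid, post, η, hw, hv, h⟩
      obtain ⟨h1, h2, h3⟩ := withArgs_inj hv
      exact ⟨pre, mid, post, hw, h1, h2, h3 ▸ h⟩
    · rintro ⟨pre, mid, post, hw, h1, h2, h⟩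
      exact ⟨pre, mid, post, d 0, hw, by rw [h1, h2], h⟩
  refine isPreimage_of (fun x w w' h h' => h.trans h'.symm) ?_ ?_ ?_
  · rintro x w -
    refine ⟨fun _ => (w, ![0, (w.length : ℤ)]), by simp [substringDom], ?_⟩
    change w = substring w 0 (w.length : ℤ)
    rw [substring_eq] <;> simp
  · rintro x ⟨h1, h2, h3⟩ v
    simp only [substringFun, exists_eq_left, substring_eq h1 h3]
    constructor
    · rintro ⟨d, hd, rfl⟩
      obtain ⟨pre, mid, post, hw, h4, h5, h⟩ := (key x d).1 hd
      change (_, evalTerms (sumTerms 1 k) d) ∈ A.lang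
      rw [evalTerms_sumTerms, Fin.sum_univ_one, hw, h4, h5]
      simpa using h
    · intro h
      refine ⟨fun _ => v, (key x _).2 ⟨(x 0).1.take ((x 0).2 0).toNat, _,
        ((x 0).1.drop ((x 0).2 0).toNat).drop ((x 0).2 1).toNat, ?_, ?_, ?_, h⟩, ?_⟩
      · rw [List.take_append_drop, List.take_append_drop]
      · rw [List.length_take]; omega
      · rw [List.length_take, List.length_drop]; omega
      · change v = evalTerms (sumTerms 1 k) _
        rw [evalTerms_sumTerms, Fin.sum_univ_one]
  · intro x d hd
    obtain ⟨pre, mid, post, hw, h4, h5, h⟩ := (key x d).1 hd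
    refine ⟨by omega, by omega, ?_⟩
    rw [h4, h5, hw]
    simp

/-- The new state of `CEFA.onFactor` from the list of the old ones. -/
def freshState (l : List ℕ) : ℕ := listCase l.getLast?.toList 0 fun x _ => x + 1

theorem freshState_range (n : ℕ) : freshState (List.range n) = n := by
  cases n with
  | zero => rfl
  | succ n => simp [freshState, List.range_succ]

theorem Comp.freshState : Comp freshState fun l => l.length + CostEnriched.freshState l := by
  have h : Comp (fun p : Unit × List ℕ => p.2.getLast?.toList) fun p => p.2.length := by
    refine Comp.listRec (z := fun _ => []) (.const [])
      (s := fun b => listCase b.2.2.1 [b.2.1] fun _ _ => b.2.2.2) (u := fun _ => 0)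
      ((Comp.list_case (r := fun _ => 0) (t := fun _ => 0) (u := fun _ => 0)
        (show ConstTime _ by fun_prop) (show ConstTime _ by fun_prop)
        (show ConstTime _ by fun_prop)).mono 1 ?_) (fun _ => rfl) ?_ (fun _ => by simp) ?_
    · rintro ⟨_, _, _ | ⟨_, _⟩, _⟩ <;> simp
    · rintro _ x (_ | ⟨y, xs⟩) <;> simp [List.getLast?_cons_cons]
    · intro _ x xs; simp; omega
  refine (Comp.list_case (h.comp_const (f := fun l => ((), l)) (by fun_prop)) (.const 0)
    (Comp.succ.comp_const (f := fun p : List ℕ × ℕ × List ℕ => p.2.1) (by fun_prop))).mono 1 ?_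
  intro l
  simp only [CostEnriched.freshState]
  cases l.getLast?.toList <;> simp
  omega

theorem Comp.flatMap_const {β γ δ : Type*} [TreeEnc β] [TreeEnc γ] (l : List δ)
    {g : δ → β → List γ} {t : β → ℕ} (hg : ∀ a, Comp (g a) t) (hlen : ∀ a b, (g a b).length ≤ t b) :
    Comp (fun b => l.flatMap fun a => g a b) t := by
  induction l with
  | nil => exact (Comp.const []).mono 1 fun b => by simp
  | cons a l ih =>
    exact (Comp.append (hg a) ih).mono 3 fun b => by have := hlen a b; omega

variable (α) in
/-- The program for `substring`, as a function of the automaton, the two new states and a zero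
vector. -/
noncomputable def factorRaw (p : (ℕ × ℕ × List ℤ) × RawCEFA α) : RawCEFA α :=
  (p.2.1 ++ [p.1.1, p.1.2.1], () :: () :: p.2.2.1,
    (p.2.2.2.1.map fun τ => (τ.1, τ.2.1, τ.2.2.1, 0 :: 1 :: τ.2.2.2.1, ())) ++
    ((Finset.univ : Finset α).toList.flatMap fun a =>
      (p.1.1, a, p.1.1, 1 :: 0 :: p.1.2.2, ()) ::
      (p.1.2.1, a, p.1.2.1, 0 :: 0 :: p.1.2.2, ()) ::
      ((p.2.2.2.2.1.map fun q => (p.1.1, a, q, 1 :: 0 :: p.1.2.2, ())) ++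
        p.2.2.2.2.2.1.map fun q => (q, a, p.1.2.1, 0 :: 0 :: p.1.2.2, ()))),
    p.1.1 :: p.2.2.2.2.1, p.1.2.1 :: p.2.2.2.2.2.1, ())

theorem Comp.factorRaw : Comp (factorRaw α) fun p => p.2.1.length + p.2.2.2.1.length +
    (p.2.2.2.2.1.length + p.2.2.2.2.2.1.length + 2) := by
  have h1 : Comp (fun p : (ℕ × ℕ × List ℤ) × RawCEFA α => p.2.1 ++ [p.1.1, p.1.2.1])
      fun p => p.2.1.length :=
    (Comp.append (t := fun _ => 0) (s := fun _ => 0) (show ConstTime _ by fun_prop)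
      (show ConstTime _ by fun_prop)).mono 1 fun b => by simp
  have h2 : Comp (fun p : (ℕ × ℕ × List ℤ) × RawCEFA α =>
      p.2.2.2.1.map fun τ => (τ.1, τ.2.1, τ.2.2.1, (0 : ℤ) :: 1 :: τ.2.2.2.1, ()))
      fun p => p.2.2.2.1.length :=
    (Comp.map_const (s := fun _ => 0) (by fun_prop) (show ConstTime _ by fun_prop)).mono 1
      fun b => by simp
  have h3 : ∀ a : α, Comp (fun p : (ℕ × ℕ × List ℤ) × RawCEFA α =>
      (p.1.1, a, p.1.1, 1 :: 0 :: p.1.2.2, ()) ::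
      (p.1.2.1, a, p.1.2.1, 0 :: 0 :: p.1.2.2, ()) ::
      ((p.2.2.2.2.1.map fun q => (p.1.1, a, q, 1 :: 0 :: p.1.2.2, ())) ++
        p.2.2.2.2.2.1.map fun q => (q, a, p.1.2.1, 0 :: 0 :: p.1.2.2, ())))
      fun p => p.2.2.2.2.1.length + p.2.2.2.2.2.1.length + 2 := by
    intro a
    refine (Comp.cons (t := fun _ => 0) (show ConstTime _ by fun_prop)
      (Comp.cons (t := fun _ => 0) (show ConstTime _ by fun_prop)
      (Comp.append (Comp.map_const (s := fun _ => 0) (by fun_prop) (show ConstTime _ by fun_prop))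
        (Comp.map_const (s := fun _ => 0) (by fun_prop) (show ConstTime _ by fun_prop))))).mono 2
      fun b => ?_
    simp
    omega
  have h4 := Comp.flatMap_const (Finset.univ : Finset α).toList h3 fun a b => by simp
  refine (h1.pair (Comp.pair_const (f := fun p => () :: () :: p.2.2.1) (by fun_prop)
    (Comp.pair (g := fun p => (p.1.1 :: p.2.2.2.2.1, p.1.2.1 :: p.2.2.2.2.2.1, ())) (s := fun _ => 0)
      (Comp.append h2 h4) (show ConstTime _ by fun_prop)))).mono 2 ?_
  intro b
  simp
  omega

theorem CEFA.onFactor_raw (A : CEFA α k) : A.onFactor.raw =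
    factorRaw α ((A.n, A.n + 1, List.replicate k 0), A.raw) := by
  have hv : ∀ (s t : ℤ) (η : Fin k → ℤ), List.ofFn (withArgs s t η) = s :: t :: List.ofFn η := by
    intro s t η
    rw [withArgs, List.ofFn_fin_append]
    simp [List.ofFn_succ]
  have hz : List.ofFn (0 : Fin k → ℤ) = List.replicate k 0 := by
    simp [List.ofFn_const, Pi.zero_def]
  simp only [CEFA.raw, factorRaw, CEFA.onFactor, CEFA.factorTrans, Prod.mk.injEq]
  refine ⟨by simp [List.range_succ], ?_, ?_, ?_, ?_, trivial⟩
  · rw [add_comm, List.replicate_succ, List.replicate_succ]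
  · simp [List.map_flatMap, Function.comp_def, hv, hz]
  · simp [Function.comp_def]
  · simp [Function.comp_def]

theorem bits_withArgs (s t : ℤ) (hs : s = 0 ∨ s = 1) (ht : t = 0 ∨ t = 1) (η : Fin k → ℤ) :
    bits (withArgs s t η) = bits η := by
  rw [bits, Fin.sum_univ_add]
  simp only [withArgs, Fin.append_left, Fin.append_right, Fin.sum_univ_two]
  rcases hs with rfl | rfl <;> rcases ht with rfl | rfl <;> simp [bits]

theorem CEFA.fullSize_onFactor (A : CEFA α k) :
    A.onFactor.fullSize ≤ (6 * Fintype.card α + 7) * A.fullSize := by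
  have h0 : bits (0 : Fin k → ℤ) = 0 := by simp [bits]
  have hsize : A.onFactor.size = A.size +
      Fintype.card α * (6 + 3 * (A.init.length + A.final.length)) := by
    rw [← Finset.card_univ, ← Finset.length_toList]
    simp only [CEFA.size, CEFA.onFactor, CEFA.factorTrans, List.map_append, List.sum_append]
    congr 1
    · simp [Function.comp_def, bits_withArgs]
    · induction (Finset.univ : Finset α).toList with
      | nil => simp
      | cons a l ih =>
        simp only [List.flatMap_cons, List.map_append, List.sum_append, ih]
        simp [Function.comp_def, bits_withArgs, h0]
        ring
  have h1 := A.lengths_le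
  rw [CEFA.fullSize, hsize]
  simp only [CEFA.onFactor, List.length_cons, List.length_map]
  have h2 : A.size + A.n + A.init.length + A.final.length + k + 1 = A.fullSize := rfl
  nlinarith [Nat.mul_le_mul_left (Fintype.card α)
    (show 6 + 3 * (A.init.length + A.final.length) ≤ 6 * A.fullSize by omega)]

theorem substring_computes : ∃ (P : TreeProgram) (c : ℕ), ∀ (k : ℕ) (A : CEFA α k),
    ComputesRep enc P (encCEFA enc A) (substringFun α) (substringDom α) A.lang
      (c * A.fullSize) := by
  have h1 : Comp (fun A : RawCEFA α => A.2.1.map fun _ => (0 : ℤ)) fun A => A.2.1.length :=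
    (Comp.map_const (s := fun _ => 0) (by fun_prop) (show ConstTime _ by fun_prop)).mono 1
      fun b => by simp
  have h2 : Comp (fun A : RawCEFA α => freshState A.1)
      fun A => A.1.length + freshState A.1 :=
    Comp.freshState.comp_const (by fun_prop)
  have h3 : Comp (fun A : RawCEFA α => freshState A.1 + 1)
      fun A => A.1.length + freshState A.1 :=
    (Comp.succ.comp h2).mono 2 fun b => by omega
  have hF := Comp.factorRaw.comp ((h2.pair (h3.pair h1)).pair Comp.id)
  have hrep : Comp (fun A : RawCEFA α => ([[factorRaw α ((freshState A.1, freshState A.1 + 1,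
      A.2.1.map fun _ => (0 : ℤ)), A)]], A.2.1.map fun _ => ((0 : ℤ), [(1 : ℤ)])))
      fun A => A.1.length + freshState A.1 + A.2.1.length + A.2.2.1.length +
        A.2.2.2.1.length + A.2.2.2.2.1.length := by
    refine ((Comp.cons (Comp.cons hF (.const [])) (.const [])).pair
      (Comp.map_const (f := fun _ _ => ((0 : ℤ), [(1 : ℤ)])) (s := fun _ => 0) (by fun_prop)
        (show ConstTime _ by fun_prop))).mono 4 fun b => ?_
    simp only
    omega
  obtain ⟨P, c, h⟩ := hrep.computesRep
  refine ⟨P, 2 * c + (6 * Fintype.card α + 9), fun k A => ?_⟩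
  have hl := A.lengths_le
  rw [← CEFA.enc_raw]
  refine h A.raw (substringRep A) ?_ (substringRep_represents A) ?_ ?_
  · simp only [PreimageRep.raw, substringRep, sumTerms, List.map_cons, List.map_nil,
      List.ofFn_succ, List.ofFn_zero, CEFA.onFactor_raw]
    simp [CEFA.raw, freshState_range]
  · rw [substringRep, fullSize_sumTerms]
    have := A.fullSize_onFactor
    simp
    nlinarith
  · have h4 : freshState A.raw.1 = A.n := freshState_range _
    rw [h4]
    have h5 : A.raw.1.length + A.n + A.raw.2.1.length + A.raw.2.2.1.length +
        A.raw.2.2.2.1.length + A.raw.2.2.2.2.1.length + 1 ≤ 2 * A.fullSize := by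
      simp [CEFA.raw]; omega
    nlinarith [Nat.mul_le_mul_left c h5]

end substring

end

/-! ### Runs of an automaton on a fixed word -/

section
variable {α : Type*} [TreeEnc α] [InjEnc α] [Fintype α] [DecidableEq α] {k : ℕ}

/-- The extensions of the runs in `r` by a first transition on the letter `a`. -/
def extendRuns (A : RawCEFA α) (a : α) (r : List (ℕ × ℕ × List ℤ)) : List (ℕ × ℕ × List ℤ) :=
  A.2.2.1.flatMap fun τ => bif decide (τ.2.1 = a) then
    r.flatMap fun p => bif decide (p.1 = τ.2.2.1) then
      [(τ.1, p.2.1, List.zipWith (· + ·) τ.2.2.2.1 p.2.2)] else [] else []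

/-- The runs of an automaton on a word: first state, last state and sum of the updates. -/
def wordRuns (A : RawCEFA α) : List α → List (ℕ × ℕ × List ℤ)
  | [] => A.1.map fun q => (q, q, A.2.1.map fun _ => 0)
  | a :: u => extendRuns A a (wordRuns A u)

theorem mem_wordRuns {A : CEFA α k} {u : List α} {p : ℕ × ℕ × List ℤ} :
    p ∈ wordRuns A.raw u ↔ ∃ q q' v, A.Run q u v q' ∧ p = (q.val, q'.val, List.ofFn v) := by
  have hz : List.map (fun _ => (0 : ℤ)) A.raw.2.1 = List.ofFn (0 : Fin k → ℤ) := by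
    simp [CEFA.raw, List.ofFn_const, Pi.zero_def]
  induction u generalizing p with
  | nil =>
    simp only [wordRuns, hz, List.mem_map]
    constructor
    · rintro ⟨q, hq, rfl⟩
      exact ⟨⟨q, by simpa [CEFA.raw] using hq⟩, _, 0, .nil _, rfl⟩
    · rintro ⟨q, q', v, h, rfl⟩
      cases h
      exact ⟨q, by simp [CEFA.raw], rfl⟩
  | cons a u ih =>
    have hadd : ∀ η v : Fin k → ℤ,
        List.zipWith (· + ·) (List.ofFn η) (List.ofFn v) = List.ofFn (η + v) := by
      intro η v
      apply List.ext_getElem <;> simp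
    simp only [wordRuns, extendRuns, List.mem_flatMap]
    constructor
    · rintro ⟨τ, hτ, h⟩
      simp only [CEFA.raw, List.mem_map] at hτ
      obtain ⟨⟨q, b, q', η⟩, hτ, rfl⟩ := hτ
      by_cases hb : b = a
      · subst hb
        simp only [decide_true, cond_true, List.mem_flatMap] at h
        obtain ⟨p', hp', h⟩ := h
        obtain ⟨r, r', v, hr, rfl⟩ := ih.1 hp'
        by_cases hq : r.val = q'.val
        · simp only [hq, decide_true, cond_true, List.mem_singleton, hadd] at h
          obtain rfl := Fin.ext hq
          exact ⟨q, r', _, .cons hτ hr, h⟩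
        · simp [hq] at h
      · simp [hb] at h
    · rintro ⟨q, q'', v, h, rfl⟩
      cases h with
      | @cons _ q' _ _ _ η v ht h =>
        refine ⟨(q, a, q', List.ofFn η, ()), ?_, ?_⟩
        · exact List.mem_map_of_mem (f := fun τ : Fin A.n × α × Fin A.n × (Fin k → ℤ) =>
            (τ.1.val, τ.2.1, τ.2.2.1.val, List.ofFn τ.2.2.2, ())) ht
        · simp only [decide_true, cond_true, List.mem_flatMap]
          exact ⟨_, ih.2 ⟨q', q'', v, h, rfl⟩, by simp [hadd]⟩

/-! ### The number of runs

The number of runs is exponential in the length of the word, and so are the running time and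
the size of the result, with the size of the automaton as the base. -/

theorem Nat.size_add_le (x y : ℕ) : (x + y).size ≤ x.size + y.size + 1 := by
  rw [Nat.size_le]
  have hx := Nat.lt_size_self x
  have hy := Nat.lt_size_self y
  have h1 : 2 ^ x.size ≤ 2 ^ (x.size + y.size) := Nat.pow_le_pow_right (by norm_num) (by omega)
  have h2 : 2 ^ y.size ≤ 2 ^ (x.size + y.size) := Nat.pow_le_pow_right (by norm_num) (by omega)
  rw [pow_succ]; omega

/-- The number of bits of a vector, counted such that it is subadditive. -/
def vecWeight (v : List ℤ) : ℕ := (v.map fun z => z.natAbs.size + 1).sum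

theorem sz_int (z : ℤ) : sz z = sz (decide (z < 0)) + sz z.natAbs + 1 := rfl

theorem sz_vec_le (v : List ℤ) : sz v ≤ 6 * vecWeight v + 1 := by
  induction v with
  | nil => simp
  | cons z v ih =>
    have h1 := sz_bool_le (decide (z < 0))
    have h2 := sz_nat_le z.natAbs
    simp only [sz_cons, vecWeight, List.map_cons, List.sum_cons, sz_int] at ih ⊢
    omega

theorem vecWeight_le_sz (v : List ℤ) : vecWeight v ≤ sz v := by
  induction v with
  | nil => simp [vecWeight]
  | cons z v ih =>
    have h2 := size_le_sz z.natAbs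
    simp only [sz_cons, vecWeight, List.map_cons, List.sum_cons, sz_int] at ih ⊢
    omega

theorem vecWeight_add_le (v v' : List ℤ) :
    vecWeight (List.zipWith (· + ·) v v') ≤ vecWeight v + vecWeight v' := by
  induction v generalizing v' with
  | nil => simp [vecWeight]
  | cons z v ih =>
    cases v' with
    | nil => simp [vecWeight]
    | cons z' v' =>
      have h1 := ih v'
      have h2 : (z + z').natAbs.size ≤ z.natAbs.size + z'.natAbs.size + 1 :=
        (Nat.size_le_size (Int.natAbs_add_le z z')).trans (Nat.size_add_le _ _)
      simp only [List.zipWith_cons_cons, vecWeight, List.map_cons, List.sum_cons] at h1 ⊢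
      omega

theorem wordRuns_elem_le (A : RawCEFA α) (u : List α) :
    ∀ p ∈ wordRuns A u, sz p.1 ≤ sz A ∧ sz p.2.1 ≤ sz A ∧
      vecWeight p.2.2 ≤ (u.length + 1) * sz A := by
  induction u with
  | nil =>
    simp only [wordRuns, List.mem_map]
    rintro _ ⟨q, hq, rfl⟩
    have h1 := sz_lt_of_mem hq
    have h2 : vecWeight (A.2.1.map fun _ => 0) = A.2.1.length := by
      simp [vecWeight]
    have h3 := length_lt_sz A.2.1
    simp only [sz_pair A, sz_pair A.2, h2]
    simp
    omega
  | cons a u ih =>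
    simp only [wordRuns, extendRuns, List.mem_flatMap]
    rintro p ⟨τ, hτ, hp⟩
    by_cases hb : τ.2.1 = a
    · simp only [hb, decide_true, cond_true, List.mem_flatMap] at hp
      obtain ⟨p', hp', hp⟩ := hp
      by_cases hq : p'.1 = τ.2.2.1
      · simp only [hq, decide_true, cond_true, List.mem_singleton] at hp
        subst hp
        obtain ⟨h1, h2, h3⟩ := ih p' hp'
        have h4 := sz_lt_of_mem hτ
        have h5 := vecWeight_add_le τ.2.2.2.1 p'.2.2
        have h6 := vecWeight_le_sz τ.2.2.2.1
        have h7 : sz A.2.2.1 ≤ sz A := by simp only [sz_pair A, sz_pair A.2, sz_pair A.2.2]; omega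
        simp only [sz_pair τ, sz_pair τ.2, sz_pair τ.2.2, sz_pair τ.2.2.2] at h4
        refine ⟨by simp only; omega, h2, ?_⟩
        simp only [List.length_cons]
        have : (u.length + 1 + 1) * sz A = (u.length + 1) * sz A + sz A := by ring
        omega
      · simp [hq] at hp
    · simp [hb] at hp

theorem wordRuns_length_le (A : RawCEFA α) (u : List α) :
    (wordRuns A u).length ≤ sz A ^ (u.length + 1) := by
  induction u with
  | nil =>
    have h := length_lt_sz A.1
    simp only [wordRuns, List.length_map, List.length_nil, zero_add, pow_one, sz_pair A]
    omega
  | cons a u ih =>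
    have h : (extendRuns A a (wordRuns A u)).length ≤
        A.2.2.1.length * (wordRuns A u).length := by
      simp only [extendRuns, List.length_flatMap]
      refine (List.sum_le_card_nsmul _ (wordRuns A u).length ?_).trans (by simp)
      simp only [List.mem_map]
      rintro _ ⟨τ, -, rfl⟩
      cases decide (τ.2.1 = a)
      · simp
      · simp only [cond_true, List.length_flatMap]
        refine (List.sum_le_card_nsmul _ 1 ?_).trans (by simp)
        simp only [List.mem_map]
        rintro _ ⟨p, -, rfl⟩
        cases decide (p.1 = τ.2.2.1) <;> simp
    have h1 := length_lt_sz A.2.2.1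
    have h2 : sz A.2.2.1 ≤ sz A := by simp only [sz_pair A, sz_pair A.2, sz_pair A.2.2]; omega
    rw [wordRuns, List.length_cons, pow_succ']
    exact h.trans (Nat.mul_le_mul (by omega) ih)

theorem le_base_pow {B : ℕ} (hB : 2 ≤ B) (n : ℕ) : n ≤ B ^ n :=
  Nat.lt_two_pow_self.le.trans (Nat.pow_le_pow_left hB n)

/-- The form of the exponential bounds: `(|A| + 2) ^ (c (|u| + 1))`. -/
def ExpBd {X : Type*} (base exp : X → ℕ) (h : X → ℕ) : Prop :=
  ∃ c, ∀ x, h x ≤ (base x + 2) ^ (c * (exp x + 1))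

section ExpBd
variable {X Y : Type*} {bs ex h h' : X → ℕ}

theorem ExpBd.mono (hh : ExpBd bs ex h') (hle : ∀ x, h x ≤ h' x) : ExpBd bs ex h :=
  let ⟨c, hc⟩ := hh
  ⟨c, fun x => (hle x).trans (hc x)⟩

theorem ExpBd.const (n : ℕ) : ExpBd bs ex fun _ => n :=
  ⟨n, fun x => (le_base_pow (by omega) n).trans
    (Nat.pow_le_pow_right (by omega) (Nat.le_mul_of_pos_right _ (by omega)))⟩

theorem ExpBd.base : ExpBd bs ex bs :=
  ⟨1, fun x => (show bs x ≤ (bs x + 2) ^ 1 by rw [pow_one]; omega).trans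
    (Nat.pow_le_pow_right (by omega) (by omega))⟩

theorem ExpBd.exp : ExpBd bs ex ex :=
  ⟨1, fun x => (le_base_pow (by omega) _).trans (Nat.pow_le_pow_right (by omega) (by omega))⟩

theorem ExpBd.mul (hh : ExpBd bs ex h) (hh' : ExpBd bs ex h') :
    ExpBd bs ex fun x => h x * h' x := by
  obtain ⟨c, hc⟩ := hh
  obtain ⟨d, hd⟩ := hh'
  exact ⟨c + d, fun x => by rw [add_mul, pow_add]; exact Nat.mul_le_mul (hc x) (hd x)⟩

theorem ExpBd.add (hh : ExpBd bs ex h) (hh' : ExpBd bs ex h') :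
    ExpBd bs ex fun x => h x + h' x := by
  obtain ⟨c, hc⟩ := hh
  obtain ⟨d, hd⟩ := hh'
  refine ⟨c + d + 1, fun x => ?_⟩
  have h3 : (bs x + 2) ^ (c * (ex x + 1)) ≤ (bs x + 2) ^ ((c + d) * (ex x + 1)) :=
    Nat.pow_le_pow_right (by omega) (by nlinarith)
  have h4 : (bs x + 2) ^ (d * (ex x + 1)) ≤ (bs x + 2) ^ ((c + d) * (ex x + 1)) :=
    Nat.pow_le_pow_right (by omega) (by nlinarith)
  have h5 : 2 ≤ (bs x + 2) ^ (ex x + 1) :=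
    (show 2 ≤ (bs x + 2) ^ 1 by rw [pow_one]; omega).trans (Nat.pow_le_pow_right (by omega) (by omega))
  have h6 := hc x
  have h7 := hd x
  rw [add_mul (c + d), one_mul, pow_add]
  simp only
  nlinarith

theorem ExpBd.pow (hh : ExpBd bs ex h) (n : ℕ) : ExpBd bs ex fun x => h x ^ n := by
  obtain ⟨c, hc⟩ := hh
  refine ⟨c * n, fun x => (Nat.pow_le_pow_left (hc x) n).trans_eq ?_⟩
  rw [← pow_mul]
  ring_nf

end ExpBd

theorem exists_letter_bound (α : Type*) [TreeEnc α] [Fintype α] : ∃ K, ∀ a : α, sz a ≤ K := by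
  obtain ⟨K, hK⟩ := (Set.finite_range fun a : α => sz a).bddAbove
  exact ⟨K, fun a => hK ⟨a, rfl⟩⟩

theorem sz_word_le {K : ℕ} (hK : ∀ a : α, sz a ≤ K) (u : List α) :
    sz u ≤ (K + 1) * u.length + 1 :=
  (sz_list_le fun a _ => hK a).trans (by rw [mul_comm])

theorem ExpBd.wordRuns : ExpBd (X := RawCEFA α × List α) (fun b => sz b.1) (fun b => b.2.length)
    fun b => sz (wordRuns b.1 b.2) := by
  have h1 : ExpBd (X := RawCEFA α × List α) (fun b => sz b.1) (fun b => b.2.length)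
      fun b => sz b.1 ^ (b.2.length + 1) :=
    ⟨1, fun b => by rw [one_mul]; exact Nat.pow_le_pow_left (Nat.le_add_right _ 2) _⟩
  refine ((h1.mul ((ExpBd.const 12).mul
    ((ExpBd.exp.add (.const 1)).mul (.base)))).add (.const 1)).mono ?_
  rintro ⟨A, u⟩
  have h2 : ∀ p ∈ CostEnriched.wordRuns A u, sz p ≤ 11 * ((u.length + 1) * sz A) := by
    intro p hp
    obtain ⟨h3, h4, h5⟩ := wordRuns_elem_le A u p hp
    have h6 := sz_vec_le p.2.2
    have h7 : sz A ≤ (u.length + 1) * sz A := Nat.le_mul_of_pos_left _ (by omega)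
    have h8 := one_le_sz A
    rw [sz_pair p, sz_pair p.2]
    omega
  refine (sz_list_le h2).trans (Nat.add_le_add_right (Nat.mul_le_mul (wordRuns_length_le A u) ?_) 1)
  have : 1 ≤ (u.length + 1) * sz A := Nat.mul_pos (by omega) (one_le_sz A)
  simp only
  omega

theorem Poly.extendRuns : Poly fun b : RawCEFA α × α × List α × List (ℕ × ℕ × List ℤ) =>
    extendRuns b.1 b.2.1 b.2.2.2 := by
  refine Poly.flatMap (Poly.cond (by fun_prop) (Poly.flatMap ?_ (by fun_prop)) (by fun_prop))
    (by fun_prop)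
  fun_prop

theorem Comp.wordRuns : ∃ t, ExpBd (fun b => sz b.1) (fun b => b.2.length) t ∧
    Comp (fun b : RawCEFA α × List α => wordRuns b.1 b.2) t := by
  obtain ⟨⟨tz, ⟨cz, htz⟩, hz⟩, -⟩ :
      Poly (fun A : RawCEFA α => A.1.map fun q => (q, q, A.2.1.map fun _ => (0 : ℤ))) :=
    Poly.map (Poly.pair (by fun_prop) (Poly.pair (by fun_prop)
      (Poly.map (f := fun _ _ => (0 : ℤ)) (by fun_prop) (by fun_prop)))) (by fun_prop)
  obtain ⟨⟨ts, ⟨cs, hts⟩, hs⟩, -⟩ := Poly.extendRuns (α := α)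
  obtain ⟨K, hK⟩ := exists_letter_bound α
  -- the cost of one step, in terms of the whole remaining word
  obtain ⟨c, hc⟩ : ExpBd (X := RawCEFA α × List α) (fun b => sz b.1) (fun b => b.2.length)
      fun b => (sz b.1 + sz b.2 + sz (CostEnriched.wordRuns b.1 b.2.tail) + 4) ^ (cz + cs) := by
    have h1 : ExpBd (X := RawCEFA α × List α) (fun b => sz b.1) (fun b => b.2.length)
        fun b => sz b.2 :=
      (((ExpBd.const (K + 1)).mul .exp).add (.const 1)).mono fun b => sz_word_le hK b.2
    have h2 : ExpBd (X := RawCEFA α × List α) (fun b => sz b.1) (fun b => b.2.length)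
        fun b => sz (CostEnriched.wordRuns b.1 b.2.tail) := by
      obtain ⟨c, hc⟩ := ExpBd.wordRuns (α := α)
      refine ⟨c, fun b => (hc (b.1, b.2.tail)).trans (Nat.pow_le_pow_right (by omega) ?_)⟩
      exact Nat.mul_le_mul_left _ (by simp)
    exact (((ExpBd.base.add h1).add h2).add (.const 4)).pow _
  refine ⟨fun b => (sz b.1 + 2) ^ ((c + 2) * (b.2.length + 1)), ⟨c + 2, fun b => le_rfl⟩,
    Comp.listRec hz hs (fun _ => rfl) (fun _ _ _ => rfl) ?_ ?_⟩
  · intro A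
    have h1 := hc (A, [])
    have h2 : tz A ≤ (sz A + sz ([] : List α) +
        sz (CostEnriched.wordRuns A ([] : List α).tail) + 4) ^ (cz + cs) :=
      (htz A).trans ((Nat.pow_le_pow_left (by omega) _).trans
        (Nat.pow_le_pow_right (by omega) (by omega)))
    exact h2.trans (h1.trans (Nat.pow_le_pow_right (by omega) (by simp)))
  · intro A a u
    have h1 := hc (A, a :: u)
    have h2 : ts (A, a, u, CostEnriched.wordRuns A u) ≤ (sz A + sz (a :: u) +
        sz (CostEnriched.wordRuns A (a :: u).tail) + 4) ^ (cz + cs) := by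
      refine (hts _).trans ((Nat.pow_le_pow_left ?_ _).trans
        (Nat.pow_le_pow_right (by omega) (by omega)))
      simp only [sz_pair (A, _), sz_pair (a, _), sz_pair (u, _), sz_cons, List.tail_cons]
      omega
    have h3 := h2.trans h1
    simp only [List.length_cons] at h3 ⊢
    set B := sz A + 2
    have hB : 3 ≤ B := by have := one_le_sz A; omega
    -- three summands, each at most a third of the bound
    have h4 : B ^ (c * (u.length + 1 + 1)) ≤ B ^ ((c + 2) * (u.length + 1) + (c + 1)) :=
      Nat.pow_le_pow_right (by omega) (by nlinarith)
    have h5 : B ^ ((c + 2) * (u.length + 1)) ≤ B ^ ((c + 2) * (u.length + 1) + (c + 1)) :=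
      Nat.pow_le_pow_right (by omega) (by omega)
    have h6 : 1 ≤ B ^ ((c + 2) * (u.length + 1) + (c + 1)) := Nat.one_le_pow _ _ (by omega)
    have h7 : (c + 2) * (u.length + 1 + 1) = (c + 2) * (u.length + 1) + (c + 1) + 1 := by ring
    rw [h7, pow_succ]
    nlinarith

end

/-! ### The product of a transducer and an automaton -/

section
variable {α : Type*} [TreeEnc α] [InjEnc α] [Fintype α] [DecidableEq α] {k : ℕ}
variable {σ : Type*} [TreeEnc σ] [InjEnc σ] [DecidableEq σ]

/-- Transducers as data, with states of an arbitrary type: states, transitions, initial and final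
states. -/
abbrev RawNFT (σ α : Type*) : Type _ :=
  List σ × List (σ × α × σ × List α × Unit) × List σ × List σ × Unit

/-- There is a run from one state to another on an input with an output. -/
inductive RawNFT.Run (T : RawNFT σ α) : σ → List α → List α → σ → Prop where
  | nil (p : σ) : RawNFT.Run T p [] [] p
  | cons {p p' p'' : σ} {a : α} {w u v : List α} :
      (p, a, p', u, ()) ∈ T.2.1 → RawNFT.Run T p' w v p'' → RawNFT.Run T p (a :: w) (u ++ v) p''

/-- The transduction defined by `T`. -/
def RawNFT.Rel (T : RawNFT σ α) (w u : List α) : Prop :=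
  ∃ p ∈ T.2.2.1, ∃ p' ∈ T.2.2.2.1, T.Run p w u p'

/-- All states that occur in transitions or are initial are listed. -/
structure RawNFT.WF (T : RawNFT σ α) : Prop where
  trans : ∀ τ ∈ T.2.1, τ.1 ∈ T.1 ∧ τ.2.2.1 ∈ T.1
  init : ∀ p ∈ T.2.2.1, p ∈ T.1

/-- All pairs of elements of two lists. -/
def pairs {β γ : Type*} (l : List β) (l' : List γ) : List (β × γ) :=
  l.flatMap fun x => l'.map fun y => (x, y)

theorem mem_pairs {β γ : Type*} {l : List β} {l' : List γ} {p : β × γ} :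
    p ∈ pairs l l' ↔ p.1 ∈ l ∧ p.2 ∈ l' := by
  obtain ⟨x, y⟩ := p
  simp [pairs]

/-- The automaton with states `0, …, N` given by data. -/
def CEFA.ofRaw (k N : ℕ) (tr : List (ℕ × α × ℕ × List ℤ × Unit)) (I F : List ℕ) : CEFA α k where
  n := N + 1
  trans := tr.map fun τ => (Fin.ofNat (N + 1) τ.1, τ.2.1, Fin.ofNat (N + 1) τ.2.2.1,
    fun i => τ.2.2.2.1.getD i 0)
  init := I.map (Fin.ofNat (N + 1))
  final := F.map (Fin.ofNat (N + 1))

theorem CEFA.raw_ofRaw {N : ℕ} {tr : List (ℕ × α × ℕ × List ℤ × Unit)} {I F : List ℕ}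
    (htr : ∀ τ ∈ tr, τ.1 ≤ N ∧ τ.2.2.1 ≤ N ∧ τ.2.2.2.1.length = k) (hI : ∀ q ∈ I, q ≤ N)
    (hF : ∀ q ∈ F, q ≤ N) : (CEFA.ofRaw k N tr I F).raw =
      (List.range (N + 1), List.replicate k (), tr, I, F, ()) := by
  have h : ∀ q ≤ N, (Fin.ofNat (N + 1) q).val = q := fun q hq =>
    Nat.mod_eq_of_lt (Nat.lt_succ_of_le hq)
  have hS : ∀ S : List ℕ, (∀ q ∈ S, q ≤ N) →
      (S.map (Fin.ofNat (N + 1))).map Fin.val = S := by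
    intro S hS
    rw [List.map_map]
    exact (List.map_congr_left fun q hq => h q (hS q hq)).trans (List.map_id S)
  simp only [CEFA.raw, CEFA.ofRaw, hS I hI, hS F hF, Prod.mk.injEq, true_and, and_true, List.map_map]
  refine (List.map_congr_left fun τ hτ => ?_).trans (List.map_id tr)
  obtain ⟨q, a, q', η, _⟩ := τ
  obtain ⟨h1, h2, h3⟩ := htr _ hτ
  simp only at h1 h2 h3
  have h4 : (List.ofFn fun i : Fin k => η.getD i 0) = η := by
    apply List.ext_getElem
    · simp [h3]
    · intro i hi hi'; simp [hi']
  simp only [Function.comp_apply, h _ h1, h _ h2, h4, id]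

/-- The transitions of the product with state names, `r` listing the transitions of the transducer
with the runs of the automaton on their outputs. -/
def productTrans (P : List (σ × ℕ))
    (r : List ((σ × α × σ × List α × Unit) × List (ℕ × ℕ × List ℤ))) :
    List (ℕ × α × ℕ × List ℤ × Unit) :=
  r.flatMap fun x => x.2.map fun y =>
    (P.idxOf (x.1.1, y.1), x.1.2.1, P.idxOf (x.1.2.2.1, y.2.1), y.2.2, ())

/-- The transitions of a transducer with the runs of the automaton on their outputs. -/
def outputRuns (T : RawNFT σ α) (A : RawCEFA α) :
    List ((σ × α × σ × List α × Unit) × List (ℕ × ℕ × List ℤ)) :=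
  T.2.1.map fun τ => (τ, wordRuns A τ.2.2.2.1)

/-- The product of a transducer and an automaton. A pair of states is named by its position in the
list of all pairs; the last name, one more than needed, is that of the pairs that are not listed. -/
def product (T : RawNFT σ α) (A : CEFA α k) : CEFA α k :=
  CEFA.ofRaw k (pairs T.1 A.raw.1).length
    (productTrans (pairs T.1 A.raw.1) (outputRuns T A.raw))
    ((pairs T.2.2.1 A.raw.2.2.2.1).map (pairs T.1 A.raw.1).idxOf)
    ((pairs T.2.2.2.1 A.raw.2.2.2.2.1).map (pairs T.1 A.raw.1).idxOf)

/-- The name of a pair of states in the product. -/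
def productState (T : RawNFT σ α) (A : CEFA α k) (p : σ) (q : Fin A.n) :
    Fin (product T A).n :=
  Fin.ofNat ((pairs T.1 A.raw.1).length + 1) ((pairs T.1 A.raw.1).idxOf (p, q.val))

/-- Listed states have names of their own. -/
theorem productState_inj {T : RawNFT σ α} {A : CEFA α k} {p p' : σ} {q q' : Fin A.n}
    (hp : p ∈ T.1) (h : productState T A p q = productState T A p' q') : p = p' ∧ q = q' := by
  have h' := congrArg Fin.val h
  simp only [productState, Fin.ofNat] at h'
  have hle : ∀ x, (pairs T.1 A.raw.1).idxOf x < (pairs T.1 A.raw.1).length + 1 := fun x =>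
    Nat.lt_succ_of_le List.idxOf_le_length
  rw [Nat.mod_eq_of_lt (hle _), Nat.mod_eq_of_lt (hle _)] at h'
  have hmem : (p, q.val) ∈ pairs T.1 A.raw.1 := mem_pairs.2 ⟨hp, by simp [CEFA.raw]⟩
  have := (List.idxOf_inj hmem).1 h'
  simp only [Prod.mk.injEq] at this
  exact ⟨this.1, Fin.ext this.2⟩

theorem mem_product_trans {T : RawNFT σ α} {A : CEFA α k} {s s' : Fin (product T A).n} {a : α}
    {η : Fin k → ℤ} : (s, a, s', η) ∈ (product T A).trans ↔ ∃ p p' u q q',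
      (p, a, p', u, ()) ∈ T.2.1 ∧ A.Run q u η q' ∧ s = productState T A p q ∧
        s' = productState T A p' q' := by
  have hgetD : ∀ v : Fin k → ℤ, (fun i : Fin k => (List.ofFn v).getD i 0) = v := by
    intro v; funext i; simp
  have : (s, a, s', η) ∈ (product T A).trans ↔ ∃ τ ∈ productTrans (pairs T.1 A.raw.1)
      (outputRuns T A.raw), (Fin.ofNat ((pairs T.1 A.raw.1).length + 1) τ.1, τ.2.1,
      Fin.ofNat ((pairs T.1 A.raw.1).length + 1) τ.2.2.1,
      fun i : Fin k => τ.2.2.2.1.getD i 0) = (s, a, s', η) := List.mem_map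
  rw [this]
  simp only [productTrans, outputRuns, List.mem_flatMap, List.mem_map]
  constructor
  · rintro ⟨_, ⟨_, ⟨⟨p, b, p', u, _⟩, hτ, rfl⟩, y, hy, rfl⟩, h⟩
    obtain ⟨q, q', v, hr, rfl⟩ := mem_wordRuns.1 hy
    simp only [hgetD] at h
    obtain ⟨rfl, rfl, rfl, rfl⟩ := h
    exact ⟨p, p', u, q, q', hτ, hr, rfl, rfl⟩
  · rintro ⟨p, p', u, q, q', hτ, hr, rfl, rfl⟩
    refine ⟨_, ⟨_, ⟨_, hτ, rfl⟩, _, mem_wordRuns.2 ⟨q, q', η, hr, rfl⟩, rfl⟩, ?_⟩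
    simp only [hgetD]
    rfl

theorem RawNFT.Run.product {T : RawNFT σ α} {A : CEFA α k} {p p' : σ} {w u : List α}
    (h : T.Run p w u p') {q q' : Fin A.n} {v : Fin k → ℤ} (hA : A.Run q u v q') :
    (product T A).Run (productState T A p q) w v (productState T A p' q') := by
  induction h generalizing q v with
  | nil p => cases hA; exact .nil _
  | cons ht _ ih =>
    obtain ⟨r, v₁, v₂, h₁, h₂, rfl⟩ := hA.split
    exact .cons (mem_product_trans.2 ⟨_, _, _, _, _, ht, h₁, rfl, rfl⟩) (ih h₂)

theorem CEFA.Run.of_product {T : RawNFT σ α} (hT : T.WF) {A : CEFA α k}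
    {s s' : Fin (product T A).n} {w : List α} {v : Fin k → ℤ} (h : (product T A).Run s w v s') :
    ∀ p q, p ∈ T.1 → s = productState T A p q → ∃ p' q' u, p' ∈ T.1 ∧
      s' = productState T A p' q' ∧ T.Run p w u p' ∧ A.Run q u v q' := by
  induction h with
  | nil s => exact fun p q hp hs => ⟨p, q, [], hp, hs, .nil p, .nil q⟩
  | cons ht _ ih =>
    intro p q hp hs
    obtain ⟨p₁, p', u, q₁, q', hτ, hr, hs₁, hs'⟩ := mem_product_trans.1 ht
    obtain ⟨rfl, rfl⟩ := productState_inj hp (hs.symm.trans hs₁)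
    obtain ⟨p'', q'', u', hp'', hs'', h1, h2⟩ := ih p' q' (hT.trans _ hτ).2 hs'
    exact ⟨p'', q'', u ++ u', hp'', hs'', .cons hτ h1, hr.append h2⟩

/-- The product accepts the pre-image of the language of `A` under the transduction. -/
theorem mem_lang_product {T : RawNFT σ α} (hT : T.WF) (A : CEFA α k) (w : List α)
    (d : Fin k → ℤ) : (w, d) ∈ (product T A).lang ↔ ∃ u, T.Rel w u ∧ (u, d) ∈ A.lang := by
  have hinit : ∀ s, s ∈ (product T A).init ↔ ∃ p ∈ T.2.2.1, ∃ q ∈ A.init,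
      s = productState T A p q := by
    intro s
    have : s ∈ (product T A).init ↔ ∃ m ∈ (pairs T.2.2.1 A.raw.2.2.2.1).map
      (pairs T.1 A.raw.1).idxOf, Fin.ofNat ((pairs T.1 A.raw.1).length + 1) m = s := List.mem_map
    rw [this]
    simp only [List.mem_map, mem_pairs]
    constructor
    · rintro ⟨_, ⟨⟨p, _⟩, ⟨hp, hq⟩, rfl⟩, rfl⟩
      obtain ⟨q, hq', rfl⟩ := List.mem_map.1 hq
      exact ⟨p, hp, q, hq', rfl⟩
    · rintro ⟨p, hp, q, hq, rfl⟩
      exact ⟨_, ⟨(p, q.val), ⟨hp, List.mem_map_of_mem hq⟩, rfl⟩, rfl⟩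
  have hfinal : ∀ s, s ∈ (product T A).final ↔ ∃ p ∈ T.2.2.2.1, ∃ q ∈ A.final,
      s = productState T A p q := by
    intro s
    have : s ∈ (product T A).final ↔ ∃ m ∈ (pairs T.2.2.2.1 A.raw.2.2.2.2.1).map
      (pairs T.1 A.raw.1).idxOf, Fin.ofNat ((pairs T.1 A.raw.1).length + 1) m = s := List.mem_map
    rw [this]
    simp only [List.mem_map, mem_pairs]
    constructor
    · rintro ⟨_, ⟨⟨p, _⟩, ⟨hp, hq⟩, rfl⟩, rfl⟩
      obtain ⟨q, hq', rfl⟩ := List.mem_map.1 hq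
      exact ⟨p, hp, q, hq', rfl⟩
    · rintro ⟨p, hp, q, hq, rfl⟩
      exact ⟨_, ⟨(p, q.val), ⟨hp, List.mem_map_of_mem hq⟩, rfl⟩, rfl⟩
  constructor
  · rintro ⟨s, hs, s', hs', h⟩
    obtain ⟨p, hp, q, hq, rfl⟩ := (hinit s).1 hs
    obtain ⟨p', hp', q', hq', rfl⟩ := (hfinal s').1 hs'
    obtain ⟨p'', q'', u, hp'', hs'', h1, h2⟩ := h.of_product hT p q (hT.init p hp) rfl
    obtain ⟨rfl, rfl⟩ := productState_inj hp'' hs''.symm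
    exact ⟨u, ⟨p, hp, p'', hp', h1⟩, q, hq, q'', hq', h2⟩
  · rintro ⟨u, ⟨p, hp, p', hp', h1⟩, q, hq, q', hq', h2⟩
    exact ⟨_, (hinit _).2 ⟨p, hp, q, hq, rfl⟩, _, (hfinal _).2 ⟨p', hp', q', hq', rfl⟩,
      h1.product h2⟩

/-! ### The program for the product -/

/-- The numbers up to the length of a list. -/
theorem Poly.range_length : Poly fun l : List σ => List.range (l.length + 1) := by
  have h : Poly fun p : Unit × List σ => List.range (p.2.length + 1) := by
    refine Poly.listRec (z := fun _ => [0]) (s := fun b => 0 :: b.2.2.2.map fun n => n + 1)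
      (.const _) (Poly.cons (by fun_prop) (Poly.map (by fun_prop) (by fun_prop))) (fun _ => rfl)
      (fun _ x xs => by simp only [List.length_cons]; exact List.range_succ_eq_map) ?_
    refine (((PolyBd.size.add (.const 1)).mul ((PolyBd.const 4).mul (PolyBd.size.add
      (.const 2)))).add (.const 1)).mono ?_
    rintro ⟨_, l⟩
    have h1 := length_lt_sz l
    change sz (List.range (l.length + 1)) ≤ _
    refine (sz_list_le (M := 4 * l.length + 1) fun n hn => ?_).trans ?_
    · have := sz_nat_le_linear n
      have := List.mem_range.1 hn
      omega
    · rw [List.length_range, sz_pair]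
      refine Nat.add_le_add_right (Nat.mul_le_mul ?_ ?_) 1 <;> simp only [sz_unit] <;> omega
  exact h.comp (f := fun l => ((), l)) (by fun_prop)

@[fun_prop]
theorem Poly.pairs {β γ δ : Type*} [TreeEnc β] [TreeEnc γ] [TreeEnc δ] {f : δ → List β}
    {g : δ → List γ} (hf : Poly f) (hg : Poly g) : Poly fun x => pairs (f x) (g x) :=
  Poly.flatMap (Poly.map (by fun_prop) (by fun_prop)) hf

/-- The representation computed from `T`, `A` and `outputRuns T A`. -/
def productRaw (X : (RawNFT σ α × RawCEFA α) ×
    List ((σ × α × σ × List α × Unit) × List (ℕ × ℕ × List ℤ))) : RawRep α :=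
  ([[(List.range ((pairs X.1.1.1 X.1.2.1).length + 1), X.1.2.2.1,
      productTrans (pairs X.1.1.1 X.1.2.1) X.2,
      (pairs X.1.1.2.2.1 X.1.2.2.2.2.1).map (pairs X.1.1.1 X.1.2.1).idxOf,
      (pairs X.1.1.2.2.2.1 X.1.2.2.2.2.2.1).map (pairs X.1.1.1 X.1.2.1).idxOf, ())]],
    X.1.2.2.1.map fun _ => (0, [1]))

theorem Poly.productRaw : Poly (productRaw (α := α) (σ := σ)) := by
  have hidx : ∀ {β : Type _} [TreeEnc β] {f : β → σ × ℕ} {g : β → List (σ × ℕ)}, Poly f → Poly g →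
      Poly fun b => (g b).idxOf (f b) := fun hf hg => Poly.idxOf.comp (hf.pair hg)
  have h1 : Poly fun X : (RawNFT σ α × RawCEFA α) ×
      List ((σ × α × σ × List α × Unit) × List (ℕ × ℕ × List ℤ)) =>
      productTrans (CostEnriched.pairs X.1.1.1 X.1.2.1) X.2 := by
    refine Poly.flatMap (Poly.map ?_ (by fun_prop)) (by fun_prop)
    exact (hidx (by fun_prop) (by fun_prop)).pair (.pair (by fun_prop)
      ((hidx (by fun_prop) (by fun_prop)).pair (by fun_prop)))
  have h2 : ∀ {f g : (RawNFT σ α × RawCEFA α) ×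
      List ((σ × α × σ × List α × Unit) × List (ℕ × ℕ × List ℤ)) → List (σ × ℕ)},
      Poly f → Poly g → Poly fun X => (f X).map (g X).idxOf := fun hf hg =>
    Poly.map (hidx .snd (hg.comp .fst)) hf
  have h3 : Poly fun X : (RawNFT σ α × RawCEFA α) ×
      List ((σ × α × σ × List α × Unit) × List (ℕ × ℕ × List ℤ)) =>
      List.range ((CostEnriched.pairs X.1.1.1 X.1.2.1).length + 1) :=
    Poly.range_length.comp (by fun_prop)
  have h4 := h2 (f := fun X => CostEnriched.pairs X.1.1.2.2.1 X.1.2.2.2.2.1)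
    (g := fun X => CostEnriched.pairs X.1.1.1 X.1.2.1) (by fun_prop) (by fun_prop)
  have h5 := h2 (f := fun X => CostEnriched.pairs X.1.1.2.2.2.1 X.1.2.2.2.2.2.1)
    (g := fun X => CostEnriched.pairs X.1.1.1 X.1.2.1) (by fun_prop) (by fun_prop)
  have h6 : Poly fun X : (RawNFT σ α × RawCEFA α) ×
      List ((σ × α × σ × List α × Unit) × List (ℕ × ℕ × List ℤ)) =>
      X.1.2.2.1.map fun _ => ((0 : ℤ), [(1 : ℤ)]) :=
    Poly.map (f := fun _ _ => ((0 : ℤ), [(1 : ℤ)])) (.const _) (by fun_prop)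
  exact (Poly.cons (.cons (h3.pair (.pair (by fun_prop) (h1.pair (h4.pair (h5.pair (.const ()))))))
    (.const [])) (.const [])).pair h6

theorem productRaw_eq (T : RawNFT σ α) (A : CEFA α k) :
    productRaw ((T, A.raw), outputRuns T A.raw) = (singleRep (product T A)).raw := by
  rw [singleRep_raw, product, CEFA.raw_ofRaw]
  · simp [productRaw, CEFA.raw]
  · intro τ hτ
    simp only [productTrans, outputRuns, List.mem_flatMap, List.mem_map] at hτ
    obtain ⟨_, ⟨τ', hτ', rfl⟩, y, hy, rfl⟩ := hτ
    obtain ⟨q, q', v, hr, rfl⟩ := mem_wordRuns.1 hy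
    exact ⟨List.idxOf_le_length, List.idxOf_le_length, by simp⟩
  · intro q hq
    obtain ⟨x, -, rfl⟩ := List.mem_map.1 hq
    exact List.idxOf_le_length
  · intro q hq
    obtain ⟨x, -, rfl⟩ := List.mem_map.1 hq
    exact List.idxOf_le_length

end

/-! ### Functional transducers -/

section
variable {σ α : Type*}

/-- The length of the longest output of a transition. -/
def RawNFT.maxOut (T : RawNFT σ α) : ℕ := (T.2.1.map fun τ => τ.2.2.2.1.length).foldr max 0

theorem RawNFT.le_maxOut {T : RawNFT σ α} {τ : σ × α × σ × List α × Unit} (h : τ ∈ T.2.1) :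
    τ.2.2.2.1.length ≤ T.maxOut :=
  List.le_max_of_le' 0 (List.mem_map_of_mem h) le_rfl

theorem RawNFT.maxOut_le {T : RawNFT σ α} {M : ℕ} (h : ∀ τ ∈ T.2.1, τ.2.2.2.1.length ≤ M) :
    T.maxOut ≤ M :=
  List.max_le_of_forall_le _ _ (by
    simp only [List.mem_map]
    rintro _ ⟨τ, hτ, rfl⟩
    exact h τ hτ)

end

section
variable {α : Type*} [TreeEnc α] [InjEnc α] [Fintype α] [DecidableEq α] {k : ℕ}
variable {σ : Type*} [TreeEnc σ] [InjEnc σ] [DecidableEq σ]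

/-- The quantity in which the product construction is polynomial. -/
def productBase (X : RawNFT σ α × RawCEFA α) : ℕ := sz X.1 * (sz X.2 + 2) ^ (X.1.maxOut + 1)

theorem le_productBase (X : RawNFT σ α × RawCEFA α) :
    sz X.1 ≤ productBase X ∧ (sz X.2 + 2) ^ (X.1.maxOut + 1) ≤ productBase X ∧
      sz X.2 + 2 ≤ productBase X := by
  have h1 := one_le_sz X.1
  have h2 : sz X.2 + 2 ≤ (sz X.2 + 2) ^ (X.1.maxOut + 1) := Nat.le_self_pow (by omega) _
  have h3 : (sz X.2 + 2) ^ (X.1.maxOut + 1) ≤ productBase X := Nat.le_mul_of_pos_left _ h1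
  exact ⟨Nat.le_mul_of_pos_right _ (by positivity), h3, h2.trans h3⟩

/-- Polynomial bounds in a given quantity. -/
abbrev PolyIn {X : Type*} (base h : X → ℕ) : Prop := ExpBd base (fun _ => 0) h

theorem PolyBd.comp_polyIn {β γ : Type*} [TreeEnc γ] {base : β → ℕ} {h : γ → ℕ}
    (hh : PolyBd h) {f : β → γ} (hf : PolyIn base fun b => sz (f b)) :
    PolyIn base fun b => h (f b) := by
  obtain ⟨c, hc⟩ := hh
  exact ((hf.add (.const 1)).pow c).mono fun b => hc (f b)

theorem Comp.outputRuns : (∃ t, PolyIn productBase t ∧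
      Comp (fun X : RawNFT σ α × RawCEFA α => outputRuns X.1 X.2) t) ∧
    PolyIn productBase fun X : RawNFT σ α × RawCEFA α => sz (outputRuns X.1 X.2) := by
  have hT : PolyIn productBase fun X : RawNFT σ α × RawCEFA α => sz X.1 :=
    ExpBd.base.mono fun X => (le_productBase X).1
  have key : ∀ {t : RawCEFA α × List α → ℕ}, ExpBd (fun b => sz b.1) (fun b => b.2.length) t →
      ∃ h : RawNFT σ α × RawCEFA α → ℕ, PolyIn productBase h ∧
        ∀ X : RawNFT σ α × RawCEFA α, ∀ τ ∈ X.1.2.1, t (X.2, τ.2.2.2.1) ≤ h X := by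
    rintro t ⟨c, hc⟩
    refine ⟨_, ExpBd.base.pow c, fun X τ hτ => (hc _).trans ?_⟩
    calc (sz X.2 + 2) ^ (c * (τ.2.2.2.1.length + 1))
        ≤ (sz X.2 + 2) ^ ((X.1.maxOut + 1) * c) := Nat.pow_le_pow_right (by omega) (by
          rw [mul_comm]
          exact Nat.mul_le_mul_right _ (Nat.add_le_add_right (RawNFT.le_maxOut hτ) 1))
      _ ≤ productBase X ^ c := by
          rw [pow_mul]; exact Nat.pow_le_pow_left (le_productBase X).2.1 c
  obtain ⟨t, ht, hw⟩ := Comp.wordRuns (α := α)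
  obtain ⟨h, hh, hle⟩ := key ht
  obtain ⟨h', hh', hle'⟩ := key (ExpBd.wordRuns (α := α))
  have hlen : ∀ X : RawNFT σ α × RawCEFA α, X.1.2.1.length ≤ sz X.1 := fun X => by
    have := length_lt_sz X.1.2.1
    simp only [sz_pair X.1, sz_pair X.1.2]
    omega
  constructor
  · refine ⟨_, hT.mul (hh.add (.const 1)), ((Comp.map (f := fun X τ => (τ, CostEnriched.wordRuns
      X.2 τ.2.2.2.1)) (t := fun p => t (p.1.2, p.2.2.2.2.1)) ?_ (s := fun _ => 0)
      (l := fun X : RawNFT σ α × RawCEFA α => X.1.2.1)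
      (show ConstTime _ by fun_prop))).mono 1 fun X => ?_⟩
    · exact Comp.pair_const (by fun_prop) (hw.comp_const
        (f := fun p : (RawNFT σ α × RawCEFA α) × (σ × α × σ × List α × Unit) =>
          (p.1.2, p.2.2.2.2.1)) (by fun_prop))
    · have := List.sum_le_card_nsmul (X.1.2.1.map fun τ => t (X.2, τ.2.2.2.1) + 1) (h X + 1) (by
        simp only [List.mem_map]
        rintro _ ⟨τ, hτ, rfl⟩
        exact Nat.add_le_add_right (hle X τ hτ) 1)
      simp only [List.length_map, smul_eq_mul] at this
      have h2 := Nat.mul_le_mul_right (h X + 1) (hlen X)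
      simp only
      omega
  · refine ((hT.mul ((hT.add hh').add (.const 2))).add (.const 1)).mono fun X => ?_
    refine (sz_list_le (M := sz X.1 + h' X + 1) ?_).trans ?_
    · simp only [CostEnriched.outputRuns, List.mem_map]
      rintro _ ⟨τ, hτ, rfl⟩
      have h1 := sz_lt_of_mem hτ
      have h2 := hle' X τ hτ
      have h3 : sz X.1.2.1 ≤ sz X.1 := by simp only [sz_pair X.1, sz_pair X.1.2]; omega
      rw [sz_pair]
      simp only at h2 ⊢
      omega
    · simp only [CostEnriched.outputRuns, List.length_map]
      exact Nat.add_le_add_right (Nat.mul_le_mul_right _ (hlen X)) 1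

/-- The representation of the pre-image under a transducer, as a function of the data. -/
def productRep (X : RawNFT σ α × RawCEFA α) : RawRep α := productRaw (X, outputRuns X.1 X.2)

theorem Comp.productRep : (∃ t, PolyIn productBase t ∧ Comp (productRep (α := α) (σ := σ)) t) ∧
    PolyIn productBase fun X : RawNFT σ α × RawCEFA α => sz (productRep X) := by
  obtain ⟨⟨t, ht, h⟩, h'⟩ := Comp.outputRuns (α := α) (σ := σ)
  obtain ⟨⟨s, hs, hp⟩, hp'⟩ := Poly.productRaw (α := α) (σ := σ)
  have hX : PolyIn productBase fun X : RawNFT σ α × RawCEFA α =>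
      sz (X, CostEnriched.outputRuns X.1 X.2) := by
    refine (((ExpBd.base.add ExpBd.base).add h').add (.const 2)).mono fun X => ?_
    obtain ⟨h1, -, h3⟩ := le_productBase X
    rw [sz_pair, sz_pair]
    simp only
    omega
  exact ⟨⟨_, ht.add (hs.comp_polyIn hX), (hp.comp (Comp.pair_const (.id) h)).mono 1
    fun b => by omega⟩, hp'.comp_polyIn hX⟩

/-! ### The size of an automaton and the size of its encoding -/

theorem bits_le_sz (η : Fin k → ℤ) : bits η ≤ sz (List.ofFn η) := by
  refine le_trans ?_ (vecWeight_le_sz _)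
  simp only [bits, vecWeight, List.map_ofFn, List.sum_ofFn, Function.comp_apply]
  exact Finset.sum_le_sum fun i _ => (Nat.clog_le_of_le_pow (Nat.lt_size_self _).le).trans
    (Nat.le_succ _)

theorem sz_ofFn_le (η : Fin k → ℤ) : sz (List.ofFn η) ≤ 6 * (bits η + 2 * k) + 1 := by
  refine (sz_vec_le _).trans (Nat.add_le_add_right (Nat.mul_le_mul_left 6 ?_) 1)
  simp only [bits, vecWeight, List.map_ofFn, List.sum_ofFn, Function.comp_apply]
  have : (2 * k : ℕ) = ∑ _i : Fin k, 2 := by simp [mul_comm]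
  rw [this, ← Finset.sum_add_distrib]
  refine Finset.sum_le_sum fun i _ => ?_
  have h : (η i).natAbs.size ≤ Nat.clog 2 (η i).natAbs + 1 := by
    rw [Nat.size_le, pow_succ]
    have := Nat.le_pow_clog (b := 2) (by norm_num) (η i).natAbs
    have : 0 < 2 ^ Nat.clog 2 (η i).natAbs := by positivity
    omega
  omega

theorem CEFA.fullSize_le_sz (A : CEFA α k) : A.fullSize ≤ 10 * sz A.raw := by
  have h1 : A.n ≤ sz (List.range A.n) := by
    have := length_lt_sz (List.range A.n); rw [List.length_range] at this; omega
  have h2 : k ≤ sz (List.replicate k ()) := by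
    have := length_lt_sz (List.replicate k ()); rw [List.length_replicate] at this; omega
  have h3 : A.init.length ≤ sz (A.init.map Fin.val) := by
    have := length_lt_sz (A.init.map Fin.val); rw [List.length_map] at this; omega
  have h4 : A.final.length ≤ sz (A.final.map Fin.val) := by
    have := length_lt_sz (A.final.map Fin.val); rw [List.length_map] at this; omega
  have h5 : A.size ≤ sz (A.trans.map fun τ =>
      (τ.1.val, τ.2.1, τ.2.2.1.val, List.ofFn τ.2.2.2, ())) := by
    rw [sz_list_eq, CEFA.size, List.map_map]
    refine (List.sum_le_sum fun τ _ => ?_).trans (Nat.le_succ _)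
    have := bits_le_sz τ.2.2.2
    simp only [Function.comp_apply, sz_pair, sz_unit]
    omega
  simp only [CEFA.fullSize, CEFA.raw, sz_pair, sz_unit]
  omega

theorem sz_states_le {n : ℕ} (S : List (Fin n)) :
    sz (S.map Fin.val) ≤ S.length * (4 * n + 2) + 1 := by
  refine (sz_list_le (M := 4 * n + 1) ?_).trans_eq (by simp)
  simp only [List.mem_map]
  rintro _ ⟨q, -, rfl⟩
  have := sz_nat_le_linear q.val
  omega

theorem CEFA.sz_raw_le {K : ℕ} (hK : ∀ a : α, sz a ≤ K) (A : CEFA α k) :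
    sz A.raw ≤ (K + 100) * A.fullSize ^ 2 := by
  have h0 := A.lengths_le
  have h1 := sz_states_le (List.finRange A.n)
  rw [List.map_coe_finRange_eq_range, List.length_finRange] at h1
  have h2 : sz (List.replicate k ()) ≤ k * 2 + 1 := by
    refine (sz_list_le (M := 1) fun x _ => le_rfl).trans_eq (by simp)
  have h3 := sz_states_le A.init
  have h4 := sz_states_le A.final
  have h5 : sz (A.trans.map fun τ => (τ.1.val, τ.2.1, τ.2.2.1.val, List.ofFn τ.2.2.2, ())) ≤
      A.trans.length * (K + 40 * A.fullSize) + 1 := by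
    have hF : 1 ≤ A.fullSize := by omega
    refine (sz_list_le (M := K + 40 * A.fullSize - 1) ?_).trans_eq ?_
    · simp only [List.mem_map]
      rintro _ ⟨τ, hτ, rfl⟩
      have h6 := sz_nat_le_linear τ.1.val
      have h7 := sz_nat_le_linear τ.2.2.1.val
      have h8 := hK τ.2.1
      have h9 := sz_ofFn_le τ.2.2.2
      have h10 : bits τ.2.2.2 + 3 ≤ A.size :=
        List.single_le_sum (by simp) _ (List.mem_map_of_mem (f := fun τ : Fin A.n × α × Fin A.n ×
          (Fin k → ℤ) => bits τ.2.2.2 + 3) hτ)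
      have h11 : A.size + A.n + A.init.length + A.final.length + k + 1 = A.fullSize := rfl
      simp only [sz_pair, sz_unit]
      omega
    · rw [List.length_map, Nat.sub_add_cancel (by omega)]
  have e : sz A.raw = sz (List.range A.n) + (sz (List.replicate k ()) + (sz (A.trans.map fun τ =>
      (τ.1.val, τ.2.1, τ.2.2.1.val, List.ofFn τ.2.2.2, ())) + (sz (A.init.map Fin.val) +
      (sz (A.final.map Fin.val) + 1 + 1) + 1) + 1) + 1) + 1 := rfl
  rw [e]
  set F := A.fullSize
  have hn : A.n * (4 * A.n + 2) ≤ F * (6 * F) := Nat.mul_le_mul (by omega) (by omega)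
  have hi : A.init.length * (4 * A.n + 2) ≤ F * (6 * F) := Nat.mul_le_mul (by omega) (by omega)
  have hf : A.final.length * (4 * A.n + 2) ≤ F * (6 * F) := Nat.mul_le_mul (by omega) (by omega)
  have ht : A.trans.length * (K + 40 * F) ≤ F * (K * F + 40 * F) :=
    Nat.mul_le_mul (by omega) (Nat.add_le_add_right (Nat.le_mul_of_pos_right _ (by omega)) _)
  have hF : F ≤ F * F := Nat.le_mul_of_pos_left _ (by omega)
  have e2 : (K + 100) * F ^ 2 = F * (K * F + 40 * F) + 60 * (F * F) := by ring
  have e3 : F * (6 * F) = 6 * (F * F) := by ring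
  rw [e2]
  omega

theorem CEFA.sz_raw_add_two_le {K : ℕ} (hK : ∀ a : α, sz a ≤ K) (A : CEFA α k) :
    sz A.raw + 2 ≤ (A.fullSize + 1) ^ (K + 102) := by
  have hA := A.sz_raw_le hK
  have hA1 : 1 ≤ A.fullSize := Nat.le_add_left _ _
  rw [pow_add _ (K + 100) 2]
  refine le_trans ?_ (Nat.mul_le_mul_right _ (le_base_pow (by omega) (K + 100)))
  have e : (K + 100) * (A.fullSize + 1) ^ 2 =
      (K + 100) * A.fullSize ^ 2 + (K + 100) * (2 * A.fullSize + 1) := by ring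
  have : 100 * 1 ≤ (K + 100) * (2 * A.fullSize + 1) := Nat.mul_le_mul (by omega) (by omega)
  omega

/-- A transducer as data. -/
def NFT.raw (T : NFT α) : RawNFT ℕ α :=
  (List.range T.n, T.trans.map fun τ => (τ.1.val, τ.2.1, τ.2.2.1.val, τ.2.2.2, ()),
    T.init.map Fin.val, T.final.map Fin.val, ())

theorem NFT.enc_raw (T : NFT α) : enc T.raw = encNFT enc T := by
  simp only [encNFT, encStates_eq, List.map_coe_finRange_eq_range, NFT.raw, enc_pair, encList]
  congr 2
  simp only [enc_list, List.map_map]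
  rfl

theorem NFT.sz_raw_le {K : ℕ} (hK : ∀ a : α, sz a ≤ K) (T : NFT α) :
    sz T.raw ≤ (K + 100) * T.fullSize ^ 2 ∧ T.raw.maxOut + 1 ≤ T.fullSize := by
  have h10 : ∀ τ ∈ T.trans, τ.2.2.2.length + 3 ≤ T.size := fun τ hτ =>
    List.single_le_sum (by simp) _ (List.mem_map_of_mem (f := fun τ : Fin T.n × α × Fin T.n ×
      List α => τ.2.2.2.length + 3) hτ)
  have h0 : 3 * T.trans.length ≤ T.size := by
    have h := List.card_nsmul_le_sum (T.trans.map fun τ => τ.2.2.2.length + 3) 3 (by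
      simp only [List.mem_map]
      rintro _ ⟨τ, _, rfl⟩
      omega)
    simp only [List.length_map, smul_eq_mul] at h
    rw [NFT.size]
    omega
  have h11 : T.size + T.n + T.init.length + T.final.length + 1 = T.fullSize := rfl
  constructor
  · have h1 := sz_states_le (List.finRange T.n)
    rw [List.map_coe_finRange_eq_range, List.length_finRange] at h1
    have h3 := sz_states_le T.init
    have h4 := sz_states_le T.final
    set F := T.fullSize
    have hKF : K ≤ K * F := Nat.le_mul_of_pos_right _ (by omega)
    have h5 : sz (T.trans.map fun τ => (τ.1.val, τ.2.1, τ.2.2.1.val, τ.2.2.2, ())) ≤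
        T.trans.length * (3 * (K * F) + 40 * F) + 1 := by
      refine (sz_list_le (M := 3 * (K * F) + 40 * F - 1) ?_).trans_eq ?_
      · simp only [List.mem_map]
        rintro _ ⟨τ, hτ, rfl⟩
        have h6 := sz_nat_le_linear τ.1.val
        have h7 := sz_nat_le_linear τ.2.2.1.val
        have h8 := hK τ.2.1
        have h9 := sz_word_le hK τ.2.2.2
        have h12 := h10 τ hτ
        have h13 : (K + 1) * τ.2.2.2.length ≤ (K + 1) * F := Nat.mul_le_mul_left _ (by omega)
        rw [add_mul, add_mul, one_mul, one_mul] at h13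
        rw [add_mul, one_mul] at h9
        simp only [sz_pair, sz_unit]
        omega
      · rw [List.length_map, Nat.sub_add_cancel (by omega)]
    have e : sz T.raw = sz (List.range T.n) + (sz (T.trans.map fun τ =>
        (τ.1.val, τ.2.1, τ.2.2.1.val, τ.2.2.2, ())) + (sz (T.init.map Fin.val) +
        (sz (T.final.map Fin.val) + 1 + 1) + 1) + 1) + 1 := rfl
    rw [e]
    have hn : T.n * (4 * T.n + 2) ≤ F * (6 * F) := Nat.mul_le_mul (by omega) (by omega)
    have hi : T.init.length * (4 * T.n + 2) ≤ F * (6 * F) := Nat.mul_le_mul (by omega) (by omega)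
    have hf : T.final.length * (4 * T.n + 2) ≤ F * (6 * F) := Nat.mul_le_mul (by omega) (by omega)
    have ht : 3 * (T.trans.length * (3 * (K * F) + 40 * F)) ≤ F * (3 * (K * F) + 40 * F) := by
      rw [← mul_assoc]; exact Nat.mul_le_mul_right _ (by omega)
    have hF : F ≤ F * F := Nat.le_mul_of_pos_left _ (by omega)
    have e2 : (K + 100) * F ^ 2 = K * (F * F) + 100 * (F * F) := by ring
    have e3 : F * (6 * F) = 6 * (F * F) := by ring
    have e4 : F * (3 * (K * F) + 40 * F) = 3 * (K * (F * F)) + 40 * (F * F) := by ring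
    rw [e2]
    omega
  · have : T.raw.maxOut ≤ T.size := by
      refine RawNFT.maxOut_le ?_
      simp only [NFT.raw, List.mem_map]
      rintro _ ⟨τ, hτ, rfl⟩
      have := h10 τ hτ
      simp only
      omega
    omega

theorem NFT.raw_rel (T : NFT α) (w u : List α) : T.raw.Rel w u ↔ T.rel w u := by
  have h1 : ∀ {q q' w u}, T.Run q w u q' → T.raw.Run q.val w u q'.val := by
    intro q q' w u h
    induction h with
    | nil q => exact .nil _
    | cons ht _ ih =>
      exact .cons (List.mem_map_of_mem (f := fun τ : Fin T.n × α × Fin T.n × List α =>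
        (τ.1.val, τ.2.1, τ.2.2.1.val, τ.2.2.2, ())) ht) ih
  have h2 : ∀ {m m' w u}, T.raw.Run m w u m' → ∀ q : Fin T.n, m = q.val → ∃ q' : Fin T.n,
      m' = q'.val ∧ T.Run q w u q' := by
    intro m m' w u h
    induction h with
    | nil m => exact fun q hq => ⟨q, hq, .nil q⟩
    | cons ht _ ih =>
      intro q hq
      obtain ⟨⟨r, b, r', v⟩, hτ, h⟩ := List.mem_map.1 ht
      simp only [Prod.mk.injEq] at h
      obtain ⟨rfl, rfl, rfl, rfl, -⟩ := h
      obtain rfl := Fin.ext hq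
      obtain ⟨q', rfl, h⟩ := ih r' rfl
      exact ⟨q', rfl, .cons hτ h⟩
  constructor
  · rintro ⟨m, hm, m', hm', h⟩
    obtain ⟨q, hq, rfl⟩ := List.mem_map.1 hm
    obtain ⟨r, hr, rfl⟩ := List.mem_map.1 hm'
    obtain ⟨q', hq', h⟩ := h2 h q rfl
    obtain rfl := Fin.ext hq'
    exact ⟨q, hq, r, hr, h⟩
  · rintro ⟨q, hq, q', hq', h⟩
    exact ⟨q.val, List.mem_map_of_mem hq, q'.val, List.mem_map_of_mem hq', h1 h⟩

theorem NFT.raw_wf (T : NFT α) : T.raw.WF := by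
  refine ⟨?_, ?_⟩ <;> simp only [NFT.raw, List.mem_map, List.mem_range]
  · rintro _ ⟨τ, -, rfl⟩; exact ⟨τ.1.isLt, τ.2.2.1.isLt⟩
  · rintro _ ⟨q, -, rfl⟩; exact q.isLt

theorem fullSize_singleRep_product_le (T : RawNFT σ α) (A : CEFA α k) :
    (singleRep (product T A)).fullSize ≤ 30 * sz (productRep (T, A.raw)) := by
  have h1 := singleRep_fullSize (product T A)
  have h2 := (product T A).fullSize_le_sz
  have h3 : sz (product T A).raw ≤ sz (productRep (T, A.raw)) := by
    rw [productRep, productRaw_eq, singleRep_raw]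
    generalize (product T A).raw = B
    rw [sz_pair ([[B]], _), sz_cons, sz_cons]
    omega
  omega

theorem transducer_computes : ∃ (P : TreeProgram) (c : ℕ), ∀ (k : ℕ) (A : CEFA α k) (T : NFT α),
    T.Functional → ComputesRep enc P (.cons (encNFT enc T) (encCEFA enc A)) T.toFun Set.univ A.lang
      ((A.fullSize + 1) ^ (c * T.fullSize)) := by
  obtain ⟨⟨t, ht, hcomp⟩, hsz⟩ := Comp.productRep (α := α) (σ := ℕ)
  obtain ⟨P, c, h⟩ := hcomp.computesRep
  obtain ⟨d, hd⟩ := ((ExpBd.const c).mul (ht.add (.const 1))).add ((ExpBd.const 30).mul hsz)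
  obtain ⟨K, hK⟩ := exists_letter_bound α
  refine ⟨P, (3 * K + 210) * d, fun k A T hT => ?_⟩
  obtain ⟨hT1, hT2⟩ := T.sz_raw_le hK
  have hbase : productBase (T.raw, A.raw) + 2 ≤
      (A.fullSize + 1) ^ ((3 * K + 210) * T.fullSize) := by
    have hA1 : 1 ≤ A.fullSize := Nat.le_add_left _ _
    have hT1' : 1 ≤ T.fullSize := Nat.le_add_left _ _
    set F := A.fullSize
    set G := T.fullSize
    have hpow : ∀ m, m ≤ (F + 1) ^ m := le_base_pow (by omega)
    have hAB := A.sz_raw_add_two_le hK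
    have hTB : sz T.raw ≤ (F + 1) ^ ((K + 102) * G) := by
      calc sz T.raw ≤ (K + 100) * G ^ 2 := hT1
        _ ≤ (F + 1) ^ (K + 100) * ((F + 1) ^ G) ^ 2 :=
          Nat.mul_le_mul (hpow _) (Nat.pow_le_pow_left (hpow _) 2)
        _ = (F + 1) ^ (K + 100 + G * 2) := by rw [← pow_mul, ← pow_add]
        _ ≤ (F + 1) ^ ((K + 102) * G) := Nat.pow_le_pow_right (by omega) (by nlinarith)
    have hprod : productBase (T.raw, A.raw) ≤ (F + 1) ^ ((K + 102) * G + (K + 102) * G) := by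
      rw [pow_add, productBase]
      refine Nat.mul_le_mul hTB ?_
      rw [pow_mul]
      exact (Nat.pow_le_pow_left hAB _).trans (Nat.pow_le_pow_right (by positivity) hT2)
    calc productBase (T.raw, A.raw) + 2
        ≤ (F + 1) ^ ((K + 102) * G + (K + 102) * G) + (F + 1) ^ 2 :=
          Nat.add_le_add hprod (hpow 2)
      _ ≤ (F + 1) ^ ((K + 102) * G + (K + 102) * G) * (F + 1) ^ 2 * (F + 1) := by
          have h1 : 1 ≤ (F + 1) ^ ((K + 102) * G + (K + 102) * G) := Nat.one_le_pow _ _ (by omega)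
          have h2 : 1 ≤ (F + 1) ^ 2 := Nat.one_le_pow _ _ (by omega)
          nlinarith [Nat.mul_le_mul h1 h2, mul_le_mul h1 h2 (by omega) (by omega)]
      _ = (F + 1) ^ ((K + 102) * G + (K + 102) * G + 3) := by
          rw [mul_assoc, ← pow_succ, ← pow_add]
      _ ≤ (F + 1) ^ ((3 * K + 210) * G) := Nat.pow_le_pow_right (by omega) (by nlinarith)
  have hb : c * (t (T.raw, A.raw) + 1) + 30 * sz (productRep (T.raw, A.raw)) ≤
      (A.fullSize + 1) ^ ((3 * K + 210) * d * T.fullSize) := by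
    refine (hd (T.raw, A.raw)).trans ?_
    rw [show (3 * K + 210) * d * T.fullSize = (3 * K + 210) * T.fullSize * d by ring, pow_mul]
    rw [zero_add, pow_one, pow_mul]
    exact Nat.pow_le_pow_left hbase d
  rw [← CEFA.enc_raw, ← NFT.enc_raw, ← enc_pair]
  refine h (T.raw, A.raw) (singleRep (product T.raw A)) (productRaw_eq _ _) ?_ ?_ ?_
  · refine singleRep_represents hT fun w d => ?_
    rw [mem_lang_product T.raw_wf]
    simp only [NFT.raw_rel]
  · exact (fullSize_singleRep_product_le _ _).trans (by omega)
  · omega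

end

/-! ### Leftmost longest matches, letter by letter -/

section
variable {α : Type*}

/-- No nonempty prefix of `w` belongs to `S`. -/
def NoPrefix (S : Language α) (w : List α) : Prop := ∀ m < w.length, w.take (m + 1) ∉ S

/-- The longest nonempty prefix of `w` in `C` has the length `m + 1`. -/
def LongestPrefix (C : Language α) (w : List α) (m : ℕ) : Prop :=
  m < w.length ∧ w.take (m + 1) ∈ C ∧ ∀ m', m < m' → m' < w.length → w.take (m' + 1) ∉ C

theorem noPrefix_cons {S S' : Language α} {a : α} (h : ∀ x, x ∈ S' ↔ a :: x ∈ S) (w : List α) :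
    NoPrefix S (a :: w) ↔ [] ∉ S' ∧ NoPrefix S' w := by
  simp only [NoPrefix, h, List.length_cons, List.take_succ_cons]
  constructor
  · exact fun H => ⟨by simpa using H 0 (by omega), fun m hm => H (m + 1) (by omega)⟩
  · rintro ⟨h0, h1⟩ (_ | m) hm
    · simpa using h0
    · exact h1 m (by omega)

theorem noPrefix_add {S S' : Language α} {w : List α} :
    NoPrefix (S + S') w ↔ NoPrefix S w ∧ NoPrefix S' w := by
  simp only [NoPrefix, Language.mem_add, not_or]
  exact ⟨fun h => ⟨fun m hm => (h m hm).1, fun m hm => (h m hm).2⟩,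
    fun h m hm => ⟨h.1 m hm, h.2 m hm⟩⟩

theorem longestPrefix_cons_zero {C D : Language α} {a : α} (h : ∀ x, x ∈ D ↔ a :: x ∈ C)
    (w : List α) : LongestPrefix C (a :: w) 0 ↔ [] ∈ D ∧ NoPrefix D w := by
  simp only [LongestPrefix, NoPrefix, h, List.length_cons, List.take_succ_cons, List.take_zero]
  constructor
  · exact fun H => ⟨H.2.1, fun m hm => H.2.2 (m + 1) (by omega) (by omega)⟩
  · rintro ⟨h0, h1⟩
    refine ⟨by omega, h0, ?_⟩
    rintro (_ | m) h2 h3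
    · omega
    · exact h1 m (by omega)

theorem longestPrefix_cons_succ {C D : Language α} {a : α} (h : ∀ x, x ∈ D ↔ a :: x ∈ C)
    (w : List α) (m : ℕ) : LongestPrefix C (a :: w) (m + 1) ↔ LongestPrefix D w m := by
  simp only [LongestPrefix, h, List.length_cons, List.take_succ_cons]
  constructor
  · exact fun H => ⟨by omega, H.2.1, fun m' h1 h2 => H.2.2 (m' + 1) (by omega) (by omega)⟩
  · rintro ⟨h0, h1, h2⟩
    refine ⟨by omega, h1, ?_⟩
    rintro (_ | m') h3 h4
    · omega
    · exact h2 m' (by omega) (by omega)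

/-- Either no match begins at the first letter, or the longest one is replaced. -/
theorem eq_replaceAll_cons {L : Language α} {u : List α} {a : α} {w v : List α} :
    v = replaceAll L u (a :: w) ↔ (NoPrefix L (a :: w) ∧ v = a :: replaceAll L u w) ∨
      ∃ m, LongestPrefix L (a :: w) m ∧ v = u ++ replaceAll L u ((a :: w).drop (m + 1)) := by
  classical
  rw [replaceAll]
  by_cases h : ∃ m ≤ w.length, (a :: w).take (m + 1) ∈ L
  · rw [if_pos h]
    have hno : ¬ NoPrefix L (a :: w) := fun H => by
      obtain ⟨m, hm, h⟩ := h
      exact H m (by simp; omega) h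
    have hlong : ∀ m, LongestPrefix L (a :: w) m ↔
        Nat.findGreatest (fun m => (a :: w).take (m + 1) ∈ L) w.length = m := by
      intro m
      obtain ⟨m₀, hm₀, h⟩ := h
      have h0 := Nat.findGreatest_spec (P := fun m => (a :: w).take (m + 1) ∈ L) hm₀ h
      constructor
      · rintro ⟨h1, h2, h3⟩
        rw [List.length_cons] at h1
        have h4 := Nat.le_findGreatest (P := fun m => (a :: w).take (m + 1) ∈ L)
          (Nat.le_of_lt_succ h1) h2
        by_contra h5
        exact h3 _ (lt_of_le_of_ne h4 (Ne.symm h5))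
          (by rw [List.length_cons]; exact Nat.lt_succ_of_le (Nat.findGreatest_le _)) h0
      · rintro rfl
        refine ⟨by rw [List.length_cons]; exact Nat.lt_succ_of_le (Nat.findGreatest_le _), h0,
          fun m' h1 h2 => Nat.findGreatest_is_greatest h1 (by simpa [Nat.lt_succ_iff] using h2)⟩
    simp [hno, hlong]
  · rw [if_neg h]
    have hno : NoPrefix L (a :: w) := fun m hm hL => h ⟨m, by simpa [Nat.lt_succ_iff] using hm, hL⟩
    have hlong : ∀ m, ¬ LongestPrefix L (a :: w) m := fun m hm => hno m hm.1 hm.2.1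
    simp [hno, hlong]

/-- `v` is the result of the replacement in `w`, and none of the matches forbidden by `S` occurs. -/
def OutsideSpec (L : Language α) (u : List α) (S : Language α) (w v : List α) : Prop :=
  v = replaceAll L u w ∧ NoPrefix S w

/-- `v` is the result of the replacement in `w` inside of a match of which `C` is the set of
possible remainders, and none of the matches forbidden by `S` occurs. -/
def InsideSpec (L : Language α) (u : List α) (C S : Language α) (w v : List α) : Prop :=
  (∃ m, LongestPrefix C w m ∧ v = u ++ replaceAll L u (w.drop (m + 1))) ∧ NoPrefix S w

/-- Inside a match, the next letter either does not end the match, or it ends the match, which is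
allowed if the remaining words `D` do not lead to a longer match. -/
theorem insideSpec_cons {L : Language α} {u : List α} {C S D S' : Language α} {a : α}
    (hD : ∀ x, x ∈ D ↔ a :: x ∈ C) (hS : ∀ x, x ∈ S' ↔ a :: x ∈ S) (w v : List α) :
    InsideSpec L u C S (a :: w) v ↔ [] ∉ S' ∧ (InsideSpec L u D S' w v ∨
      [] ∈ D ∧ ∃ v', v = u ++ v' ∧ OutsideSpec L u (S' + D) w v') := by
  simp only [InsideSpec, OutsideSpec, noPrefix_cons hS, noPrefix_add]
  rw [← Nat.or_exists_add_one]
  simp only [longestPrefix_cons_zero hD, longestPrefix_cons_succ hD, List.drop_succ_cons,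
    List.drop_zero, zero_add]
  constructor
  · rintro ⟨⟨⟨h1, h2⟩, rfl⟩ | h1, h3, h4⟩
    · exact ⟨h3, .inr ⟨h1, _, rfl, rfl, h4, h2⟩⟩
    · exact ⟨h3, .inl ⟨h1, h4⟩⟩
  · rintro ⟨h3, ⟨h1, h4⟩ | ⟨h1, _, rfl, rfl, h4, h2⟩⟩
    · exact ⟨.inr h1, h3, h4⟩
    · exact ⟨.inl ⟨⟨h1, h2⟩, rfl⟩, h3, h4⟩

/-- Outside of a match, there is the further choice to keep the next letter, if it is not the
beginning of a match. -/
theorem outsideSpec_cons {L : Language α} {u : List α} {S D S' : Language α} {a : α}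
    (hD : ∀ x, x ∈ D ↔ a :: x ∈ L) (hS : ∀ x, x ∈ S' ↔ a :: x ∈ S) (w v : List α) :
    OutsideSpec L u S (a :: w) v ↔ [] ∉ S' ∧ (InsideSpec L u D S' w v ∨
      ([] ∈ D ∧ ∃ v', v = u ++ v' ∧ OutsideSpec L u (S' + D) w v') ∨
      [] ∉ D ∧ ∃ v', v = [a] ++ v' ∧ OutsideSpec L u (S' + D) w v') := by
  have h := insideSpec_cons (u := u) (L := L) hD hS w v
  rw [InsideSpec] at h
  rw [OutsideSpec, eq_replaceAll_cons, or_and_right, h, noPrefix_cons hD, noPrefix_cons hS]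
  have h2 : (([] ∉ D ∧ NoPrefix D w) ∧ v = a :: replaceAll L u w) ∧ [] ∉ S' ∧ NoPrefix S' w ↔
      [] ∉ S' ∧ [] ∉ D ∧ ∃ v', v = [a] ++ v' ∧ OutsideSpec L u (S' + D) w v' := by
    simp only [OutsideSpec, noPrefix_add]
    constructor
    · rintro ⟨⟨⟨h1, h2⟩, rfl⟩, h3, h4⟩
      exact ⟨h3, h1, _, rfl, rfl, h4, h2⟩
    · rintro ⟨h3, h1, _, rfl, rfl, h4, h2⟩
      exact ⟨⟨⟨h1, h2⟩, rfl⟩, h3, h4⟩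
  rw [h2]
  constructor
  · rintro (⟨h3, h⟩ | ⟨h3, h | h⟩)
    exacts [⟨h3, .inr (.inr h)⟩, ⟨h3, .inl h⟩, ⟨h3, .inr (.inl h)⟩]
  · rintro ⟨h3, h | h | h⟩
    exacts [.inr ⟨h3, .inl h⟩, .inr ⟨h3, .inr h⟩, .inl ⟨h3, h⟩]

end

/-! ### Marked regular expressions -/

section
variable {α : Type*}

/-- The words that lead from a marking of `e` to the end of `e`. A marking is a set of occurrences
of letters in `e`: those which may have been read last. It is given by a tree of the shape of `e`;
an unmarked part may also be given by the empty tree. -/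
def markLang : RegularExpression α → BinTree → Language α
  | .zero, _ => 0
  | .epsilon, _ => 0
  | .char _, m => if m.isCons then 1 else 0
  | .plus r s, m => markLang r m.hd + markLang s m.tl
  | .comp r s, m => markLang r m.hd * s.matches' + markLang s m.tl
  | .star r, m => markLang r m * KStar.kstar r.matches'

/-- Whether a letter at the end of `e` is marked. -/
def markFinal : RegularExpression α → BinTree → Bool
  | .zero, _ => false
  | .epsilon, _ => false
  | .char _, m => m.isCons
  | .plus r s, m => markFinal r m.hd || markFinal s m.tl
  | .comp r s, m => markFinal s m.tl || (s.matchEpsilon && markFinal r m.hd)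
  | .star r, m => markFinal r m

/-- The marking after a further letter `a`; with `b`, a match may also begin with this letter. -/
def markShift [DecidableEq α] : RegularExpression α → Bool → α → BinTree → BinTree
  | .zero, _, _, _ => .nil
  | .epsilon, _, _, _ => .nil
  | .char c, b, a, _ => bif b && decide (c = a) then .cons .nil .nil else .nil
  | .plus r s, b, a, m => .cons (markShift r b a m.hd) (markShift s b a m.tl)
  | .comp r s, b, a, m => .cons (markShift r b a m.hd)
      (markShift s ((b && r.matchEpsilon) || markFinal r m.hd) a m.tl)
  | .star r, b, a, m => markShift r (b || markFinal r m) a m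

/-- The union of two markings. -/
def markJoin : BinTree → BinTree → BinTree
  | .nil, m => m
  | .cons a b, .nil => .cons a b
  | .cons a b, .cons c d => .cons (markJoin a c) (markJoin b d)

/-- All markings of `e`. -/
def markings : RegularExpression α → List BinTree
  | .zero => [.nil]
  | .epsilon => [.nil]
  | .char _ => [.nil, .cons .nil .nil]
  | .plus r s => (pairs (markings r) (markings s)).map fun p => .cons p.1 p.2
  | .comp r s => (pairs (markings r) (markings s)).map fun p => .cons p.1 p.2
  | .star r => markings r

@[simp] theorem BinTree.hd_nil : BinTree.nil.hd = .nil := rfl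
@[simp] theorem BinTree.tl_nil : BinTree.nil.tl = .nil := rfl
@[simp] theorem BinTree.isCons_nil : BinTree.nil.isCons = false := rfl
@[simp] theorem BinTree.hd_cons (a b : BinTree) : (BinTree.cons a b).hd = a := rfl
@[simp] theorem BinTree.tl_cons (a b : BinTree) : (BinTree.cons a b).tl = b := rfl
@[simp] theorem BinTree.isCons_cons (a b : BinTree) : (BinTree.cons a b).isCons = true := rfl

theorem markJoin_hd (m m' : BinTree) : (markJoin m m').hd = markJoin m.hd m'.hd := by
  cases m with
  | nil => rfl
  | cons a b => cases m' <;> cases a <;> rfl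

theorem markJoin_tl (m m' : BinTree) : (markJoin m m').tl = markJoin m.tl m'.tl := by
  cases m with
  | nil => rfl
  | cons a b => cases m' <;> cases b <;> rfl

theorem markJoin_isCons (m m' : BinTree) :
    (markJoin m m').isCons = (m.isCons || m'.isCons) := by
  cases m <;> cases m' <;> rfl

theorem markLang_nil (e : RegularExpression α) : markLang e .nil = 0 := by
  induction e with
  | zero => rfl
  | epsilon => rfl
  | char a => rfl
  | plus r s hr hs => simp [markLang, hr, hs]
  | comp r s hr hs => simp [markLang, hr, hs]
  | star r hr => simp [markLang, hr]

theorem markLang_join (e : RegularExpression α) (m m' : BinTree) :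
    markLang e (markJoin m m') = markLang e m + markLang e m' := by
  induction e generalizing m m' with
  | zero => simp [markLang]
  | epsilon => simp [markLang]
  | char a =>
    simp only [markLang, markJoin_isCons]
    cases m.isCons <;> cases m'.isCons <;> simp
  | plus r s hr hs =>
    simp only [markLang, markJoin_hd, markJoin_tl, hr, hs]
    abel
  | comp r s hr hs =>
    simp only [markLang, markJoin_hd, markJoin_tl, hr, hs, add_mul]
    abel
  | star r hr => simp only [markLang, hr, add_mul]

theorem nil_mem_mul {L M : Language α} : [] ∈ L * M ↔ [] ∈ L ∧ [] ∈ M := by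
  simp [Language.mem_mul]

theorem cons_mem_mul {L M : Language α} {a : α} {w : List α} :
    a :: w ∈ L * M ↔ (∃ x y, a :: x ∈ L ∧ y ∈ M ∧ x ++ y = w) ∨ [] ∈ L ∧ a :: w ∈ M := by
  rw [Language.mem_mul]
  constructor
  · rintro ⟨_ | ⟨b, x⟩, hx, y, hy, h⟩
    · exact .inr ⟨hx, by simpa using h ▸ hy⟩
    · simp only [List.cons_append, List.cons.injEq] at h
      obtain ⟨rfl, h⟩ := h
      exact .inl ⟨x, y, hx, hy, h⟩
  · rintro (⟨x, y, hx, hy, rfl⟩ | ⟨h1, h2⟩)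
    · exact ⟨_, hx, y, hy, rfl⟩
    · exact ⟨_, h1, _, h2, rfl⟩

theorem cons_mem_kstar {L : Language α} {a : α} {w : List α} :
    a :: w ∈ KStar.kstar L ↔ ∃ x y, a :: x ∈ L ∧ y ∈ KStar.kstar L ∧ x ++ y = w := by
  constructor
  · rw [Language.mem_kstar_iff_exists_nonempty]
    rintro ⟨_ | ⟨_ | ⟨b, x⟩, S⟩, h, hS⟩
    · simp at h
    · simpa using (hS [] (by simp)).2
    · simp only [List.flatten_cons, List.cons_append, List.cons.injEq] at h
      obtain ⟨rfl, rfl⟩ := h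
      exact ⟨x, S.flatten, (hS _ (by simp)).1,
        Language.join_mem_kstar fun y hy => (hS y (by simp [hy])).1, rfl⟩
  · rintro ⟨x, y, hx, hy, rfl⟩
    rw [← Language.one_add_self_mul_kstar_eq_kstar, Language.mem_add]
    exact .inr (Language.append_mem_mul hx hy)

theorem matchEpsilon_iff (e : RegularExpression α) : e.matchEpsilon ↔ [] ∈ e.matches' := by
  classical
  exact e.rmatch_iff_matches' []

theorem markFinal_iff (e : RegularExpression α) (m : BinTree) :
    markFinal e m ↔ [] ∈ markLang e m := by
  induction e generalizing m with
  | zero => simp [markFinal, markLang, Language.notMem_zero]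
  | epsilon => simp [markFinal, markLang, Language.notMem_zero]
  | char a =>
    simp only [markFinal, markLang]
    cases m.isCons <;> simp [Language.notMem_zero]
  | plus r s hr hs => simp [markFinal, markLang, Language.mem_add, hr, hs]
  | comp r s hr hs =>
    simp only [markFinal, markLang, Language.mem_add, nil_mem_mul, Bool.or_eq_true,
      Bool.and_eq_true, hr, hs, matchEpsilon_iff]
    tauto
  | star r hr => simp [markFinal, markLang, nil_mem_mul, hr, Language.nil_mem_kstar]

/-- The shift by `a` computes the residual by `a` of the language of a marking, and of the language
of `e` if `b` holds. -/
theorem mem_markLang_shift [DecidableEq α] (e : RegularExpression α) (b : Bool) (a : α)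
    (m : BinTree) (w : List α) :
    w ∈ markLang e (markShift e b a m) ↔ a :: w ∈ markLang e m ∨ b ∧ a :: w ∈ e.matches' := by
  induction e generalizing b m w with
  | zero => simp [markLang, RegularExpression.matches', Language.notMem_zero]
  | epsilon =>
    simp [markLang, RegularExpression.matches', Language.notMem_zero, Language.mem_one]
  | char c =>
    have h1 : a :: w ∉ markLang (.char c) m := by
      simp only [markLang]
      cases m.isCons <;> simp [Language.notMem_zero, Language.mem_one]
    have h2 : a :: w ∈ (RegularExpression.char c).matches' ↔ c = a ∧ w = [] := by
      rw [RegularExpression.matches'_char]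
      change a :: w = [c] ↔ _
      simp [eq_comm]
    simp only [h1, h2, false_or]
    by_cases h : c = a <;> cases b <;>
      simp [h, markLang, markShift, Language.notMem_zero, Language.mem_one]
  | plus r s hr hs =>
    simp only [markLang, markShift, BinTree.hd_cons, BinTree.tl_cons, Language.mem_add, hr, hs,
      RegularExpression.matches']
    tauto
  | comp r s hr hs =>
    simp only [markLang, markShift, BinTree.hd_cons, BinTree.tl_cons, Language.mem_add, hs,
      RegularExpression.matches', cons_mem_mul, Bool.or_eq_true, Bool.and_eq_true,
      matchEpsilon_iff, markFinal_iff]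
    rw [Language.mem_mul]
    simp only [hr]
    have : (∃ x, (a :: x ∈ markLang r m.hd ∨ b ∧ a :: x ∈ r.matches') ∧
        ∃ y ∈ s.matches', x ++ y = w) ↔
        (∃ x y, a :: x ∈ markLang r m.hd ∧ y ∈ s.matches' ∧ x ++ y = w) ∨
        b ∧ ∃ x y, a :: x ∈ r.matches' ∧ y ∈ s.matches' ∧ x ++ y = w := by
      constructor
      · rintro ⟨x, hx | ⟨hb, hx⟩, y, h⟩
        exacts [.inl ⟨x, y, hx, h⟩, .inr ⟨hb, x, y, hx, h⟩]
      · rintro (⟨x, y, hx, h⟩ | ⟨hb, x, y, hx, h⟩)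
        exacts [⟨x, .inl hx, y, h⟩, ⟨x, .inr ⟨hb, hx⟩, y, h⟩]
    rw [this]
    have taut : ∀ P Q S E F G B : Prop, ((P ∨ B ∧ Q) ∨ S ∨ (B ∧ E ∨ F) ∧ G) ↔
        (((P ∨ F ∧ G) ∨ S) ∨ B ∧ (Q ∨ E ∧ G)) := by grind
    exact taut ..
  | star r hr =>
    simp only [markLang, markShift, RegularExpression.matches', cons_mem_mul, cons_mem_kstar]
    rw [Language.mem_mul]
    simp only [hr, Bool.or_eq_true, markFinal_iff]
    constructor
    · rintro ⟨x, hx | ⟨hb | hb, hx⟩, y, h⟩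
      exacts [.inl (.inl ⟨x, y, hx, h⟩), .inr ⟨hb, x, y, hx, h⟩, .inl (.inr ⟨hb, x, y, hx, h⟩)]
    · rintro ((⟨x, y, hx, h⟩ | ⟨hb, x, y, hx, h⟩) | ⟨hb, x, y, hx, h⟩)
      exacts [⟨x, .inl hx, y, h⟩, ⟨x, .inr ⟨.inr hb, hx⟩, y, h⟩, ⟨x, .inr ⟨.inl hb, hx⟩, y, h⟩]

theorem markShift_mem [DecidableEq α] (e : RegularExpression α) (b : Bool) (a : α) (m : BinTree) :
    markShift e b a m ∈ markings e := by
  induction e generalizing b m with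
  | zero => simp [markShift, markings]
  | epsilon => simp [markShift, markings]
  | char c => cases h : b && decide (c = a) <;> simp [markShift, markings, h]
  | plus r s hr hs =>
    exact List.mem_map_of_mem (f := fun p : BinTree × BinTree => BinTree.cons p.1 p.2)
      (a := (_, _)) (mem_pairs.2 ⟨hr _ _, hs _ _⟩)
  | comp r s hr hs =>
    exact List.mem_map_of_mem (f := fun p : BinTree × BinTree => BinTree.cons p.1 p.2)
      (a := (_, _)) (mem_pairs.2 ⟨hr _ _, hs _ _⟩)
  | star r hr => exact hr _ _

theorem markJoin_mem {e : RegularExpression α} {m m' : BinTree} (hm : m ∈ markings e)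
    (hm' : m' ∈ markings e) : markJoin m m' ∈ markings e := by
  have hpairs : ∀ {l l' : List BinTree} {m m' : BinTree},
      (∀ {m m'}, m ∈ l → m' ∈ l → markJoin m m' ∈ l) →
      (∀ {m m'}, m ∈ l' → m' ∈ l' → markJoin m m' ∈ l') →
      m ∈ (pairs l l').map (fun p => BinTree.cons p.1 p.2) →
      m' ∈ (pairs l l').map (fun p => BinTree.cons p.1 p.2) →
      markJoin m m' ∈ (pairs l l').map fun p => BinTree.cons p.1 p.2 := by
    intro l l' m m' hl hl' h h'
    obtain ⟨p, hp, rfl⟩ := List.mem_map.1 h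
    obtain ⟨q, hq, rfl⟩ := List.mem_map.1 h'
    rw [mem_pairs] at hp hq
    exact List.mem_map_of_mem (f := fun p : BinTree × BinTree => BinTree.cons p.1 p.2)
      (a := (_, _)) (mem_pairs.2 ⟨hl hp.1 hq.1, hl' hp.2 hq.2⟩)
  induction e generalizing m m' with
  | zero => simp_all [markings, markJoin]
  | epsilon => simp_all [markings, markJoin]
  | char c =>
    simp only [markings, List.mem_cons, List.not_mem_nil, or_false] at hm hm' ⊢
    rcases hm with rfl | rfl <;> rcases hm' with rfl | rfl <;> simp [markJoin]
  | plus r s hr hs => exact hpairs hr hs hm hm'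
  | comp r s hr hs => exact hpairs hr hs hm hm'
  | star r hr => exact hr hm hm'

theorem length_markings_le (e : RegularExpression α) :
    (markings e).length ≤ 2 ^ regexSize e := by
  have hpairs : ∀ r s : RegularExpression α, (markings r).length ≤ 2 ^ regexSize r →
      (markings s).length ≤ 2 ^ regexSize s → (pairs (markings r) (markings s)).length ≤
        2 ^ (regexSize r + regexSize s + 1) := by
    intro r s hr hs
    have h : (pairs (markings r) (markings s)).length =
        (markings r).length * (markings s).length := by simp [pairs]
    rw [h, pow_succ, pow_add]
    exact (Nat.mul_le_mul hr hs).trans (Nat.le_mul_of_pos_right _ (by norm_num))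
  induction e with
  | zero => simp [markings, regexSize]
  | epsilon => simp [markings, regexSize]
  | char c => simp [markings, regexSize]
  | plus r s hr hs => simpa [markings, regexSize] using hpairs r s hr hs
  | comp r s hr hs => simpa [markings, regexSize] using hpairs r s hr hs
  | star r hr => exact hr.trans (Nat.pow_le_pow_right (by norm_num) (Nat.le_succ _))

theorem size_le_of_mem_markings {e : RegularExpression α} {m : BinTree} (hm : m ∈ markings e) :
    m.size ≤ 3 * regexSize e := by
  have hpairs : ∀ {r s : RegularExpression α} {m : BinTree},
      (∀ {m}, m ∈ markings r → m.size ≤ 3 * regexSize r) →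
      (∀ {m}, m ∈ markings s → m.size ≤ 3 * regexSize s) →
      m ∈ (pairs (markings r) (markings s)).map (fun p => BinTree.cons p.1 p.2) →
      m.size ≤ 3 * (regexSize r + regexSize s + 1) := by
    intro r s m hr hs h
    obtain ⟨p, hp, rfl⟩ := List.mem_map.1 h
    rw [mem_pairs] at hp
    have h1 := hr hp.1
    have h2 := hs hp.2
    simp only [BinTree.size]
    omega
  induction e generalizing m with
  | zero => simp_all [markings, regexSize, BinTree.size]
  | epsilon => simp_all [markings, regexSize, BinTree.size]
  | char c =>
    simp only [markings, List.mem_cons, List.not_mem_nil, or_false] at hm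
    rcases hm with rfl | rfl <;> simp [BinTree.size, regexSize]
  | plus r s hr hs => exact hpairs hr hs hm
  | comp r s hr hs => exact hpairs hr hs hm
  | star r hr => exact (hr hm).trans (Nat.mul_le_mul_left 3 (Nat.le_succ _))

/-! ### The transducer for `replaceAll` -/

variable [DecidableEq α]

/-- The transitions from the state `q` on the letter `a`. A state `(b, c, s)` is outside of a match
(if `b` holds; then `c` is empty) or inside a match, with the marking `c`; the marking `s`
represents the words which would continue an earlier match, or would begin a match at a letter that
has been kept, and which must not occur. The choices are to continue a match, to end a match, and
to keep the letter. -/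
def replaceSteps (e : RegularExpression α) (u : List α) (q : Bool × BinTree × BinTree) (a : α) :
    List ((Bool × BinTree × BinTree) × α × (Bool × BinTree × BinTree) × List α × Unit) :=
  bif markFinal e (markShift e false a q.2.2) then [] else
    (q, a, (false, markShift e q.1 a q.2.1, markShift e false a q.2.2), [], ()) ::
      bif markFinal e (markShift e q.1 a q.2.1) then
        [(q, a, (true, .nil, markJoin (markShift e false a q.2.2) (markShift e q.1 a q.2.1)), u,
          ())]
      else bif q.1 then
        [(q, a, (true, .nil, markJoin (markShift e false a q.2.2) (markShift e q.1 a q.2.1)), [a],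
          ())]
      else []

/-- The transducer for `replaceAll`, given the list `l` of the letters and the list `M` of the
markings. -/
def replaceNFT (l : List α) (e : RegularExpression α) (u : List α) (M : List BinTree) :
    RawNFT (Bool × BinTree × BinTree) α :=
  (pairs [true, false] (pairs M M),
    (pairs [true, false] (pairs M M)).flatMap fun q => l.flatMap fun a => replaceSteps e u q a,
    [(true, .nil, .nil)], M.map fun s => (true, .nil, s), ())

/-- The markings, and the empty one. -/
def allMarkings (e : RegularExpression α) : List BinTree := .nil :: markings e

theorem markShift_mem_all (e : RegularExpression α) (b : Bool) (a : α) (m : BinTree) :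
    markShift e b a m ∈ allMarkings e := List.mem_cons_of_mem _ (markShift_mem e b a m)

theorem markJoin_shift_mem_all (e : RegularExpression α) (b b' : Bool) (a : α) (m m' : BinTree) :
    markJoin (markShift e b a m) (markShift e b' a m') ∈ allMarkings e :=
  List.mem_cons_of_mem _ (markJoin_mem (markShift_mem ..) (markShift_mem ..))

theorem mem_replaceNFT_states {l : List α} {e : RegularExpression α} {u : List α}
    {q : Bool × BinTree × BinTree} : q ∈ (replaceNFT l e u (allMarkings e)).1 ↔
      q.2.1 ∈ allMarkings e ∧ q.2.2 ∈ allMarkings e := by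
  obtain ⟨b, c, s⟩ := q
  cases b <;> simp [replaceNFT, mem_pairs]

theorem mem_replaceNFT_trans {l : List α} (hl : ∀ a, a ∈ l) {e : RegularExpression α}
    {u : List α} {q q' : Bool × BinTree × BinTree} {a : α} {v : List α} :
    (q, a, q', v, ()) ∈ (replaceNFT l e u (allMarkings e)).2.1 ↔
      q ∈ (replaceNFT l e u (allMarkings e)).1 ∧ (q, a, q', v, ()) ∈ replaceSteps e u q a := by
  have key : ∀ {p : Bool × BinTree × BinTree} {b : α} {τ}, τ ∈ replaceSteps e u p b →
      τ.1 = p ∧ τ.2.1 = b := by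
    rintro ⟨b', c, s⟩ b τ h
    simp only [replaceSteps] at h
    cases h1 : markFinal e (markShift e false b s) <;>
      cases h2 : markFinal e (markShift e b' b c) <;> cases b' <;>
      simp only [h1, h2, cond_true, cond_false, List.mem_cons, List.not_mem_nil, or_false] at h
    all_goals rcases h with rfl | rfl <;> exact ⟨rfl, rfl⟩
  change _ ∈ List.flatMap _ _ ↔ _
  simp only [List.mem_flatMap]
  constructor
  · rintro ⟨p, hp, b, -, h⟩
    obtain ⟨h1, h2⟩ := key h
    obtain rfl : q = p := h1
    obtain rfl : a = b := h2
    exact ⟨hp, h⟩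
  · rintro ⟨hq, h⟩
    exact ⟨q, hq, a, hl a, h⟩

end

section
variable {α : Type*}

theorem outsideSpec_nil {L : Language α} {u : List α} {S : Language α} {v : List α} :
    OutsideSpec L u S [] v ↔ v = [] := by
  simp [OutsideSpec, NoPrefix, replaceAll]

theorem not_insideSpec_nil {L : Language α} {u : List α} {C S : Language α} {v : List α} :
    ¬ InsideSpec L u C S [] v := by
  simp [InsideSpec, LongestPrefix]

/-- `T` accepts the input `w` from the state `p` on, with the output `v`. -/
def RawNFT.Accepts {σ : Type*} (T : RawNFT σ α) (p : σ) (w v : List α) : Prop :=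
  ∃ p' ∈ T.2.2.2.1, T.Run p w v p'

theorem RawNFT.accepts_nil {σ : Type*} {T : RawNFT σ α} {p : σ} {v : List α} :
    T.Accepts p [] v ↔ p ∈ T.2.2.2.1 ∧ v = [] := by
  constructor
  · rintro ⟨p', hp', h⟩
    cases h
    exact ⟨hp', rfl⟩
  · rintro ⟨hp, rfl⟩
    exact ⟨p, hp, .nil p⟩

theorem RawNFT.accepts_cons {σ : Type*} {T : RawNFT σ α} {p : σ} {a : α} {w v : List α} :
    T.Accepts p (a :: w) v ↔
      ∃ q x, (p, a, q, x, ()) ∈ T.2.1 ∧ ∃ v', v = x ++ v' ∧ T.Accepts q w v' := by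
  constructor
  · rintro ⟨p', hp', h⟩
    cases h with
    | cons ht h => exact ⟨_, _, ht, _, rfl, p', hp', h⟩
  · rintro ⟨q, x, ht, v', rfl, p', hp', h⟩
    exact ⟨p', hp', .cons ht h⟩

variable [DecidableEq α]

theorem mem_replaceSteps {e : RegularExpression α} {u : List α} {q q' : Bool × BinTree × BinTree}
    {a : α} {x : List α} : (q, a, q', x, ()) ∈ replaceSteps e u q a ↔
      ¬ markFinal e (markShift e false a q.2.2) ∧
      (q' = (false, markShift e q.1 a q.2.1, markShift e false a q.2.2) ∧ x = [] ∨
      markFinal e (markShift e q.1 a q.2.1) ∧ q' = (true, .nil,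
        markJoin (markShift e false a q.2.2) (markShift e q.1 a q.2.1)) ∧ x = u ∨
      ¬ markFinal e (markShift e q.1 a q.2.1) ∧ q.1 ∧ q' = (true, .nil,
        markJoin (markShift e false a q.2.2) (markShift e q.1 a q.2.1)) ∧ x = [a]) := by
  obtain ⟨b, c, s⟩ := q
  simp only [replaceSteps]
  cases markFinal e (markShift e false a s) <;>
    cases markFinal e (markShift e b a c) <;> cases b <;> simp

theorem replaceNFT_accepts_cons {l : List α} (hl : ∀ a, a ∈ l) {e : RegularExpression α}
    {u : List α} {q : Bool × BinTree × BinTree} (hq : q ∈ (replaceNFT l e u (allMarkings e)).1)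
    (a : α) (w v : List α) : (replaceNFT l e u (allMarkings e)).Accepts q (a :: w) v ↔
      [] ∉ markLang e (markShift e false a q.2.2) ∧
      ((replaceNFT l e u (allMarkings e)).Accepts
        (false, markShift e q.1 a q.2.1, markShift e false a q.2.2) w v ∨
      [] ∈ markLang e (markShift e q.1 a q.2.1) ∧ (∃ v', v = u ++ v' ∧
        (replaceNFT l e u (allMarkings e)).Accepts (true, .nil,
          markJoin (markShift e false a q.2.2) (markShift e q.1 a q.2.1)) w v') ∨
      [] ∉ markLang e (markShift e q.1 a q.2.1) ∧ q.1 ∧ ∃ v', v = [a] ++ v' ∧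
        (replaceNFT l e u (allMarkings e)).Accepts (true, .nil,
          markJoin (markShift e false a q.2.2) (markShift e q.1 a q.2.1)) w v') := by
  simp only [RawNFT.accepts_cons, mem_replaceNFT_trans hl, mem_replaceSteps, hq, true_and,
    markFinal_iff]
  constructor
  · rintro ⟨q', x, ⟨h0, ⟨rfl, rfl⟩ | ⟨h1, rfl, rfl⟩ | ⟨h1, h2, rfl, rfl⟩⟩, v', rfl, h⟩
    exacts [⟨h0, .inl h⟩, ⟨h0, .inr (.inl ⟨h1, v', rfl, h⟩)⟩,
      ⟨h0, .inr (.inr ⟨h1, h2, v', rfl, h⟩)⟩]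
  · rintro ⟨h0, h | ⟨h1, v', rfl, h⟩ | ⟨h1, h2, v', rfl, h⟩⟩
    exacts [⟨_, _, ⟨h0, .inl ⟨rfl, rfl⟩⟩, v, rfl, h⟩,
      ⟨_, _, ⟨h0, .inr (.inl ⟨h1, rfl, rfl⟩)⟩, v', rfl, h⟩,
      ⟨_, _, ⟨h0, .inr (.inr ⟨h1, h2, rfl, rfl⟩)⟩, v', rfl, h⟩]

/-- The outputs from a state `(true, .nil, s)` or `(false, c, s)` are those prescribed by
`OutsideSpec` or `InsideSpec`. -/
theorem replaceNFT_accepts {l : List α} (hl : ∀ a, a ∈ l) (e : RegularExpression α) (u : List α)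
    (w : List α) : ∀ s ∈ allMarkings e,
    (∀ v, (replaceNFT l e u (allMarkings e)).Accepts (true, .nil, s) w v ↔
      OutsideSpec e.matches' u (markLang e s) w v) ∧
    ∀ c ∈ allMarkings e, ∀ v, (replaceNFT l e u (allMarkings e)).Accepts (false, c, s) w v ↔
      InsideSpec e.matches' u (markLang e c) (markLang e s) w v := by
  induction w with
  | nil =>
    refine fun s hs => ⟨fun v => ?_, fun c _ v => ?_⟩
    · rw [RawNFT.accepts_nil, outsideSpec_nil]
      simp [replaceNFT, hs]
    · rw [RawNFT.accepts_nil]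
      simp [replaceNFT, not_insideSpec_nil]
  | cons a w ih =>
    intro s hs
    have hS : ∀ x, x ∈ markLang e (markShift e false a s) ↔ a :: x ∈ markLang e s := by
      simp [mem_markLang_shift]
    have hjoin := fun b c v =>
      (ih _ (markJoin_shift_mem_all e false b a s c)).1 v
    simp only [markLang_join] at hjoin
    have hin := fun b c v => (ih _ (markShift_mem_all e false a s)).2 _ (markShift_mem_all e b a c) v
    refine ⟨fun v => ?_, fun c hc v => ?_⟩
    · rw [replaceNFT_accepts_cons hl (mem_replaceNFT_states.2 ⟨List.mem_cons_self, hs⟩),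
        outsideSpec_cons (D := markLang e (markShift e true a .nil))
        (fun x => by simp [mem_markLang_shift, markLang_nil, Language.notMem_zero]) hS]
      simp only [hjoin, hin, true_and]
    · rw [replaceNFT_accepts_cons hl (mem_replaceNFT_states.2 ⟨hc, hs⟩),
        insideSpec_cons (D := markLang e (markShift e false a c))
        (fun x => by simp [mem_markLang_shift]) hS]
      simp [hjoin, hin]

theorem replaceNFT_rel {l : List α} (hl : ∀ a, a ∈ l) (e : RegularExpression α) (u w v : List α) :
    (replaceNFT l e u (allMarkings e)).Rel w v ↔ v = replaceAll e.matches' u w := by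
  have h := (replaceNFT_accepts hl e u w .nil List.mem_cons_self).1 v
  rw [OutsideSpec, markLang_nil] at h
  have h0 : NoPrefix (0 : Language α) w := fun m _ => Language.notMem_zero _
  rw [RawNFT.Rel, ← and_iff_left (a := v = _) h0, ← h]
  simp [replaceNFT, RawNFT.Accepts]

theorem replaceNFT_wf {l : List α} (hl : ∀ a, a ∈ l) (e : RegularExpression α) (u : List α) :
    (replaceNFT l e u (allMarkings e)).WF := by
  refine ⟨?_, ?_⟩
  · rintro ⟨q, a, q', x, ⟨⟩⟩ h
    obtain ⟨hq, h⟩ := (mem_replaceNFT_trans hl).1 h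
    refine ⟨hq, mem_replaceNFT_states.2 ?_⟩
    obtain ⟨-, ⟨rfl, -⟩ | ⟨-, rfl, -⟩ | ⟨-, -, rfl, -⟩⟩ := mem_replaceSteps.1 h
    exacts [⟨markShift_mem_all .., markShift_mem_all ..⟩,
      ⟨List.mem_cons_self, markJoin_shift_mem_all ..⟩,
      ⟨List.mem_cons_self, markJoin_shift_mem_all ..⟩]
  · intro q hq
    obtain rfl : q = (true, .nil, .nil) := List.mem_singleton.1 hq
    exact mem_replaceNFT_states.2 ⟨List.mem_cons_self, List.mem_cons_self⟩

theorem maxOut_replaceNFT_le {l : List α} (hl : ∀ a, a ∈ l) (e : RegularExpression α)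
    (u : List α) : (replaceNFT l e u (allMarkings e)).maxOut ≤ u.length + 1 := by
  refine RawNFT.maxOut_le ?_
  rintro ⟨q, a, q', x, ⟨⟩⟩ h
  obtain ⟨-, ⟨-, rfl⟩ | ⟨-, -, rfl⟩ | ⟨-, -, -, rfl⟩⟩ :=
    mem_replaceSteps.1 ((mem_replaceNFT_trans hl).1 h).2 <;> simp

end

/-! ### Computing with regular expressions and markings -/

section
variable {α β : Type*} [TreeEnc α] [TreeEnc β]

instance : TreeEnc (RegularExpression α) := ⟨encRegex enc⟩

/-- The number of the outermost symbol. -/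
def regexTag : RegularExpression α → ℕ
  | .zero => 0
  | .epsilon => 1
  | .char _ => 2
  | .plus _ _ => 3
  | .comp _ _ => 4
  | .star _ => 5

/-- The arguments of the outermost symbol. -/
def regexArgs : RegularExpression α → List (RegularExpression α)
  | .plus r s => [r, s]
  | .comp r s => [r, s]
  | .star r => [r]
  | _ => []

/-- The letter of a regular expression that consists of a letter. -/
def regexLetter : RegularExpression α → List α
  | .char a => [a]
  | _ => []

@[fun_prop]
theorem Poly.regexTag {f : β → RegularExpression α} (hf : Poly f) :
    Poly fun b => regexTag (f b) :=
  Poly.of_enc_eq_comp (g := fun b => (CostEnriched.enc (f b)).hd) (by fun_prop) fun b => by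
    cases f b <;> rfl

@[fun_prop]
theorem Poly.regexArgs {f : β → RegularExpression α} (hf : Poly f) :
    Poly fun b => regexArgs (f b) :=
  Poly.of_enc_eq_comp (g := fun b => bif decide (CostEnriched.regexTag (f b) = 2) then BinTree.nil
    else (CostEnriched.enc (f b)).tl) (by fun_prop) fun b => by cases f b <;> rfl

@[fun_prop]
theorem Poly.regexLetter {f : β → RegularExpression α} (hf : Poly f) :
    Poly fun b => regexLetter (f b) :=
  Poly.of_enc_eq_comp (g := fun b => bif decide (CostEnriched.regexTag (f b) = 2) then
    (CostEnriched.enc (f b)).tl else BinTree.nil) (by fun_prop) fun b => by cases f b <;> rfl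

@[fun_prop]
theorem Poly.treeCons {f g : β → BinTree} (hf : Poly f) (hg : Poly g) :
    Poly fun b => BinTree.cons (f b) (g b) :=
  Poly.of_enc_eq_comp (hf.pair hg) fun _ => rfl

theorem sz_regexArgs (e : RegularExpression α) : sz (regexArgs e) + 2 ≤ sz e := by
  have h := one_le_sz (regexTag e)
  have key : sz e = sz (regexTag e) + (enc e).tl.size + 1 := by cases e <;> rfl
  have hargs : sz (regexArgs e) ≤ (enc e).tl.size := by
    cases e with
    | char a => exact one_le_sz [a]
    | _ => exact le_rfl
  omega

theorem sz_lt_of_mem_regexArgs {e d : RegularExpression α} (hd : d ∈ regexArgs e) :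
    sz d + 3 ≤ sz e := by
  have := sz_regexArgs e
  have := sz_lt_of_mem hd
  omega

theorem sum_regexSize_args (e : RegularExpression α) :
    ((regexArgs e).map regexSize).sum + 1 ≤ regexSize e := by
  cases e <;> simp [regexArgs, regexSize]

theorem regexSize_le_sz (e : RegularExpression α) : regexSize e ≤ sz e := by
  have h := sz_regexArgs e
  induction e with
  | zero => exact one_le_sz _
  | epsilon => exact one_le_sz _
  | char a => exact one_le_sz _
  | plus r s hr hs =>
    have hr := hr (sz_regexArgs r)
    have hs := hs (sz_regexArgs s)
    simp only [regexSize, regexArgs, sz_cons] at h ⊢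
    omega
  | comp r s hr hs =>
    have hr := hr (sz_regexArgs r)
    have hs := hs (sz_regexArgs s)
    simp only [regexSize, regexArgs, sz_cons] at h ⊢
    omega
  | star r hr =>
    have hr := hr (sz_regexArgs r)
    simp only [regexSize, regexArgs, sz_cons] at h ⊢
    omega

theorem sz_regex_le {K : ℕ} (hK : ∀ a : α, sz a ≤ K) (e : RegularExpression α) :
    sz e ≤ (K + 20) * regexSize e := by
  induction e with
  | zero => exact (by decide : sz (0 : ℕ) + 2 ≤ 20).trans (by simp [regexSize])
  | epsilon => exact (by decide : sz (1 : ℕ) + 2 ≤ 20).trans (by simp [regexSize])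
  | char a =>
    have h : sz (RegularExpression.char a) = sz (2 : ℕ) + sz [a] + 1 := rfl
    have h2 : sz (2 : ℕ) ≤ 9 := sz_nat_le_linear 2
    have := hK a
    simp only [regexSize, sz_cons, sz_nil] at h ⊢
    omega
  | plus r s hr hs =>
    have h : sz (RegularExpression.plus r s) = sz (3 : ℕ) + sz [r, s] + 1 := rfl
    have h3 : sz (3 : ℕ) ≤ 13 := sz_nat_le_linear 3
    simp only [regexSize, mul_add, sz_cons, sz_nil] at h ⊢
    omega
  | comp r s hr hs =>
    have h : sz (RegularExpression.comp r s) = sz (4 : ℕ) + sz [r, s] + 1 := rfl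
    have h3 : sz (4 : ℕ) ≤ 13 := (sz_nat_le 4).trans (by decide)
    simp only [regexSize, mul_add, sz_cons, sz_nil] at h ⊢
    omega
  | star r hr =>
    have h : sz (RegularExpression.star r) = sz (5 : ℕ) + sz [r] + 1 := rfl
    have h3 : sz (5 : ℕ) ≤ 13 := (sz_nat_le 5).trans (by decide)
    simp only [regexSize, mul_add, sz_cons, sz_nil] at h ⊢
    omega

theorem PolyBd.regexSize {f : β → RegularExpression α} (hf : PolyBd fun b => sz (f b)) :
    PolyBd fun b => regexSize (f b) :=
  hf.mono fun b => regexSize_le_sz (f b)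

/-- The first element of a list, with a default value. -/
abbrev firstD {γ : Type*} (l : List γ) (d : γ) : γ := listCase l d fun x _ => x

@[fun_prop]
theorem Poly.firstD {γ : Type*} [TreeEnc γ] {f : β → List γ} {d : β → γ} (hf : Poly f)
    (hd : Poly d) : Poly fun b => firstD (f b) (d b) :=
  Poly.list_case hf hd (by fun_prop)

@[fun_prop]
theorem Poly.matchEpsilon {f : β → RegularExpression α} (hf : Poly f) :
    Poly fun b => (f b).matchEpsilon := by
  refine Poly.comp (g := RegularExpression.matchEpsilon (α := α)) (Poly.recursion
    (ds := CostEnriched.regexArgs) (post := fun b =>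
      decide (CostEnriched.regexTag b.1 = 1) || (decide (CostEnriched.regexTag b.1 = 5) ||
      ((decide (CostEnriched.regexTag b.1 = 3) &&
        (CostEnriched.firstD b.2 false || CostEnriched.firstD b.2.tail false)) ||
      (decide (CostEnriched.regexTag b.1 = 4) &&
        (CostEnriched.firstD b.2 false && CostEnriched.firstD b.2.tail false)))))
    (by fun_prop) (by fun_prop) (fun e => ?_) regexSize (PolyBd.regexSize .size)
    sum_regexSize_args (fun e d hd => ?_) (.bool _)) hf
  · cases e <;> simp [RegularExpression.matchEpsilon, CostEnriched.regexTag,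
      CostEnriched.regexArgs]
  · have := sz_lt_of_mem_regexArgs hd
    omega

/-- The recursive calls of `markFinal`. -/
def markFinalArgs (b : RegularExpression α × BinTree) : List (RegularExpression α × BinTree) :=
  listCase (regexArgs b.1) [] fun r rs => bif decide (regexTag b.1 = 5) then [(r, b.2)] else
    (r, b.2.hd) :: rs.map fun s => (s, b.2.tl)

theorem sz_tree (m : BinTree) : sz m = m.size := rfl

theorem sz_hd_le (m : BinTree) : sz m.hd ≤ sz m ∧ sz m.tl ≤ sz m := by
  cases m with
  | nil => exact ⟨le_rfl, le_rfl⟩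
  | cons a b =>
    have : sz (BinTree.cons a b) = sz a + sz b + 1 := rfl
    rw [BinTree.hd_cons, BinTree.tl_cons]
    omega

theorem Poly.markFinal_tuple : Poly fun b : RegularExpression α × BinTree => markFinal b.1 b.2 := by
  refine Poly.recursion (ds := markFinalArgs) (post := fun b =>
      (decide (CostEnriched.regexTag b.1.1 = 2) && b.1.2.isCons) ||
      ((decide (CostEnriched.regexTag b.1.1 = 5) && CostEnriched.firstD b.2 false) ||
      ((decide (CostEnriched.regexTag b.1.1 = 3) &&
        (CostEnriched.firstD b.2 false || CostEnriched.firstD b.2.tail false)) ||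
      (decide (CostEnriched.regexTag b.1.1 = 4) &&
        (CostEnriched.firstD b.2.tail false || ((CostEnriched.firstD
          ((CostEnriched.regexArgs b.1.1).tail.map fun s => s.matchEpsilon) false) &&
          CostEnriched.firstD b.2 false))))))
    ?_ ?_ ?_ (fun b => CostEnriched.regexSize b.1) (PolyBd.regexSize (PolyBd.size.mono fun b => by
      simp; omega)) ?_ ?_ (.bool _)
  · refine Poly.list_case (by fun_prop) (by fun_prop) (Poly.cond (by fun_prop) (by fun_prop)
      (Poly.cons (by fun_prop) (Poly.map (by fun_prop) (by fun_prop))))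
  · have : Poly fun b : (RegularExpression α × BinTree) × List Bool =>
        (CostEnriched.regexArgs b.1.1).tail.map fun s => s.matchEpsilon :=
      Poly.map (by fun_prop) (by fun_prop)
    fun_prop
  · rintro ⟨e, m⟩
    cases e <;> simp [CostEnriched.markFinal, CostEnriched.regexTag, CostEnriched.regexArgs,
      markFinalArgs]
  · rintro ⟨e, m⟩
    cases e <;> simp [CostEnriched.regexTag, CostEnriched.regexArgs, markFinalArgs, regexSize]
  · rintro ⟨e, m⟩ ⟨d, m'⟩ h
    have h' : d ∈ CostEnriched.regexArgs e ∧ (m' = m ∨ m' = m.hd ∨ m' = m.tl) := by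
      cases e <;> simp [CostEnriched.regexTag, CostEnriched.regexArgs, markFinalArgs] at h ⊢ <;>
        grind
    have h1 := sz_lt_of_mem_regexArgs h'.1
    have h2 := sz_hd_le m
    simp only [sz_pair]
    rcases h'.2 with rfl | rfl | rfl <;> omega

@[fun_prop]
theorem Poly.markFinal {f : β → RegularExpression α} {g : β → BinTree} (hf : Poly f)
    (hg : Poly g) : Poly fun b => CostEnriched.markFinal (f b) (g b) :=
  Poly.markFinal_tuple.comp (f := fun b => (f b, g b)) (hf.pair hg)

variable [InjEnc α] [DecidableEq α]

/-- The recursive calls of `markShift`. -/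
def markShiftArgs (b : RegularExpression α × Bool × α × BinTree) :
    List (RegularExpression α × Bool × α × BinTree) :=
  listCase (regexArgs b.1) [] fun r rs => bif decide (regexTag b.1 = 5) then
    [(r, b.2.1 || markFinal r b.2.2.2, b.2.2.1, b.2.2.2)] else
    (r, b.2.1, b.2.2.1, b.2.2.2.hd) :: rs.map fun s =>
      (s, (bif decide (regexTag b.1 = 3) then b.2.1 else
        (b.2.1 && r.matchEpsilon) || markFinal r b.2.2.2.hd), b.2.2.1, b.2.2.2.tl)

theorem Poly.markShiftArgs : Poly (markShiftArgs (α := α)) := by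
  refine Poly.list_case (by fun_prop) (by fun_prop) (Poly.cond (by fun_prop) (by fun_prop)
    (Poly.cons (by fun_prop) (Poly.map ?_ (by fun_prop))))
  fun_prop

theorem Poly.markShift_tuple : Poly fun b : RegularExpression α × Bool × α × BinTree =>
    markShift b.1 b.2.1 b.2.2.1 b.2.2.2 := by
  refine Poly.recursion (ds := CostEnriched.markShiftArgs) (post := fun b =>
      bif decide (CostEnriched.regexTag b.1.1 = 2) then
        bif b.1.2.1 && decide (CostEnriched.regexLetter b.1.1 = [b.1.2.2.1]) then
          BinTree.cons .nil .nil else .nil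
      else bif decide (CostEnriched.regexTag b.1.1 = 5) then CostEnriched.firstD b.2 .nil else
      bif decide (CostEnriched.regexTag b.1.1 = 3) || decide (CostEnriched.regexTag b.1.1 = 4) then
        BinTree.cons (CostEnriched.firstD b.2 .nil) (CostEnriched.firstD b.2.tail .nil)
      else .nil)
    Poly.markShiftArgs (by fun_prop) ?_ (fun b => CostEnriched.regexSize b.1)
    (PolyBd.regexSize (PolyBd.size.mono fun b => by simp; omega)) ?_ ?_ ?_
  · rintro ⟨e, b, a, m⟩
    cases e <;> simp [CostEnriched.markShift, CostEnriched.regexTag, CostEnriched.regexArgs,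
      CostEnriched.markShiftArgs, CostEnriched.regexLetter]
  · rintro ⟨e, b, a, m⟩
    cases e <;> simp [CostEnriched.regexTag, CostEnriched.regexArgs, CostEnriched.markShiftArgs,
      regexSize]
  · rintro ⟨e, b, a, m⟩ ⟨d, b', a', m'⟩ h
    have h' : d ∈ CostEnriched.regexArgs e ∧ a' = a ∧ (m' = m ∨ m' = m.hd ∨ m' = m.tl) := by
      cases e <;> simp [CostEnriched.regexTag, CostEnriched.regexArgs,
        CostEnriched.markShiftArgs] at h ⊢ <;> grind
    have h1 := sz_lt_of_mem_regexArgs h'.1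
    have h2 := sz_hd_le m
    have h3 := sz_bool_le b'
    have h4 := one_le_sz b
    obtain ⟨-, rfl, h5⟩ := h'
    simp only [sz_pair]
    rcases h5 with rfl | rfl | rfl <;> omega
  · refine ((PolyBd.const 3).mul (PolyBd.size (β := RegularExpression α × Bool × α ×
      BinTree))).mono fun b => ?_
    have h1 := size_le_of_mem_markings (markShift_mem b.1 b.2.1 b.2.2.1 b.2.2.2)
    have h2 := regexSize_le_sz b.1
    rw [sz_pair, sz_tree]
    omega

@[fun_prop]
theorem Poly.markShift {f : β → RegularExpression α} {g : β → Bool} {a : β → α} {h : β → BinTree}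
    (hf : Poly f) (hg : Poly g) (ha : Poly a) (hh : Poly h) :
    Poly fun b => CostEnriched.markShift (f b) (g b) (a b) (h b) :=
  Poly.markShift_tuple.comp (f := fun b => (f b, g b, a b, h b)) (by fun_prop)

theorem Poly.markJoin_tuple : Poly fun b : BinTree × BinTree => markJoin b.1 b.2 := by
  refine Poly.recursion (ds := fun b => bif b.1.isCons && b.2.isCons then
      [(b.1.hd, b.2.hd), (b.1.tl, b.2.tl)] else [])
    (post := fun b => bif b.1.1.isCons && b.1.2.isCons then
      BinTree.cons (CostEnriched.firstD b.2 .nil) (CostEnriched.firstD b.2.tail .nil)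
      else bif b.1.1.isCons then b.1.1 else b.1.2)
    (by fun_prop) (by fun_prop) ?_ (fun b => sz b) .size ?_ ?_
    ((PolyBd.size (β := BinTree × BinTree)).mono ?_)
  · rintro ⟨_ | ⟨a, b⟩, _ | ⟨c, d⟩⟩ <;> simp [CostEnriched.markJoin]
  · rintro ⟨_ | ⟨a, b⟩, _ | ⟨c, d⟩⟩ <;> simp [sz, BinTree.size]
    omega
  · rintro ⟨_ | ⟨a, b⟩, _ | ⟨c, d⟩⟩ <;> simp [sz, BinTree.size]
    omega
  · rintro ⟨m, m'⟩
    induction m generalizing m' with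
    | nil => simp only [CostEnriched.markJoin, sz_pair]; omega
    | cons a b ha hb =>
      cases m' with
      | nil => simp only [CostEnriched.markJoin, sz_pair]; omega
      | cons c d =>
        have h1 := ha c
        have h2 := hb d
        simp only [sz_pair, sz_tree, BinTree.size, CostEnriched.markJoin] at h1 h2 ⊢
        omega

@[fun_prop]
theorem Poly.markJoin {f g : β → BinTree} (hf : Poly f) (hg : Poly g) :
    Poly fun b => CostEnriched.markJoin (f b) (g b) :=
  Poly.markJoin_tuple.comp (f := fun b => (f b, g b)) (hf.pair hg)

theorem Poly.replaceNFT (l : List α) :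
    Poly fun b : RegularExpression α × List α × List BinTree =>
      replaceNFT l b.1 b.2.1 b.2.2 := by
  have hstates : Poly fun b : RegularExpression α × List α × List BinTree =>
      CostEnriched.pairs [true, false] (CostEnriched.pairs b.2.2 b.2.2) := by fun_prop
  refine hstates.pair (Poly.pair (Poly.flatMap (Poly.flatMap ?_ (.const l)) hstates)
    (Poly.pair (by fun_prop) (Poly.pair (Poly.map (by fun_prop) (by fun_prop)) (by fun_prop))))
  unfold replaceSteps
  fun_prop

end

/-! ### `replaceAll`: the bounds -/

section
variable {α : Type*} [TreeEnc α] [InjEnc α] [Fintype α] [DecidableEq α] {k : ℕ}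

theorem ExpBd.comp_le {X Y : Type*} {base : Y → ℕ} {base' : X → ℕ} {h : Y → ℕ}
    (hh : PolyIn base h) {f : X → Y} (hf : ∀ x, base (f x) ≤ base' x) :
    PolyIn base' fun x => h (f x) := by
  obtain ⟨c, hc⟩ := hh
  exact ⟨c, fun x => (hc (f x)).trans (Nat.pow_le_pow_left (Nat.add_le_add_right (hf x) 2) _)⟩

/-- A bound that is polynomial in a polynomially bounded quantity. -/
theorem ExpBd.trans {X Y : Type*} {base : Y → ℕ} {base' : X → ℕ} {h : Y → ℕ}
    (hh : PolyIn base h) {f : X → Y} (hf : PolyIn base' fun x => base (f x)) :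
    PolyIn base' fun x => h (f x) := by
  obtain ⟨c, hc⟩ := hh
  exact ((hf.add (.const 2)).pow _).mono fun x => hc (f x)

theorem polyIn_sz_regex :
    PolyIn (fun e : RegularExpression α => 2 ^ regexSize e) fun e => sz e := by
  obtain ⟨K, hK⟩ := exists_letter_bound α
  exact ((ExpBd.const (K + 20)).mul .base).mono fun e => (sz_regex_le hK e).trans
    (Nat.mul_le_mul_left _ Nat.lt_two_pow_self.le)

theorem polyIn_sz_markings :
    PolyIn (fun e : RegularExpression α => 2 ^ regexSize e) fun e => sz (markings e) := by
  refine ((ExpBd.base.mul (((ExpBd.const 3).mul .base).add (.const 1))).add (.const 1)).mono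
    fun e => (sz_list_le (M := 3 * regexSize e) fun m hm => size_le_of_mem_markings hm).trans ?_
  refine Nat.add_le_add_right (Nat.mul_le_mul (length_markings_le e) ?_) 1
  exact Nat.add_le_add_right (Nat.mul_le_mul_left 3 Nat.lt_two_pow_self.le) 1

/-- The list of the markings is computed in time `2 ^ O(|e|)`. -/
theorem Comp.markings : ∃ t, PolyIn (fun e : RegularExpression α => 2 ^ regexSize e) t ∧
    Comp (markings (α := α)) t := by
  obtain ⟨⟨t, ht, hds⟩, -⟩ : Poly (regexArgs (α := α)) := by fun_prop
  obtain ⟨⟨s, hs, hpost⟩, -⟩ : Poly fun b : RegularExpression α × List (List BinTree) =>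
      bif decide (regexTag b.1 = 2) then [BinTree.nil, .cons .nil .nil] else
      bif decide (regexTag b.1 = 5) then firstD b.2 [] else
      bif decide (regexTag b.1 = 3) || decide (regexTag b.1 = 4) then
        (pairs (firstD b.2 []) (firstD b.2.tail [])).map fun p => BinTree.cons p.1 p.2
      else [BinTree.nil] :=
    .cond (by fun_prop) (by fun_prop) (.cond (by fun_prop) (by fun_prop) (.cond (by fun_prop)
      (.map (by fun_prop) (by fun_prop)) (by fun_prop)))
  have hlist : PolyIn (fun e : RegularExpression α => 2 ^ regexSize e)
      fun e => sz ((regexArgs e).map CostEnriched.markings) := by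
    obtain ⟨c, hc⟩ := polyIn_sz_markings (α := α)
    refine (((ExpBd.const 2).mul ((ExpBd.base.add (.const 2)).pow c)).add (.const 3)).mono
      fun e => ?_
    have h : ∀ d ∈ regexArgs e, sz (CostEnriched.markings d) ≤ (2 ^ regexSize e + 2) ^ c := by
      intro d hd
      refine (hc d).trans ?_
      have h1 := sum_regexSize_args e
      have h2 := List.single_le_sum (by simp) _ (List.mem_map_of_mem (f := regexSize) hd)
      rw [zero_add, mul_one]
      exact Nat.pow_le_pow_left (Nat.add_le_add_right (Nat.pow_le_pow_right (by norm_num)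
        (by omega)) 2) c
    have h2 : (regexArgs e).length ≤ 2 := by cases e <;> simp [regexArgs]
    refine (sz_list_le (M := (2 ^ regexSize e + 2) ^ c) (by simpa using h)).trans ?_
    rw [List.length_map]
    have := Nat.mul_le_mul_right ((2 ^ regexSize e + 2) ^ c + 1) h2
    omega
  obtain ⟨c, hc⟩ := ((ht.comp_polyIn polyIn_sz_regex).add (hs.comp_polyIn
    (f := fun e : RegularExpression α => (e, (regexArgs e).map CostEnriched.markings))
    (((polyIn_sz_regex.add hlist).add (.const 1)).mono fun e => by simp))).add (.const 1)
  simp only [zero_add, mul_one] at hc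
  refine ⟨fun e => regexSize e * (2 ^ regexSize e + 2) ^ c, ?_, Comp.recursion hds hpost ?_ ?_⟩
  · exact (ExpBd.base.mul ((ExpBd.base.add (.const 2)).pow c)).mono fun e =>
      Nat.mul_le_mul_right _ Nat.lt_two_pow_self.le
  · intro e
    cases e <;> simp [CostEnriched.markings, regexTag, regexArgs]
  · intro e
    have h1 : ((regexArgs e).map fun d => regexSize d * (2 ^ regexSize d + 2) ^ c).sum ≤
        ((regexArgs e).map fun d => regexSize d * (2 ^ regexSize e + 2) ^ c).sum := by
      refine List.sum_le_sum fun d hd => Nat.mul_le_mul_left _ (Nat.pow_le_pow_left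
        (Nat.add_le_add_right (Nat.pow_le_pow_right (by norm_num) ?_) 2) c)
      have h1 := sum_regexSize_args e
      have h2 := List.single_le_sum (by simp) _ (List.mem_map_of_mem (f := regexSize) hd)
      omega
    rw [List.sum_map_mul_right] at h1
    have h2 := Nat.mul_le_mul_right ((2 ^ regexSize e + 2) ^ c) (sum_regexSize_args e)
    rw [add_mul, one_mul] at h2
    have h3 := hc e
    omega

/-- The quantity in which the construction for `replaceAll` is polynomial. -/
def replaceBase (X : RegularExpression α × List α × RawCEFA α) : ℕ :=
  2 ^ regexSize X.1 * (sz X.2.2 + 2) ^ (X.2.1.length + 1)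

theorem le_replaceBase (X : RegularExpression α × List α × RawCEFA α) :
    2 ^ regexSize X.1 ≤ replaceBase X ∧ (sz X.2.2 + 2) ^ (X.2.1.length + 1) ≤ replaceBase X ∧
      sz X.2.2 + 2 ≤ replaceBase X ∧ X.2.1.length ≤ replaceBase X := by
  have h1 : (sz X.2.2 + 2) ^ (X.2.1.length + 1) ≤ replaceBase X :=
    Nat.le_mul_of_pos_left _ (by positivity)
  refine ⟨Nat.le_mul_of_pos_right _ (by positivity), h1, ?_, ?_⟩
  · exact (Nat.le_self_pow (by omega) _).trans h1
  · exact (Nat.le_succ _).trans ((le_base_pow (by omega) _).trans h1)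

/-- The transducer for `replaceAll` together with the automaton. -/
noncomputable def replaceData (X : RegularExpression α × List α × RawCEFA α) :
    RawNFT (Bool × BinTree × BinTree) α × RawCEFA α :=
  (replaceNFT Finset.univ.toList X.1 X.2.1 (allMarkings X.1), X.2.2)

theorem Comp.replaceData : (∃ t, PolyIn replaceBase t ∧ Comp (replaceData (α := α)) t) ∧
    PolyIn replaceBase fun X : RegularExpression α × List α × RawCEFA α =>
      productBase (replaceData X) := by
  obtain ⟨K, hK⟩ := exists_letter_bound α
  obtain ⟨⟨t, ht, hT⟩, hT'⟩ := Poly.replaceNFT (α := α) Finset.univ.toList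
  obtain ⟨s, hs, hM⟩ := Comp.markings (α := α)
  have hmark := (polyIn_sz_markings (α := α)).comp_le (base' := replaceBase) (f := Prod.fst)
    fun X => (le_replaceBase X).1
  have hregex := (polyIn_sz_regex (α := α)).comp_le (base' := replaceBase) (f := Prod.fst)
    fun X => (le_replaceBase X).1
  have hword : PolyIn replaceBase fun X : RegularExpression α × List α × RawCEFA α => sz X.2.1 :=
    (((ExpBd.const (K + 1)).mul .base).add (.const 1)).mono fun X => (sz_word_le hK _).trans
      (Nat.add_le_add_right (Nat.mul_le_mul_left _ (le_replaceBase X).2.2.2) 1)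
  have harg : PolyIn replaceBase fun X : RegularExpression α × List α × RawCEFA α =>
      sz (X.1, X.2.1, allMarkings X.1) :=
    (((hregex.add hword).add hmark).add (.const 4)).mono fun X => by
      rw [sz_pair, sz_pair, allMarkings, sz_cons, show sz BinTree.nil = 1 from rfl]
      simp only
      omega
  constructor
  · have hall : Comp (fun X : RegularExpression α × List α × RawCEFA α => allMarkings X.1)
        fun X => s X.1 :=
      (Comp.cons (.const .nil) (hM.comp_const (by fun_prop))).mono 1 fun X => by simp
    refine ⟨_, (ht.comp_polyIn harg).add (hs.comp_le (base' := replaceBase) (f := Prod.fst)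
      fun X => (le_replaceBase X).1), (Comp.pair (hT.comp (Comp.pair_const (by fun_prop)
      (Comp.pair_const (by fun_prop) hall))) (show ConstTime _ by fun_prop)).mono 1 fun X => ?_⟩
    rw [one_mul, add_zero, add_comm (s X.1)]
    exact Nat.le_succ _
  · refine ((hT'.comp_polyIn harg).mul (.pow .base 2)).mono fun X => ?_
    refine Nat.mul_le_mul le_rfl ?_
    have h1 : (CostEnriched.replaceData X).1.maxOut + 1 ≤ (X.2.1.length + 1) * 2 := by
      have := maxOut_replaceNFT_le (l := Finset.univ.toList) (by simp) X.1 X.2.1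
      simp only [CostEnriched.replaceData]
      omega
    refine (Nat.pow_le_pow_right (by omega) h1).trans ?_
    rw [pow_mul]
    exact Nat.pow_le_pow_left (le_replaceBase X).2.1 2

theorem replaceAll_computes : ∃ (P : TreeProgram) (c : ℕ), ∀ (k : ℕ) (A : CEFA α k)
    (e : RegularExpression α) (u : List α),
    ComputesRep enc P
      (.cons (encRegex enc e) (.cons (encString enc u) (encCEFA enc A)))
      (replaceAllFun e u) Set.univ A.lang
      (2 ^ (c * regexSize e) * (A.fullSize + 1) ^ (c * (u.length + 1))) := by
  classical
  obtain ⟨⟨t, ht, hcomp⟩, hsz⟩ := Comp.productRep (α := α) (σ := Bool × BinTree × BinTree)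
  obtain ⟨⟨s, hs, hdata⟩, hbase⟩ := Comp.replaceData (α := α)
  obtain ⟨P, c, h⟩ := (hcomp.comp hdata).computesRep
  obtain ⟨d, hd⟩ := ((ExpBd.const c).mul ((hs.add (ht.trans hbase)).add (.const 1))).add
    ((ExpBd.const 30).mul (hsz.trans hbase))
  obtain ⟨K, hK⟩ := exists_letter_bound α
  refine ⟨P, 2 * d * (K + 102), fun k A e u => ?_⟩
  have hb : c * (s (e, u, A.raw) + t (replaceData (e, u, A.raw)) + 1) +
      30 * sz (productRep (replaceData (e, u, A.raw))) ≤
      2 ^ (2 * d * (K + 102) * regexSize e) *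
        (A.fullSize + 1) ^ (2 * d * (K + 102) * (u.length + 1)) := by
    refine (hd (e, u, A.raw)).trans ?_
    have h2 : 2 ≤ replaceBase (e, u, A.raw) := le_trans (by omega) (le_replaceBase _).2.2.1
    have h3 : replaceBase (e, u, A.raw) + 2 ≤ replaceBase (e, u, A.raw) ^ 2 := by nlinarith
    have h4 : replaceBase (e, u, A.raw) ≤
        2 ^ regexSize e * (A.fullSize + 1) ^ ((K + 102) * (u.length + 1)) := by
      rw [pow_mul]
      exact Nat.mul_le_mul_left _ (Nat.pow_le_pow_left (A.sz_raw_add_two_le hK) _)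
    rw [zero_add, mul_one]
    calc (replaceBase (e, u, A.raw) + 2) ^ d
        ≤ ((2 ^ regexSize e * (A.fullSize + 1) ^ ((K + 102) * (u.length + 1))) ^ 2) ^ d :=
          Nat.pow_le_pow_left (h3.trans (Nat.pow_le_pow_left h4 2)) d
      _ = 2 ^ (2 * d * 1 * regexSize e) *
          (A.fullSize + 1) ^ (2 * d * (K + 102) * (u.length + 1)) := by
          rw [← pow_mul, mul_pow, ← pow_mul, ← pow_mul]
          ring_nf
      _ ≤ _ := Nat.mul_le_mul_right _ (Nat.pow_le_pow_right (by norm_num)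
          (Nat.mul_le_mul_right _ (Nat.mul_le_mul_left _ (by omega))))
  rw [← CEFA.enc_raw]
  have hl : ∀ a : α, a ∈ (Finset.univ : Finset α).toList := by simp
  refine h (e, u, A.raw) (singleRep (product (replaceNFT Finset.univ.toList e u (allMarkings e)) A))
    (productRaw_eq _ _) ?_ ?_ ?_
  · refine singleRep_represents (f := fun w v => v = replaceAll e.matches' u w)
      (fun w v v' h h' => h.trans h'.symm) fun w d => ?_
    rw [mem_lang_product (replaceNFT_wf hl e u)]
    simp only [replaceNFT_rel hl]
  · exact (fullSize_singleRep_product_le _ _).trans (le_trans (Nat.le_add_left _ _) hb)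
  · exact le_trans (Nat.le_add_right _ _) hb

end

/-! ### Definability from representations -/

theorem PreimageRep.isCERR_rel {α : Type*} {l k : ℕ} {ks : Fin l → ℕ} (B : PreimageRep α ks k) :
    IsCERR B.rel := by
  refine ⟨B.disjuncts.length, fun i j => (B.disjuncts.get i j).lang, fun i j => ⟨_, rfl⟩, ?_⟩
  ext x
  simp [PreimageRep.rel, List.mem_iff_get]

theorem ComputesRep.definable {α : Type*} {code : α → BinTree} {P : TreeProgram} {x : BinTree}
    {l k : ℕ} {ks : Fin l → ℕ} {f : StrFun α ks} {D : Set (Args α ks)}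
    {L : Set (List α × (Fin k → ℤ))} {b : ℕ} (h : ComputesRep code P x f D L b) :
    CERRDefinable f D L :=
  let ⟨B, hB, _⟩ := h
  ⟨B.rel, B.terms, B.isCERR_rel, hB⟩

end CostEnriched

theorem proposition1 {α : Type*} [Fintype α] (code : α → BinTree) (hcode : Function.Injective code) :
    -- definability of the pre-images
    (∀ (k : ℕ) (L : Set (List α × (Fin k → ℤ))), IsCERL L →
      CERRDefinable (concatFun α) Set.univ L ∧
      CERRDefinable (reverseFun α) Set.univ L ∧
      CERRDefinable (substringFun α) (substringDom α) L ∧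
      (∀ T : NFT α, T.Functional → CERRDefinable T.toFun Set.univ L) ∧
      (∀ (e : RegularExpression α) (u : List α), [] ∉ e.matches' →
        CERRDefinable (replaceAllFun e u) Set.univ L)) ∧
    -- concatenation: quadratic time
    (∃ (P : TreeProgram) (c : ℕ), ∀ (k : ℕ) (A : CEFA α k),
      ComputesRep code P (encCEFA code A) (concatFun α) Set.univ A.lang
        (c * A.fullSize ^ 2)) ∧
    -- reverse: linear time
    (∃ (P : TreeProgram) (c : ℕ), ∀ (k : ℕ) (A : CEFA α k),
      ComputesRep code P (encCEFA code A) (reverseFun α) Set.univ A.lang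
        (c * A.fullSize)) ∧
    -- substring: linear time
    (∃ (P : TreeProgram) (c : ℕ), ∀ (k : ℕ) (A : CEFA α k),
      ComputesRep code P (encCEFA code A) (substringFun α) (substringDom α) A.lang
        (c * A.fullSize)) ∧
    -- functional finite transducers: polynomial in the automaton, exponential in the transducer
    (∃ (P : TreeProgram) (c : ℕ), ∀ (k : ℕ) (A : CEFA α k) (T : NFT α), T.Functional →
      ComputesRep code P (.cons (encNFT code T) (encCEFA code A)) T.toFun Set.univ A.lang
        ((A.fullSize + 1) ^ (c * T.fullSize))) ∧
    -- replaceAll: polynomial in the automaton, exponential in the pattern and the replacement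
    (∃ (P : TreeProgram) (c : ℕ), ∀ (k : ℕ) (A : CEFA α k) (e : RegularExpression α)
        (u : List α), [] ∉ e.matches' →
      ComputesRep code P
        (.cons (encRegex code e) (.cons (encString code u) (encCEFA code A)))
        (replaceAllFun e u) Set.univ A.lang
        (2 ^ (c * regexSize e) * (A.fullSize + 1) ^ (c * (u.length + 1)))) := by
  classical
  let _ : TreeEnc α := ⟨code⟩
  have _ : InjEnc α := ⟨hcode⟩
  have hconcat := concat_computes (α := α)
  have hreverse := reverse_computes (α := α)
  have hsubstring := substring_computes (α := α)
  have htransducer := transducer_computes (α := α)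
  have hreplace := replaceAll_computes (α := α)
  refine ⟨?_, hconcat, hreverse, hsubstring, htransducer, ?_⟩
  · rintro k _ ⟨A, rfl⟩
    obtain ⟨_, _, h₁⟩ := hconcat
    obtain ⟨_, _, h₂⟩ := hreverse
    obtain ⟨_, _, h₃⟩ := hsubstring
    obtain ⟨_, _, h₄⟩ := htransducer
    obtain ⟨_, _, h₅⟩ := hreplace
    exact ⟨(h₁ k A).definable, (h₂ k A).definable, (h₃ k A).definable,
      fun T hT => (h₄ k A T hT).definable, fun e u _ => (h₅ k A e u).definable⟩
  · obtain ⟨P, c, h⟩ := hreplace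
    exact ⟨P, c, fun k A e u _ => h k A e u⟩
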